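/- **Proposition (Bulk scaling asymptotics).** *Notation.* For $f:[-2,2]\to\mathbb R$ put $$\langle f\rangle_{sc}=\int_{-2}^2 f(x)\frac{\sqrt{4-x^2}}{2\pi}\,dx,\qquad \langle f\rangle_{1/sc}=\int_{-2}^2\frac{f(x)}{\pi\sqrt{4-x^2}}\,dx ,$$ $$V_{tr}^1(f)=\frac1{4\pi^2}\iint_{[-2,2]^2}\Bigl(\frac{f(x)-f(y)}{x-y}\Bigr)^2\frac{4-xy}{\sqrt{(4-x^2)(4-y^2)}}\,dx\,dy,\qquad V_d^1(f)=\langle f^2\rangle_{sc}-\langle f\rangle_{sc}^2,$$ and, for $|\sigma|<1$, $$V_{tr}^2(f,\sigma)=\frac1{4\pi^2}\iint_{[-2,2]^2} f(x)f(y)\,\partial_x\partial_y\log\left[\frac{(x-\sigma y)^2+(\sqrt{4-x^2}+\sigma\sqrt{4-y^2})^2}{(x-\sigma y)^2+(\sqrt{4-x^2}-\sigma\sqrt{4-y^2})^2}\right]dx\,dy,$$ $$V_d^2(f,\sigma)=\frac1{4\pi^2}\iint_{[-2,2]^2} f(x)f(y)\frac{(1-\sigma^2)\sqrt{(4-x^2)(4-y^2)}}{\sigma^2(x^2+y^2)+(1-\sigma^2)^2-xy\sigma(1+\sigma^2)}\,dx\,dy-\langle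 f\rangle_{sc}^2,$$ $$E_{tr}(f,\sigma)=\Bigl\langle f\Bigl(1-\frac{1-\sigma^2}{(1+\sigma)^2-\sigma x^2}\Bigr)\Bigr\rangle_{1/sc};$$ at $\sigma=\pm1$ the last three are defined as the limits for $\sigma\to\pm1$ from inside $(-1,1)$. Let $m_{sc}(z)=\int_{-2}^2\frac{\sqrt{4-x^2}}{2\pi(x-z)}\,dx$, $\rho(z)=\frac1\pi|\operatorname{Im} m_{sc}(z)|$ and $C_N=C_N^{a,E}=N^a/\rho(E+iN^{-a})$ for $a>0$. Let $\langle f,g\rangle_{L^2}=\int_{\mathbb R} fg$ and $\langle f,g\rangle_{\dot H^{1/2}}=\iint_{\mathbb R^2}\frac{f(x)-f(y)}{x-y}\,\frac{g(x)-g(y)}{x-y}\,dx\,dy$, and write $g^-(x)=g(-x)$. *Statement.* Fix $a\in(0,1)$, $\epsilon>0$, $\delta>0$, $M$ and $R$. There is a constant $C=C(a,\epsilon,\delta,M,R)$ such that the following holds for every real-valued $g\in H^2(\mathbb R)$ (continuous representative) with $\operatorname{supp} g\subset[-R,R]$ and $\|g\|_{H^2}\le M$, every integer $N\ge1$ and every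 real $E$ with $|E|\le 2-\epsilon$. Put $f(x)=g(N^a(x-E))$. The limits defining $V_{tr}^2$, $V_d^2$, $E_{tr}$ at $\sigma=\pm1$ exist. With $O(N^{-a})$ denoting a quantity of absolute value at most $CN^{-a}$, $$V_{tr}^1(f)=\frac{\|g\|_{\dot H^{1/2}}^2}{4\pi^2}+O(N^{-a}),\qquad C_NV_d^1(f)=\|g\|_{L^2}^2+O(N^{-a}).$$ Moreover, let $\sigma\in[-1,1]$ be such that $\sigma=-1$ or $\sigma\ge-1+\delta$, and, in case $\sigma=-1$, assume that $E=0$ or $|E|\ge\delta$. Then $$-\tfrac12E_{tr}(f,\sigma)=\mathbf 1(\sigma=-1)\mathbf 1(E=0)\frac{g(0)}2+O(N^{-a}),$$ and, if in addition $\sigma=1$ or $\sigma\le1-\delta$, $$V_{tr}^2(f,\sigma)=\mathbf 1(\sigma=1)\frac{\|g\|_{\dot H^{1/2}}^2}{4\pi^2}+\mathbf 1(\sigma=-1)\mathbf 1(E=0)\frac{\langle g,g^-\rangle_{\dot H^{1/2}}}{4\pi^2}+O(N^{-a}),$$ $$C_NV_d^2(f,\sigma)=\mathbf 1(\sigma=1)\|g\|_{L^2}^2+\mathbf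 1(\sigma=-1)\mathbf 1(E=0)\langle g,g^-\rangle_{L^2}+O(N^{-a}).$$ -/

import Mathlib

open Real Set Filter Topology MeasureTheory
open scoped ContDiff

namespace WignerMeso

noncomputable section

/-! ### The Sobolev space `H²(ℝ)` -/

/-- `g'` is a weak derivative of `g` on `ℝ`, tested against all `φ ∈ C_c^∞(ℝ)`. -/
def HasWeakDeriv (g g' : ℝ → ℝ) : Prop :=
  ∀ φ : ℝ → ℝ, ContDiff ℝ ∞ φ → HasCompactSupport φ →
    ∫ x, g x * deriv φ x = -∫ x, g' x * φ x

/-- `g` is (the continuous representative of) an element of the real Sobolev space `H²(ℝ)`, with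
first and second weak derivatives `g₁` and `g₂`. -/
structure IsH2 (g g₁ g₂ : ℝ → ℝ) : Prop where
  continuous : Continuous g
  memLp : MemLp g 2 volume
  memLp_fst : MemLp g₁ 2 volume
  memLp_snd : MemLp g₂ 2 volume
  weakDeriv_fst : HasWeakDeriv g g₁
  weakDeriv_snd : HasWeakDeriv g₁ g₂

/-- The `H²` norm of a function with weak derivatives `g₁` and `g₂`. -/
def h2Norm (g g₁ g₂ : ℝ → ℝ) : ℝ :=
  √((∫ x, g x ^ 2) + (∫ x, g₁ x ^ 2) + ∫ x, g₂ x ^ 2)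

/-! ### The `L²` and homogeneous `H^{1/2}` inner products -/

/-- `⟨f, g⟩_{L²}`. -/
def innerL2 (f g : ℝ → ℝ) : ℝ := ∫ x, f x * g x

/-- `⟨f, g⟩_{Ḣ^{1/2}}`. -/
def innerHhalf (f g : ℝ → ℝ) : ℝ :=
  ∫ p : ℝ × ℝ, (f p.1 - f p.2) / (p.1 - p.2) * ((g p.1 - g p.2) / (p.1 - p.2))

/-- The reflection `x ↦ g (-x)`. -/
def reflect (g : ℝ → ℝ) : ℝ → ℝ := fun x => g (-x)

/-! ### The semicircle law and the scaling -/

/-- The semicircular density on `[-2, 2]`. -/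
def rhoSc (x : ℝ) : ℝ := √(4 - x ^ 2) / (2 * π)

/-- `⟨f⟩_sc`. -/
def avgSc (f : ℝ → ℝ) : ℝ := ∫ x in (-2 : ℝ)..2, f x * (√(4 - x ^ 2) / (2 * π))

/-- `⟨f⟩_{1/sc}`. -/
def avgInvSc (f : ℝ → ℝ) : ℝ := ∫ x in (-2 : ℝ)..2, f x / (π * √(4 - x ^ 2))

/-- The Stieltjes transform of the semicircle law (for `z ∉ ℝ`). -/
def mSc (z : ℂ) : ℂ := ∫ x in (-2 : ℝ)..2, (rhoSc x : ℂ) / ((x : ℂ) - z)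

/-- `ρ(z) = |Im m_sc(z)| / π`. -/
def rhoC (z : ℂ) : ℝ := |(mSc z).im| / π

/-- `ρ_N^{a,E}`. -/
def rhoN (N : ℕ) (a E : ℝ) : ℝ :=
  if 0 < a then rhoC ((E : ℂ) + (((N : ℝ) ^ (-a) : ℝ) : ℂ) * Complex.I) else 1

/-- The scaling factor `C_N^{a,E} = N^a / ρ_N^{a,E}`. -/
def CN (N : ℕ) (a E : ℝ) : ℝ := (N : ℝ) ^ a / rhoN N a E

/-- The rescaled test function `f(x) = g(N^a (x - E))`. -/
def rescale (N : ℕ) (a E : ℝ) (g : ℝ → ℝ) : ℝ → ℝ := fun x => g ((N : ℝ) ^ a * (x - E))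

/-! ### The variances and the expectation correction -/

/-- The square `[-2, 2]²`. -/
def square : Set (ℝ × ℝ) := Icc (-2) 2 ×ˢ Icc (-2) 2

/-- `V_tr^1(f)`. -/
def Vtr1 (f : ℝ → ℝ) : ℝ :=
  1 / (4 * π ^ 2) * ∫ p in square,
    ((f p.1 - f p.2) / (p.1 - p.2)) ^ 2 *
      ((4 - p.1 * p.2) / √((4 - p.1 ^ 2) * (4 - p.2 ^ 2)))

/-- The logarithm whose mixed second derivative is the kernel of `V_tr^2`. -/
def logKernel (σ x y : ℝ) : ℝ :=
  Real.log (((x - σ * y) ^ 2 + (√(4 - x ^ 2) + σ * √(4 - y ^ 2)) ^ 2) /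
    ((x - σ * y) ^ 2 + (√(4 - x ^ 2) - σ * √(4 - y ^ 2)) ^ 2))

/-- The formula for `V_tr^2(f, σ)`, valid for `|σ| < 1`. -/
def Vtr2Interior (f : ℝ → ℝ) (σ : ℝ) : ℝ :=
  1 / (4 * π ^ 2) * ∫ p in square,
    f p.1 * f p.2 * deriv (fun x => deriv (fun y => logKernel σ x y) p.2) p.1

/-- `V_d^1(f)`. -/
def Vd1 (f : ℝ → ℝ) : ℝ := avgSc (fun x => f x ^ 2) - avgSc f ^ 2

/-- The formula for `V_d^2(f, σ)`, valid for `|σ| < 1`. -/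
def Vd2Interior (f : ℝ → ℝ) (σ : ℝ) : ℝ :=
  1 / (4 * π ^ 2) * (∫ p in square,
    f p.1 * f p.2 * ((1 - σ ^ 2) * √((4 - p.1 ^ 2) * (4 - p.2 ^ 2)) /
      (σ ^ 2 * (p.1 ^ 2 + p.2 ^ 2) + (1 - σ ^ 2) ^ 2 - p.1 * p.2 * σ * (1 + σ ^ 2)))) -
    avgSc f ^ 2

/-- The formula for `E_tr(f, σ)`, valid for `|σ| < 1`. -/
def EtrInterior (f : ℝ → ℝ) (σ : ℝ) : ℝ :=
  avgInvSc (fun x => f x * (1 - (1 - σ ^ 2) / ((1 + σ) ^ 2 - σ * x ^ 2)))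

/-- The extension of a function of `σ ∈ (-1, 1)` to `σ = ±1` by its one-sided limits. -/
def extendToEndpoints (F : ℝ → ℝ) (σ : ℝ) : ℝ :=
  if σ = 1 then limUnder (𝓝[<] (1 : ℝ)) F
  else if σ = -1 then limUnder (𝓝[>] (-1 : ℝ)) F
  else F σ

/-- `V_tr^2(f, σ)` for `σ ∈ [-1, 1]`. -/
def Vtr2 (f : ℝ → ℝ) (σ : ℝ) : ℝ := extendToEndpoints (Vtr2Interior f) σ

/-- `V_d^2(f, σ)` for `σ ∈ [-1, 1]`. -/
def Vd2 (f : ℝ → ℝ) (σ : ℝ) : ℝ := extendToEndpoints (Vd2Interior f) σ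

/-- `E_tr(f, σ)` for `σ ∈ [-1, 1]`. -/
def Etr (f : ℝ → ℝ) (σ : ℝ) : ℝ := extendToEndpoints (EtrInterior f) σ

/-- The limits of `F` at `σ → ±1` from inside `(-1, 1)` exist (and are finite). -/
def HasEndpointLimits (F : ℝ → ℝ) : Prop :=
  (∃ l : ℝ, Tendsto F (𝓝[<] (1 : ℝ)) (𝓝 l)) ∧ ∃ l : ℝ, Tendsto F (𝓝[>] (-1 : ℝ)) (𝓝 l)

/-- The indicator of a proposition, as a real number. -/
def ind (p : Prop) [Decidable p] : ℝ := if p then 1 else 0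

end

end WignerMeso

/-! Of the H² hypothesis only this survives: g is bounded and Lipschitz with constants depending on
M and R, and supported in a fixed interval (`IsH2.testFn`). With n = N^a, the function f lives on a
window of radius R/n around E. For n ≥ 2R/ε this window stays in the bulk, where √(4 - x²) is
bounded below; for smaller n, a bound not involving the window is already O(1/n).

The endpoints σ = ±1 are handled through the marginals of the kernels. The kernel of V_tr^2 is a
total derivative of a function vanishing at ±2, so its marginals are zero (`integral_trKernel`). The
kernel of V_d^2 is the imaginary part of a Stieltjes integrand, so its marginals are 2π√(4 - x²)
(`integral_dKernel`). A symmetric kernel is then split by `integral_bilinear_eq` into a marginal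
term and a form in the increments of f and h. The product of two increments is O((x - y)²), which
compensates the denominator uniformly as σ → 1. Hence V_tr^2 tends to the polarized V_tr^1
(`tendsto_trForm`), and V_d^2 before subtracting the squared mean tends to ⟨fh⟩_sc
(`tendsto_dForm`). The sign change σ ↦ -σ amounts to y ↦ -y, so σ → -1 is the same limit with h the
reflection of f. In E_tr the subtracted weight is a probability density that concentrates at 0 as σ
→ -1 and at ±2 as σ → 1.

It remains to find the size of these limits. The Ḣ^{1/2} form is scale invariant, and the weight (4
- xy)/√((4 - x²)(4 - y²)) differs from 1 by a multiple of (x - y)², which cancels the singularity;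
the error is therefore an integral over a window, of size O(1/n) (`exists_trLimit_sub_le`). For V_d
the density √(4 - x²)/(2π) and ρ_N agree up to O(1/n) on the window (`exists_variance_le`). For σ =
-1 and |E| ≥ δ the window and its reflection are a fixed distance apart, so nothing of order one
remains. For |σ| ≤ 1 - δ the kernels have no diagonal singularity, and counting the size of the
windows suffices. -/

namespace WignerMeso

noncomputable section

/-! ### The kernels -/

/-- The edge factor `√(4 - x²)`. -/
def edge (x : ℝ) : ℝ := √(4 - x ^ 2)

/-- The common denominator of the kernels of `V_tr^2` and `V_d^2`. -/
def den (σ x y : ℝ) : ℝ :=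
  σ ^ 2 * (x ^ 2 + y ^ 2) + (1 - σ ^ 2) ^ 2 - x * y * σ * (1 + σ ^ 2)

/-- The kernel of `V_tr^2` on the open square. -/
def trKernel (σ x y : ℝ) : ℝ :=
  σ / (edge x * edge y) * (((1 + σ ^ 2) * (x * y) - 8 * σ) / den σ x y +
    σ * (1 - σ ^ 2) ^ 2 * ((4 - x ^ 2) * (4 - y ^ 2)) / den σ x y ^ 2)

/-- The kernel of `V_d^2`. -/
def dKernel (σ x y : ℝ) : ℝ := (1 - σ ^ 2) * (edge x * edge y) / den σ x y

lemma edge_nonneg (x : ℝ) : 0 ≤ edge x := Real.sqrt_nonneg _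

lemma edge_neg (x : ℝ) : edge (-x) = edge x := by simp [edge]

lemma continuous_edge : Continuous edge := by unfold edge; fun_prop

lemma edge_pos {x : ℝ} (hx : x ∈ Ioo (-2 : ℝ) 2) : 0 < edge x :=
  Real.sqrt_pos.2 (by nlinarith [hx.1, hx.2])

lemma edge_sq {x : ℝ} (hx : x ∈ Icc (-2 : ℝ) 2) : edge x ^ 2 = 4 - x ^ 2 :=
  Real.sq_sqrt (by nlinarith [hx.1, hx.2])

lemma edge_le_two (x : ℝ) : edge x ≤ 2 := by
  refine (Real.sqrt_le_sqrt (show 4 - x ^ 2 ≤ 2 ^ 2 by nlinarith [sq_nonneg x])).trans ?_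
  rw [Real.sqrt_sq (by norm_num)]

lemma edge_eq_zero_of_notMem {x : ℝ} (hx : x ∉ Ioo (-2 : ℝ) 2) : edge x = 0 := by
  refine Real.sqrt_eq_zero_of_nonpos ?_
  by_contra! h
  exact hx ⟨by nlinarith, by nlinarith⟩

lemma hasDerivAt_edge {x : ℝ} (hx : x ∈ Ioo (-2 : ℝ) 2) :
    HasDerivAt edge (-(x / edge x)) x := by
  have h := ((hasDerivAt_pow 2 x).const_sub 4).sqrt (by nlinarith [hx.1, hx.2])
  have : edge x ≠ 0 := (edge_pos hx).ne'
  refine h.congr_deriv ?_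
  change _ / (2 * edge x) = _
  field_simp
  simp

lemma den_symm (σ x y : ℝ) : den σ x y = den σ y x := by unfold den; ring

lemma den_neg (σ x y : ℝ) : den (-σ) x y = den σ x (-y) := by unfold den; ring

lemma trKernel_symm (σ x y : ℝ) : trKernel σ x y = trKernel σ y x := by
  unfold trKernel; rw [den_symm σ x y, mul_comm (edge x)]; ring

lemma trKernel_neg (σ x y : ℝ) : trKernel (-σ) x y = trKernel σ x (-y) := by
  unfold trKernel; rw [den_neg, edge_neg]; ring

lemma dKernel_symm (σ x y : ℝ) : dKernel σ x y = dKernel σ y x := by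
  unfold dKernel; rw [den_symm σ x y, mul_comm (edge x)]

lemma dKernel_neg (σ x y : ℝ) : dKernel (-σ) x y = dKernel σ x (-y) := by
  unfold dKernel; rw [den_neg, edge_neg]; ring

/-- The two sides differ by (1 - σ)² σ (4 - xy). The first term on the left serves the limit σ → 1
off the diagonal, the second gives positivity for fixed σ < 1. -/
lemma den_ge {σ x y : ℝ} (hσ : 0 ≤ σ) (hx : x ∈ Icc (-2 : ℝ) 2) (hy : y ∈ Icc (-2 : ℝ) 2) :
    σ ^ 2 * (x - y) ^ 2 + (1 - σ) ^ 4 ≤ den σ x y := by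
  have h : x * y ≤ 4 := by nlinarith [hx.1, hx.2, hy.1, hy.2, sq_nonneg (x - y)]
  have : 0 ≤ (1 - σ) ^ 2 * (σ * (4 - x * y)) := by
    have : 0 ≤ 4 - x * y := by linarith
    positivity
  unfold den
  nlinarith

lemma den_ge_pow {σ x y : ℝ} (hx : x ∈ Icc (-2 : ℝ) 2) (hy : y ∈ Icc (-2 : ℝ) 2) :
    (1 - |σ|) ^ 4 ≤ den σ x y := by
  rcases le_total 0 σ with h | h
  · rw [abs_of_nonneg h]
    have := den_ge h hx hy
    nlinarith [mul_nonneg (sq_nonneg σ) (sq_nonneg (x - y))]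
  · rw [abs_of_nonpos h, ← neg_neg σ, den_neg, neg_neg]
    have := den_ge (neg_nonneg.2 h) hx (y := -y) ⟨by linarith [hy.2], by linarith [hy.1]⟩
    nlinarith [mul_nonneg (sq_nonneg (-σ)) (sq_nonneg (x - -y))]

lemma den_pos {σ x y : ℝ} (hσ : |σ| < 1) (hx : x ∈ Icc (-2 : ℝ) 2) (hy : y ∈ Icc (-2 : ℝ) 2) :
    0 < den σ x y :=
  lt_of_lt_of_le (by have : 0 < 1 - |σ| := by linarith
                     positivity) (den_ge_pow hx hy)

/-- Completing the square in x: the difference of the two sides is (2σx - (1 + σ²)y)². -/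
lemma sq_mul_le_den (σ x y : ℝ) : (1 - σ ^ 2) ^ 2 * (4 - y ^ 2) ≤ 4 * den σ x y := by
  unfold den
  nlinarith [sq_nonneg (2 * σ * x - (1 + σ ^ 2) * y)]

/-- One of the two powers of the denominator in the second term is absorbed by `sq_mul_le_den`. A
single power is what the (x - y)² coming from two Lipschitz increments can compensate. -/
lemma abs_trKernel_le {σ x y : ℝ} (hσ : |σ| < 1) (hx : x ∈ Ioo (-2 : ℝ) 2)
    (hy : y ∈ Ioo (-2 : ℝ) 2) :
    |trKernel σ x y| ≤ 32 / den σ x y * ((edge x)⁻¹ * (edge y)⁻¹) := by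
  have hD := den_pos hσ (Ioo_subset_Icc_self hx) (Ioo_subset_Icc_self hy)
  have h1 := edge_pos hx
  have h2 := edge_pos hy
  set D := den σ x y with hDdef
  have e : trKernel σ x y = σ * ((1 + σ ^ 2) * (x * y) - 8 * σ +
      σ * ((1 - σ ^ 2) ^ 2 * ((4 - x ^ 2) * (4 - y ^ 2)) / D)) / D *
      ((edge x)⁻¹ * (edge y)⁻¹) := by
    unfold trKernel
    rw [← hDdef]
    field_simp
  rw [e, abs_mul, abs_of_pos (a := (edge x)⁻¹ * (edge y)⁻¹) (by positivity), abs_div,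
    abs_of_pos hD]
  refine mul_le_mul_of_nonneg_right ?_ (by positivity)
  refine div_le_div_of_nonneg_right ?_ hD.le
  have hq : (1 - σ ^ 2) ^ 2 * ((4 - x ^ 2) * (4 - y ^ 2)) / D ≤ 16 := by
    rw [div_le_iff₀ hD]
    have := sq_mul_le_den σ x y
    have hx4 : 0 ≤ 4 - x ^ 2 := by nlinarith [hx.1, hx.2]
    have hx4' : 4 - x ^ 2 ≤ 4 := by nlinarith
    calc _ = (4 - x ^ 2) * ((1 - σ ^ 2) ^ 2 * (4 - y ^ 2)) := by ring
      _ ≤ (4 - x ^ 2) * (4 * D) := by gcongr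
      _ ≤ 4 * (4 * D) := by gcongr
      _ = _ := by ring
  have hq0 : 0 ≤ (1 - σ ^ 2) ^ 2 * ((4 - x ^ 2) * (4 - y ^ 2)) / D := by
    have hx4 : 0 ≤ 4 - x ^ 2 := by nlinarith [hx.1, hx.2]
    have hy4 : 0 ≤ 4 - y ^ 2 := by nlinarith [hy.1, hy.2]
    positivity
  set q := (1 - σ ^ 2) ^ 2 * ((4 - x ^ 2) * (4 - y ^ 2)) / D
  have hxy : |x * y| ≤ 4 := by
    rw [abs_mul]
    have := abs_le.2 ⟨hx.1.le, hx.2.le⟩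
    have := abs_le.2 ⟨hy.1.le, hy.2.le⟩
    nlinarith [abs_nonneg x, abs_nonneg y]
  have hs2 : σ ^ 2 ≤ 1 := by rw [sq_le_one_iff_abs_le_one]; exact hσ.le
  rw [abs_mul]
  have hb : |(1 + σ ^ 2) * (x * y) - 8 * σ + σ * q| ≤ 32 := by
    have h3 : |(1 + σ ^ 2) * (x * y)| ≤ 8 := by
      rw [abs_mul, abs_of_nonneg (by positivity : 0 ≤ 1 + σ ^ 2)]
      nlinarith [abs_nonneg (x * y)]
    -- Since q lies in [0, 16], pairing it with the -8 centres it.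
    have h4 : |σ * (q - 8)| ≤ 8 := by
      rw [abs_mul]
      have : |q - 8| ≤ 8 := abs_le.2 ⟨by linarith, by linarith⟩
      nlinarith [abs_nonneg σ, abs_nonneg (q - 8)]
    calc _ = |(1 + σ ^ 2) * (x * y) + σ * (q - 8)| := by ring_nf
      _ ≤ _ := abs_add_le _ _
      _ ≤ 32 := by linarith
  nlinarith [abs_nonneg σ, abs_nonneg ((1 + σ ^ 2) * (x * y) - 8 * σ + σ * q)]

/-- After expanding the edge squares, numerator A and denominator B inside the logarithm differ only
in the sign of 2σ·`edge x`·`edge y`, and AB = 16 `den σ x y`. The derivative is (A'B - AB')/(AB). -/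
lemma hasDerivAt_logKernel_snd {σ x y : ℝ} (hσ : |σ| < 1) (hx : x ∈ Icc (-2 : ℝ) 2)
    (hy : y ∈ Ioo (-2 : ℝ) 2) :
    HasDerivAt (fun y => logKernel σ x y)
      (σ * edge x / edge y * (2 * σ * x - (1 + σ ^ 2) * y) / den σ x y) y := by
  have hy' := Ioo_subset_Icc_self hy
  have hD := den_pos hσ hx hy'
  have hX := edge_sq hx
  have hY := edge_sq hy'
  have hYp := edge_pos hy
  have hds := hasDerivAt_edge hy
  have hlin : HasDerivAt (fun y : ℝ => (x - σ * y) ^ 2) (2 * (x - σ * y) * (-σ)) y := by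
    have := (((hasDerivAt_id y).const_mul σ).const_sub x).fun_pow 2
    simpa using this
  have hA : HasDerivAt (fun y : ℝ => (x - σ * y) ^ 2 + (edge x + σ * edge y) ^ 2)
      (2 * (x - σ * y) * (-σ) + 2 * (edge x + σ * edge y) * (σ * -(y / edge y))) y := by
    have := hlin.fun_add (((hds.const_mul σ).const_add (edge x)).fun_pow 2)
    simpa using this
  have hB : HasDerivAt (fun y : ℝ => (x - σ * y) ^ 2 + (edge x - σ * edge y) ^ 2)
      (2 * (x - σ * y) * (-σ) + 2 * (edge x - σ * edge y) * (-(σ * -(y / edge y)))) y := by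
    have := hlin.fun_add (((hds.const_mul σ).const_sub (edge x)).fun_pow 2)
    simpa using this
  have eA : (x - σ * y) ^ 2 + (edge x + σ * edge y) ^ 2 =
      4 + 4 * σ ^ 2 - 2 * σ * (x * y) + 2 * σ * (edge x * edge y) := by
    linear_combination hX + σ ^ 2 * hY
  have eB : (x - σ * y) ^ 2 + (edge x - σ * edge y) ^ 2 =
      4 + 4 * σ ^ 2 - 2 * σ * (x * y) - 2 * σ * (edge x * edge y) := by
    linear_combination hX + σ ^ 2 * hY
  have hAB : ((x - σ * y) ^ 2 + (edge x + σ * edge y) ^ 2) *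
      ((x - σ * y) ^ 2 + (edge x - σ * edge y) ^ 2) = 16 * den σ x y := by
    rw [eA, eB]
    unfold den
    linear_combination (-4 * σ ^ 2) * (edge y ^ 2 * hX + (4 - x ^ 2) * hY)
  have hA0 : (x - σ * y) ^ 2 + (edge x + σ * edge y) ^ 2 ≠ 0 := by
    intro h; rw [h] at hAB; linarith
  have hB0 : (x - σ * y) ^ 2 + (edge x - σ * edge y) ^ 2 ≠ 0 := by
    intro h; rw [h] at hAB; linarith
  have h := (hA.fun_div hB hB0).log (div_ne_zero hA0 hB0)
  refine h.congr_deriv ?_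
  set A := (x - σ * y) ^ 2 + (edge x + σ * edge y) ^ 2
  set B := (x - σ * y) ^ 2 + (edge x - σ * edge y) ^ 2
  have hD' : den σ x y = A * B / 16 := by rw [hAB]; ring
  have hY0 := hYp.ne'
  rw [hD']
  have hA' : 2 * (x - σ * y) * (-σ) + 2 * (edge x + σ * edge y) * (σ * -(y / edge y)) =
      -2 * σ * x - 2 * σ * edge x * (y / edge y) := by
    field_simp; ring
  have hB' : 2 * (x - σ * y) * (-σ) + 2 * (edge x - σ * edge y) * (-(σ * -(y / edge y))) =
      -2 * σ * x + 2 * σ * edge x * (y / edge y) := by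
    field_simp; ring
  rw [hA', hB']
  have key : (-2 * σ * x - 2 * σ * edge x * (y / edge y)) * B -
      A * (-2 * σ * x + 2 * σ * edge x * (y / edge y)) =
      16 * (σ * edge x / edge y * (2 * σ * x - (1 + σ ^ 2) * y)) := by
    rw [eA, eB]
    field_simp
    linear_combination (8 * σ ^ 2 * x * edge x) * hY
  rw [key]
  field_simp

lemma hasDerivAt_trKernel {σ x y : ℝ} (hσ : |σ| < 1) (hx : x ∈ Ioo (-2 : ℝ) 2)
    (hy : y ∈ Ioo (-2 : ℝ) 2) :
    HasDerivAt (fun x => σ * edge x / edge y * (2 * σ * x - (1 + σ ^ 2) * y) / den σ x y)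
      (trKernel σ x y) x := by
  have hD := den_pos hσ (Ioo_subset_Icc_self hx) (Ioo_subset_Icc_self hy)
  have h1 : HasDerivAt (fun x => den σ x y) (σ * (2 * σ * x - (1 + σ ^ 2) * y)) x := by
    unfold den
    have := ((((hasDerivAt_pow 2 x).add_const (y ^ 2)).const_mul (σ ^ 2)).add_const
      ((1 - σ ^ 2) ^ 2)).sub ((hasDerivAt_id x).mul_const (y * σ * (1 + σ ^ 2)))
    convert! this using 1
    · ext; simp; ring
    · simp; ring
  have h2 : HasDerivAt (fun x => 2 * σ * x - (1 + σ ^ 2) * y) (2 * σ) x := by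
    simpa using ((hasDerivAt_id x).const_mul (2 * σ)).sub_const ((1 + σ ^ 2) * y)
  have h3 := (((hasDerivAt_edge hx).const_mul σ).div_const (edge y)).fun_mul h2
  have h4 := h3.fun_div h1 hD.ne'
  refine h4.congr_deriv ?_
  have hX := edge_sq (Ioo_subset_Icc_self hx)
  have hXp := (edge_pos hx).ne'
  have hYp := (edge_pos hy).ne'
  -- The x-derivative of the denominator is σq, so q² appears; trading it for the denominator
  -- produces the squared-denominator term of `trKernel`.
  have hsq : (2 * σ * x - (1 + σ ^ 2) * y) ^ 2 =
      4 * den σ x y - (1 - σ ^ 2) ^ 2 * (4 - y ^ 2) := by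
    unfold den; ring
  unfold trKernel
  set D := den σ x y
  set q := 2 * σ * x - (1 + σ ^ 2) * y with hq
  have hD0 := hD.ne'
  field_simp
  have hqx : (1 + σ ^ 2) * (x * y) = 2 * σ * x ^ 2 - q * x := by rw [hq]; ring
  linear_combination (σ * (2 * σ * D - σ * q ^ 2)) * hX - σ ^ 2 * (4 - x ^ 2) * hsq - σ * D * hqx

lemma deriv_deriv_logKernel {σ x y : ℝ} (hσ : |σ| < 1) (hx : x ∈ Ioo (-2 : ℝ) 2)
    (hy : y ∈ Ioo (-2 : ℝ) 2) :
    deriv (fun x => deriv (fun y => logKernel σ x y) y) x = trKernel σ x y := by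
  refine HasDerivAt.deriv ((hasDerivAt_trKernel hσ hx hy).congr_of_eventuallyEq ?_)
  filter_upwards [isOpen_Ioo.mem_nhds hx] with z hz
  exact (hasDerivAt_logKernel_snd hσ (Ioo_subset_Icc_self hz) hy).deriv

/-! ### Functions in `H²` with compact support are Lipschitz -/

lemma IsH2.integral_mul_deriv_deriv {g g₁ g₂ : ℝ → ℝ} (hg : IsH2 g g₁ g₂) {φ : ℝ → ℝ}
    (hφ : ContDiff ℝ ∞ φ) (hc : HasCompactSupport φ) :
    ∫ x, g x * deriv (deriv φ) x = ∫ x, g₂ x * φ x := by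
  have h1 := hg.weakDeriv_fst (deriv φ) (contDiff_infty_iff_deriv.1 hφ).2 hc.deriv
  have h2 := hg.weakDeriv_snd φ hφ hc
  rw [h1, h2, neg_neg]

lemma IsH2.abs_integral_mul_le {g g₁ g₂ : ℝ → ℝ} (hg : IsH2 g g₁ g₂) {M K : ℝ}
    (hM : h2Norm g g₁ g₂ ≤ M) (hK : 0 ≤ K) {φ : ℝ → ℝ}
    (hφ1 : ∀ x, |φ x| ≤ 1) (hφK : ∀ x, x ∉ Icc (-K) K → φ x = 0) :
    |∫ x, g₂ x * φ x| ≤ M ^ 2 + 2 * K := by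
  have hi2 : Integrable (fun x => g₂ x ^ 2) := hg.memLp_snd.integrable_sq
  have hsq : ∫ x, g₂ x ^ 2 ≤ M ^ 2 := by
    have h0 : 0 ≤ h2Norm g g₁ g₂ := Real.sqrt_nonneg _
    have h1 : h2Norm g g₁ g₂ ^ 2 ≤ M ^ 2 := by gcongr
    have hg0 : 0 ≤ ∫ x, g x ^ 2 := integral_nonneg fun x => sq_nonneg _
    have hg1 : 0 ≤ ∫ x, g₁ x ^ 2 := integral_nonneg fun x => sq_nonneg _
    have hg2 : 0 ≤ ∫ x, g₂ x ^ 2 := integral_nonneg fun x => sq_nonneg _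
    rw [h2Norm, Real.sq_sqrt (by positivity)] at h1
    linarith
  have hind : Integrable (indicator (Icc (-K) K) (fun _ => (1 : ℝ))) :=
    (integrable_indicator_iff measurableSet_Icc).2 (integrable_const _ |>.mono_measure le_rfl)
  rw [← Real.norm_eq_abs]
  -- The elementary |t| ≤ t² + 1 takes the place of Cauchy–Schwarz; the 1, restricted to [-K, K],
  -- integrates to 2K.
  calc ‖∫ x, g₂ x * φ x‖ ≤ ∫ x, (g₂ x ^ 2 + indicator (Icc (-K) K) (fun _ => (1 : ℝ)) x) := by
        refine norm_integral_le_of_norm_le (hi2.add hind) (ae_of_all _ fun x => ?_)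
        rw [norm_mul, Real.norm_eq_abs, Real.norm_eq_abs]
        by_cases hx : x ∈ Icc (-K) K
        · rw [indicator_of_mem hx]
          nlinarith [hφ1 x, abs_nonneg (φ x), abs_nonneg (g₂ x), sq_abs (g₂ x),
            sq_nonneg (|g₂ x| - 1)]
        · rw [indicator_of_notMem hx, hφK x hx]
          simp [sq_nonneg]
    _ = (∫ x, g₂ x ^ 2) + ∫ x, indicator (Icc (-K) K) (fun _ => (1 : ℝ)) x :=
        integral_add hi2 hind
    _ ≤ _ := by
        rw [integral_indicator measurableSet_Icc]
        simp [hK]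
        linarith

/-- The mollifications of `g` have uniformly bounded derivative. -/
lemma IsH2.abs_integral_mul_deriv_le {g g₁ g₂ : ℝ → ℝ} (hg : IsH2 g g₁ g₂) {M R : ℝ}
    (hR : 0 ≤ R) (hsupp : tsupport g ⊆ Icc (-R) R) (hM : h2Norm g g₁ g₂ ≤ M)
    {ρ : ℝ → ℝ} (hρ : ContDiff ℝ ∞ ρ) (hρc : HasCompactSupport ρ) (hρ0 : ∀ x, 0 ≤ ρ x)
    (hρ1 : ∫ x, ρ x = 1) :
    |∫ x, g x * deriv ρ x| ≤ M ^ 2 + 2 * (R + 2) := by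
  have hρi : Integrable ρ := hρ.continuous.integrable_of_hasCompactSupport hρc
  -- The distribution function Φ of ρ satisfies Φ'' = ρ' and 0 ≤ Φ ≤ 1. Moving both derivatives onto
  -- g gives a bound independent of how concentrated ρ is.
  set Φ : ℝ → ℝ := fun t => ∫ s in Iic t, ρ s with hΦ
  have hΦd : ∀ t, HasDerivAt Φ (ρ t) t := by
    intro t
    have h1 : ∀ u, Φ u = (∫ s in Iic (0 : ℝ), ρ s) + ∫ s in (0 : ℝ)..u, ρ s := by
      intro u
      rw [← intervalIntegral.integral_Iic_sub_Iic hρi.integrableOn hρi.integrableOn]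
      ring
    have h2 := (intervalIntegral.integral_hasDerivAt_right (a := 0) (b := t)
      (hρ.continuous.intervalIntegrable _ _)
      (hρ.continuous.stronglyMeasurableAtFilter _ _) hρ.continuous.continuousAt).const_add
      (∫ s in Iic (0 : ℝ), ρ s)
    rwa [← show Φ = _ from funext h1] at h2
  have hΦs : ContDiff ℝ ∞ Φ := by
    rw [contDiff_infty_iff_deriv]
    refine ⟨fun t => (hΦd t).differentiableAt, ?_⟩
    rwa [show deriv Φ = ρ from funext fun t => (hΦd t).deriv]
  have hΦ0 : ∀ t, 0 ≤ Φ t := fun t => integral_nonneg hρ0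
  have hΦ1 : ∀ t, Φ t ≤ 1 := fun t => by
    rw [← hρ1]
    exact setIntegral_le_integral hρi (ae_of_all _ hρ0)
  -- Φ is not compactly supported. The cutoff equals 1 near the support of g, so it leaves the
  -- pairing unchanged; its outer radius R + 2 enters the constant.
  let χ : ContDiffBump (0 : ℝ) := ⟨R + 1, R + 2, by linarith, by linarith⟩
  have hχs : ContDiff ℝ ∞ (χ : ℝ → ℝ) := χ.contDiff
  have hprod : ContDiff ℝ ∞ (fun t => χ t * Φ t) := hχs.mul hΦs
  have hcomp : HasCompactSupport (fun t => χ t * Φ t) := χ.hasCompactSupport.mul_right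
  have key := hg.integral_mul_deriv_deriv hprod hcomp
  have e : ∫ x, g x * deriv ρ x = ∫ x, g x * deriv (deriv fun t => χ t * Φ t) x := by
    refine integral_congr_ae (ae_of_all _ fun x => ?_)
    by_cases hx : x ∈ Icc (-R) R
    · have hloc : (fun t => χ t * Φ t) =ᶠ[𝓝 x] Φ := by
        have : Metric.ball (0 : ℝ) (R + 1) ∈ 𝓝 x := by
          refine Metric.isOpen_ball.mem_nhds ?_
          rw [Metric.mem_ball, dist_zero_right, Real.norm_eq_abs]
          have := abs_le.2 hx
          linarith
        filter_upwards [this] with t ht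
        rw [χ.one_of_mem_closedBall (Metric.ball_subset_closedBall ht), one_mul]
      have : deriv (deriv fun t => χ t * Φ t) x = deriv ρ x := by
        rw [hloc.deriv.deriv_eq, show deriv Φ = ρ from funext fun t => (hΦd t).deriv]
      simp only [this]
    · have : g x = 0 := image_eq_zero_of_notMem_tsupport fun h => hx (hsupp h)
      simp [this]
  rw [e, key]
  refine hg.abs_integral_mul_le hM (by linarith) (fun x => ?_) fun x hx => ?_
  · rw [abs_mul, abs_of_nonneg χ.nonneg, abs_of_nonneg (hΦ0 x)]
    exact mul_le_one₀ χ.le_one (hΦ0 x) (hΦ1 x)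
  · have : χ x = 0 := by
      refine χ.zero_of_le_dist ?_
      rw [dist_zero_right, Real.norm_eq_abs]
      by_contra! h
      exact hx (abs_le.1 h.le)
    simp [this]

/-- The derivative of a mollification of g at z is, up to sign, the pairing of g with the derivative
of a reflected and translated bump, which is again a probability density. The bound is thus uniform
in the width, and the continuous g inherits it in the limit. -/
lemma IsH2.abs_sub_le {g g₁ g₂ : ℝ → ℝ} (hg : IsH2 g g₁ g₂) {M R : ℝ}
    (hR : 0 ≤ R) (hsupp : tsupport g ⊆ Icc (-R) R) (hM : h2Norm g g₁ g₂ ≤ M) (x y : ℝ) :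
    |g x - g y| ≤ (M ^ 2 + 2 * (R + 2)) * |x - y| := by
  let φ : ℕ → ContDiffBump (0 : ℝ) := fun n =>
    ⟨1 / (n + 1) / 2, 1 / (n + 1), by positivity, by
      have : (0 : ℝ) < 1 / (n + 1) := by positivity
      linarith⟩
  have hφ : Tendsto (fun n => (φ n).rOut) atTop (𝓝 0) := tendsto_one_div_add_atTop_nhds_zero_nat
  have hconv : ∀ x, Tendsto (fun n => (convolution ((φ n).normed volume) g
      (ContinuousLinearMap.lsmul ℝ ℝ) volume) x) atTop (𝓝 (g x)) := fun x =>
    ContDiffBump.convolution_tendsto_right_of_continuous hφ hg.continuous x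
  have hlip : ∀ n, |(convolution ((φ n).normed volume) g
      (ContinuousLinearMap.lsmul ℝ ℝ) volume) x - (convolution ((φ n).normed volume) g
      (ContinuousLinearMap.lsmul ℝ ℝ) volume) y| ≤ (M ^ 2 + 2 * (R + 2)) * |x - y| := by
    intro n
    have hd : ∀ z, HasDerivAt (convolution ((φ n).normed volume) g
        (ContinuousLinearMap.lsmul ℝ ℝ) volume) (convolution (deriv ((φ n).normed volume)) g
        (ContinuousLinearMap.lsmul ℝ ℝ) volume z) z := fun z =>
      (φ n).hasCompactSupport_normed.hasDerivAt_convolution_left _ (φ n).contDiff_normed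
        hg.continuous.locallyIntegrable z
    have hb : ∀ z, ‖convolution (deriv ((φ n).normed volume)) g
        (ContinuousLinearMap.lsmul ℝ ℝ) volume z‖ ≤ M ^ 2 + 2 * (R + 2) := by
      intro z
      have hs : ContDiff ℝ ∞ ((φ n).normed volume) := (φ n).contDiff_normed
      have hz : convolution (deriv ((φ n).normed volume)) g
          (ContinuousLinearMap.lsmul ℝ ℝ) volume z =
          -∫ t, g t * deriv (fun t => (φ n).normed volume (z - t)) t := by
        rw [convolution_eq_swap, ← integral_neg]
        refine integral_congr_ae (ae_of_all _ fun t => ?_)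
        have : deriv (fun t => (φ n).normed volume (z - t)) t =
            -deriv ((φ n).normed volume) (z - t) := deriv_comp_const_sub _ _ _
        simp [this, mul_comm]
      rw [hz, norm_neg, Real.norm_eq_abs]
      refine hg.abs_integral_mul_deriv_le hR hsupp hM (hs.comp (contDiff_const.sub contDiff_id))
        ?_ (fun t => (φ n).nonneg_normed _) ?_
      · exact (φ n).hasCompactSupport_normed.comp_homeomorph (Homeomorph.subLeft z)
      · rw [integral_sub_left_eq_self (fun t => (φ n).normed volume t), (φ n).integral_normed]
    have := Convex.norm_image_sub_le_of_norm_hasDerivWithin_le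
      (s := univ) (fun z _ => (hd z).hasDerivWithinAt) (fun z _ => hb z) convex_univ
      (mem_univ y) (mem_univ x)
    simpa using this
  exact le_of_tendsto' ((hconv x).sub (hconv y)).abs hlip

/-! ### The Stieltjes transform of the semicircle law -/

lemma one_add_mul_ne_zero {m w : ℂ} (hm : ‖m‖ < 1) (hw : ‖w‖ ≤ 1) : 1 + m * w ≠ 0 := by
  intro h
  have h1 : m * w = -1 := by linear_combination h
  have h2 : ‖m * w‖ = 1 := by rw [h1]; simp
  rw [norm_mul] at h2
  nlinarith [norm_nonneg m, norm_nonneg w]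

/-- Mean value property: the integrand is the boundary value of a function holomorphic on the closed
unit disc, a pole at -1/m lying outside, with value 1 at the centre. -/
lemma integral_semicircle_symbol {m : ℂ} (hm : ‖m‖ < 1) :
    ∫ θ in (-π)..π, (1 - Complex.exp (θ * Complex.I) ^ 2) /
      (1 + m * Complex.exp (θ * Complex.I)) = (2 * π : ℂ) := by
  set F : ℂ → ℂ := fun w => (1 - w ^ 2) / (1 + m * w) with hF
  have hd : DiffContOnCl ℂ F (Metric.ball 0 |1|) := by
    refine DifferentiableOn.diffContOnCl fun w hw => ?_
    have hw' : ‖w‖ ≤ 1 := by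
      have := Metric.closure_ball_subset_closedBall hw
      simpa using this
    exact DifferentiableAt.differentiableWithinAt
      (by have := one_add_mul_ne_zero hm hw'; fun_prop (disch := assumption))
  have h := hd.circleAverage
  rw [Real.circleAverage_def] at h
  have hper : Function.Periodic (fun θ : ℝ => F (circleMap 0 1 θ)) (2 * π) := fun θ => by
    change F _ = F _
    rw [periodic_circleMap 0 1 θ]
  have h2 := hper.intervalIntegral_add_eq (-π) 0
  rw [show -π + 2 * π = π by ring, zero_add] at h2
  have h3 : ∀ θ : ℝ, F (circleMap 0 1 θ) = (1 - Complex.exp (θ * Complex.I) ^ 2) /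
      (1 + m * Complex.exp (θ * Complex.I)) := fun θ => by simp [hF, circleMap]
  simp_rw [← h3]
  rw [h2]
  have hF0 : F 0 = 1 := by simp [hF]
  rw [hF0, Complex.real_smul] at h
  have hpi : ((2 * π : ℝ) : ℂ) ≠ 0 := by exact_mod_cast Real.two_pi_pos.ne'
  push_cast at h hpi ⊢
  field_simp at h
  rw [← h]

/-- The Stieltjes transform `m` of the semicircle law at `z = -(m + m⁻¹)`, `|m| < 1`. -/
lemma mSc_eq {m z : ℂ} (hm : ‖m‖ < 1) (hz : m ^ 2 + z * m + 1 = 0) : mSc z = m := by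
  have hm0 : m ≠ 0 := by rintro rfl; simp at hz
  set G : ℝ → ℂ := fun x => (rhoSc x : ℂ) / ((x : ℂ) - z) with hG
  set F : ℝ → ℂ := fun θ => (1 - Complex.exp (θ * Complex.I) ^ 2) /
      (1 + m * Complex.exp (θ * Complex.I)) with hF
  have hnorm : ∀ θ : ℝ, ‖Complex.exp (θ * Complex.I)‖ ≤ 1 := fun θ => by
    rw [Complex.norm_exp_ofReal_mul_I]
  have hne : ∀ θ : ℝ, 1 + m * Complex.exp (θ * Complex.I) ≠ 0 := fun θ =>
    one_add_mul_ne_zero hm (hnorm θ)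
  have hFc : Continuous F := by
    refine Continuous.div (by fun_prop) (by fun_prop) hne
  -- With x = 2 cos θ, the equation for m splits the resolvent denominator into two factors
  -- exchanged by θ ↦ -θ.
  have hfac : ∀ θ : ℝ, m * (((2 * cos θ : ℝ) : ℂ) - z) =
      (1 + m * Complex.exp (θ * Complex.I)) * (1 + m * Complex.exp ((-θ : ℝ) * Complex.I)) := by
    intro θ
    have h1 : Complex.exp (θ * Complex.I) * Complex.exp ((-θ : ℝ) * Complex.I) = 1 := by
      rw [← Complex.exp_add]; simp
    have h2 : ((2 * cos θ : ℝ) : ℂ) =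
        Complex.exp (θ * Complex.I) + Complex.exp ((-θ : ℝ) * Complex.I) := by
      push_cast
      rw [Complex.cos]
      ring
    rw [h2]
    linear_combination -hz - m ^ 2 * h1
  have hpt : ∀ θ ∈ Icc 0 π, G (2 * cos θ) * (2 * sin θ : ℝ) = m / (2 * π) * (F θ + F (-θ)) := by
    intro θ hθ
    have hs : 0 ≤ sin θ := sin_nonneg_of_mem_Icc hθ
    have hrho : rhoSc (2 * cos θ) = sin θ / π := by
      unfold rhoSc
      rw [show 4 - (2 * cos θ) ^ 2 = (2 * sin θ) ^ 2 by nlinarith [sin_sq_add_cos_sq θ],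
        Real.sqrt_sq (by positivity)]
      field_simp
    have hE1 : Complex.exp (θ * Complex.I) * Complex.exp ((-θ : ℝ) * Complex.I) = 1 := by
      rw [← Complex.exp_add]; simp
    have hsin : ((sin θ : ℝ) : ℂ) ^ 2 = (2 - Complex.exp (θ * Complex.I) ^ 2 -
        Complex.exp ((-θ : ℝ) * Complex.I) ^ 2) / 4 := by
      have h3 : ((sin θ : ℝ) : ℂ) = (Complex.exp ((-θ : ℝ) * Complex.I) -
        Complex.exp (θ * Complex.I)) * Complex.I / 2 := by
        push_cast
        rw [Complex.sin]
      rw [h3]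
      linear_combination (1/2) * hE1 + ((Complex.exp ((-θ : ℝ) * Complex.I) -
        Complex.exp (θ * Complex.I)) ^ 2 / 4) * Complex.I_sq
    have ha := hne θ
    have hb := hne (-θ)
    have hden : ((2 * cos θ : ℝ) : ℂ) - z = (1 + m * Complex.exp (θ * Complex.I)) *
        (1 + m * Complex.exp ((-θ : ℝ) * Complex.I)) / m := by
      rw [← hfac]; field_simp
    have hpi : (π : ℂ) ≠ 0 := by exact_mod_cast Real.pi_ne_zero
    simp only [hG, hF]
    rw [hrho, hden]
    set w := Complex.exp (θ * Complex.I)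
    set v := Complex.exp ((-θ : ℝ) * Complex.I)
    have : (((sin θ / π : ℝ) : ℂ)) * ((2 * sin θ : ℝ) : ℂ) = (2 - w ^ 2 - v ^ 2) / (2 * π) := by
      push_cast
      have : ((sin θ : ℝ) : ℂ) / π * (2 * ((sin θ : ℝ) : ℂ)) =
        2 * ((sin θ : ℝ) : ℂ) ^ 2 / π := by ring
      push_cast at this hsin
      rw [this, hsin]
      field_simp
      ring
    -- Partial fractions: the integrand on [0, π] is the symbol at θ plus the symbol at -θ, so it
    -- unfolds to a full circle.
    have e : (1 - w ^ 2) / (1 + m * w) + (1 - v ^ 2) / (1 + m * v) =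
        (2 - w ^ 2 - v ^ 2) / ((1 + m * w) * (1 + m * v)) := by
      rw [div_add_div _ _ ha hb]
      congr 1
      linear_combination (-(m * (w + v))) * hE1
    rw [div_mul_eq_mul_div, this, e]
    generalize (1 + m * w) * (1 + m * v) = A
    rw [div_div_eq_mul_div]
    ring
  have hGc : ContinuousOn G ((fun θ => 2 * cos θ) '' uIcc 0 π) := by
    rintro _ ⟨θ, -, rfl⟩
    refine ContinuousAt.continuousWithinAt ?_
    have : ((2 * cos θ : ℝ) : ℂ) - z ≠ 0 := by
      intro h
      have := hfac θ
      rw [h, mul_zero] at this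
      exact mul_ne_zero (hne θ) (hne (-θ)) this.symm
    unfold rhoSc at hG
    refine ContinuousAt.div ?_ (by fun_prop) this
    exact (Complex.continuous_ofReal.comp
      ((continuous_edge.div_const _))).continuousAt
  have hsub := intervalIntegral.integral_deriv_smul_comp'' (a := 0) (b := π)
    (f := fun θ => 2 * cos θ) (f' := fun θ => -(2 * sin θ)) (g := G) (by fun_prop)
    (fun θ _ => ((((hasDerivAt_cos θ).const_mul 2).congr_deriv (by ring)).hasDerivWithinAt))
    (by fun_prop) hGc
  simp only [cos_zero, cos_pi] at hsub
  have h1 : mSc z = ∫ θ in (0 : ℝ)..π, m / (2 * π) * (F θ + F (-θ)) := by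
    unfold mSc
    rw [intervalIntegral.integral_symm, ← show 2 * (1 : ℝ) = 2 by norm_num,
      ← show 2 * (-1 : ℝ) = -(2 * 1) by norm_num]
    rw [← hsub, ← intervalIntegral.integral_neg]
    refine intervalIntegral.integral_congr fun θ hθ => ?_
    rw [uIcc_of_le pi_pos.le] at hθ
    simp only [Function.comp]
    rw [← hpt θ hθ, neg_smul, neg_neg, Complex.real_smul, mul_comm]
  have h2 : ∫ θ in (0 : ℝ)..π, F (-θ) = ∫ θ in (-π)..0, F θ := by
    rw [intervalIntegral.integral_comp_neg]; simp
  have h3 : IntervalIntegrable (fun θ => F (-θ)) volume 0 π :=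
    (hFc.comp continuous_neg).intervalIntegrable _ _
  rw [h1, intervalIntegral.integral_const_mul, intervalIntegral.integral_add
    (hFc.intervalIntegrable _ _) h3, h2, add_comm,
    intervalIntegral.integral_add_adjacent_intervals (hFc.intervalIntegrable _ _)
      (hFc.intervalIntegrable _ _), hF, integral_semicircle_symbol hm]
  have hpi : (π : ℂ) ≠ 0 := by exact_mod_cast Real.pi_ne_zero
  field_simp

/-- The two roots have product 1. If neither lies in the open disc, both lie on the unit circle and
are conjugate, so their sum -z is real. -/
lemma exists_norm_lt_one_root {z : ℂ} (hz : z.im ≠ 0) :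
    ∃ m : ℂ, ‖m‖ < 1 ∧ m ^ 2 + z * m + 1 = 0 := by
  obtain ⟨r, hr⟩ := IsAlgClosed.exists_pow_nat_eq (z ^ 2 - 4) (n := 2) (by norm_num)
  set p : ℂ := (-z + r) / 2 with hp
  set q : ℂ := (-z - r) / 2 with hq
  have hpq : p * q = 1 := by rw [hp, hq]; linear_combination (-1 / 4) * hr
  by_cases h1 : ‖p‖ < 1
  · exact ⟨p, h1, by rw [hp]; linear_combination (1 / 4) * hr⟩
  by_cases h2 : ‖q‖ < 1
  · exact ⟨q, h2, by rw [hq]; linear_combination (1 / 4) * hr⟩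
  exfalso
  push Not at h1 h2
  have hn : ‖p‖ * ‖q‖ = 1 := by rw [← norm_mul, hpq, norm_one]
  have hp1 : ‖p‖ = 1 := by nlinarith
  have hc : q = (starRingEnd ℂ) p := by
    have hp0 : p ≠ 0 := by rintro h; rw [h] at hpq; simp at hpq
    refine mul_left_cancel₀ hp0 ?_
    rw [hpq, Complex.mul_conj, Complex.normSq_eq_norm_sq, hp1]
    norm_num
  have hsum : p + q = -z := by rw [hp, hq]; ring
  have := congrArg Complex.im hsum
  rw [hc] at this
  simp at this
  exact hz this

/-- For `z = E + iη` with `0 < η ≤ 1` in the bulk, `2 Im m_sc(z)` is close to `√(4 - E²)`. -/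
lemma im_mSc_bounds {E η : ℝ} (hE : E ∈ Ioo (-2 : ℝ) 2) (hη : 0 < η) (hη1 : η ≤ 1) :
    edge E ^ 2 / 6 ≤ 2 * (mSc (E + (η : ℂ) * Complex.I)).im ∧
    |2 * (mSc (E + (η : ℂ) * Complex.I)).im - edge E| ≤ (1 + 2 / edge E) * η := by
  set z : ℂ := E + (η : ℂ) * Complex.I with hz
  have hzre : z.re = E := by simp [hz]
  have hzim : z.im = η := by simp [hz]
  obtain ⟨m, hm, hmz⟩ := exists_norm_lt_one_root (z := z) (by rw [hzim]; exact hη.ne')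
  rw [mSc_eq hm hmz]
  have hs := edge_pos hE
  have hs2 := edge_sq (Ioo_subset_Icc_self hE)
  have hsle := edge_le_two E
  have hre := congrArg Complex.re hmz
  have him := congrArg Complex.im hmz
  simp only [pow_two, Complex.add_re, Complex.add_im, Complex.mul_re, Complex.mul_im, hzre, hzim,
    Complex.one_re, Complex.one_im, Complex.zero_re, Complex.zero_im] at hre him
  have hn : m.re ^ 2 + m.im ^ 2 < 1 := by
    have : Complex.normSq m < 1 := by
      rw [Complex.normSq_eq_norm_sq]; nlinarith [norm_nonneg m]
    rw [Complex.normSq_apply] at this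
    nlinarith
  set a := m.re
  set b := m.im
  set s := edge E
  -- Up to sign, the imaginary part of the equation multiplied by the conjugate of m. Since |m| < 1,
  -- it forces b > 0.
  have hbn : b * (1 - (a ^ 2 + b ^ 2)) = η * (a ^ 2 + b ^ 2) := by
    linear_combination b * hre - a * him
  have hab : 0 < a ^ 2 + b ^ 2 := by
    rcases (by positivity : 0 ≤ a ^ 2 + b ^ 2).lt_or_eq with h | h
    · exact h
    · have h1 : a = 0 := by nlinarith [sq_nonneg a, sq_nonneg b]
      have h2 : b = 0 := by nlinarith [sq_nonneg a, sq_nonneg b]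
      rw [h1, h2] at hre
      norm_num at hre
  have hb : 0 < b := by
    have : 0 < b * (1 - (a ^ 2 + b ^ 2)) := by rw [hbn]; positivity
    exact pos_of_mul_pos_left this (by linarith)
  set p := 2 * a + E with hp
  set u := 2 * b + η with hu
  have e1 : u ^ 2 = s ^ 2 + η ^ 2 + p ^ 2 := by rw [hs2, hp, hu]; linear_combination (-4) * hre
  have e2 : p * u = E * η := by rw [hp, hu]; linear_combination 2 * him
  have hus : s ≤ u := by
    have : 0 < u := by positivity
    nlinarith [sq_nonneg p, sq_nonneg η]
  have hps : |p| ≤ 2 / s * η := by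
    rw [div_mul_eq_mul_div, le_div_iff₀ hs]
    have hEa : |E| ≤ 2 := abs_le.2 ⟨hE.1.le, hE.2.le⟩
    calc |p| * s ≤ |p| * u := by gcongr
      _ = |E| * η := by rw [← abs_of_pos (a := u) (by positivity), ← abs_mul, e2, abs_mul,
          abs_of_pos hη]
      _ ≤ 2 * η := by gcongr
  have hup : u ≤ s + η + |p| := by
    refine le_of_sq_le_sq ?_ (by positivity)
    rw [e1, ← sq_abs p]
    nlinarith [mul_pos hs hη, mul_nonneg hs.le (abs_nonneg p), mul_nonneg hη.le (abs_nonneg p)]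
  constructor
  -- If 2b < s²/6 ≤ 2/3, then η ≤ 1 gives s² ≤ 2b(2b + 2η) ≤ (8/3)·2b < s².
  · by_contra! h
    have h4 : s ^ 2 ≤ 4 := by nlinarith
    have : s ^ 2 ≤ 2 * b * (2 * b + 2 * η) := by nlinarith [sq_nonneg p]
    have h5 : 2 * b * (2 * b + 2 * η) ≤ 2 * b * (8 / 3) :=
      mul_le_mul_of_nonneg_left (by linarith) (by linarith)
    have h6 : 0 < s ^ 2 := by positivity
    linarith
  · have : (1 + 2 / s) * η = η + 2 / s * η := by ring
    have h0 : 0 ≤ 2 / s * η := by positivity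
    rw [abs_le, this]
    constructor <;> linarith

/-! ### Integrals of the kernels over `(-2, 2)` -/

/-- Lebesgue measure on `(-2, 2)`. -/
def bulk : Measure ℝ := volume.restrict (Ioo (-2) 2)

instance : IsFiniteMeasure bulk := by unfold bulk; infer_instance

lemma intervalIntegral_eq_bulk {F : Type*} [NormedAddCommGroup F] [NormedSpace ℝ F] (f : ℝ → F) :
    ∫ x in (-2 : ℝ)..2, f x = ∫ x, f x ∂bulk := by
  rw [intervalIntegral.integral_of_le (by norm_num), bulk, integral_Ioc_eq_integral_Ioo]

lemma ae_bulk : ∀ᵐ x ∂bulk, x ∈ Ioo (-2 : ℝ) 2 := ae_restrict_mem measurableSet_Ioo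

lemma bulk_prod : bulk.prod bulk = volume.restrict (Ioo (-2 : ℝ) 2 ×ˢ Ioo (-2 : ℝ) 2) := by
  rw [bulk, Measure.prod_restrict]; rfl

lemma ae_bulk_prod : ∀ᵐ p ∂bulk.prod bulk, p.1 ∈ Ioo (-2 : ℝ) 2 ∧ p.2 ∈ Ioo (-2 : ℝ) 2 := by
  rw [bulk_prod]
  exact ae_restrict_mem (measurableSet_Ioo.prod measurableSet_Ioo)

lemma restrict_square : (volume : Measure (ℝ × ℝ)).restrict square = bulk.prod bulk := by
  have h : bulk = volume.restrict (Icc (-2) 2) := Measure.restrict_congr_set Ioo_ae_eq_Icc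
  rw [square, h, Measure.prod_restrict]; rfl

lemma hasDerivAt_arcsin_half {x : ℝ} (hx : x ∈ Ioo (-2 : ℝ) 2) :
    HasDerivAt (fun x => arcsin (x / 2)) (edge x)⁻¹ x := by
  have h := (hasDerivAt_arcsin (x := x / 2) (by linarith [hx.1]) (by linarith [hx.2])).comp x
    ((hasDerivAt_id x).div_const 2)
  refine h.congr_deriv ?_
  have : √(1 - (x / 2) ^ 2) = edge x / 2 := by
    rw [edge, show 1 - (x / 2) ^ 2 = (4 - x ^ 2) / 2 ^ 2 by ring, Real.sqrt_div' _ (by norm_num),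
      Real.sqrt_sq (by norm_num)]
  rw [this]
  field_simp

lemma integrable_inv_edge : Integrable (fun x => (edge x)⁻¹) bulk := by
  have h := intervalIntegral.integrableOn_deriv_of_nonneg (a := -2) (b := 2)
    (g := fun x => arcsin (x / 2)) (by fun_prop) (fun x hx => hasDerivAt_arcsin_half hx)
    (fun x hx => (inv_pos.2 (edge_pos hx)).le)
  exact h.mono_set Ioo_subset_Ioc_self

lemma integral_inv_edge : ∫ x, (edge x)⁻¹ ∂bulk = π := by
  rw [← intervalIntegral_eq_bulk, intervalIntegral.integral_eq_sub_of_hasDerivAt_of_le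
    (by norm_num) (f := fun x => arcsin (x / 2)) (by fun_prop)
    (fun x hx => hasDerivAt_arcsin_half hx)]
  · norm_num [arcsin_one, arcsin_neg]
  · rw [intervalIntegrable_iff_integrableOn_Ioo_of_le (by norm_num)]
    exact integrable_inv_edge

lemma integrable_inv_edge_prod :
    Integrable (fun p : ℝ × ℝ => (edge p.1)⁻¹ * (edge p.2)⁻¹) (bulk.prod bulk) :=
  integrable_inv_edge.mul_prod integrable_inv_edge

/-- The kernel of `V_d^2` has constant marginals with respect to the semicircle law. -/
lemma integral_dKernel {σ x : ℝ} (hσ0 : 0 < σ) (hσ1 : σ < 1) (hx : x ∈ Ioo (-2 : ℝ) 2) :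
    ∫ y, dKernel σ x y ∂bulk = 2 * π * edge x := by
  have hs := edge_pos hx
  have hs2 := edge_sq (Ioo_subset_Icc_self hx)
  set s := edge x with hsdef
  have hσσ : 0 < 1 - σ ^ 2 := by nlinarith
  -- The choice |m| = σ together with z = -(m + 1/m) makes |y - z|² = `den σ x y` / σ². The kernel
  -- is then 4π/σ times the imaginary part of the Stieltjes integrand at z, and Im m = σ`s`/2.
  set m : ℂ := ⟨-(σ * x / 2), σ * s / 2⟩ with hm
  set z : ℂ := ⟨(1 + σ ^ 2) * x / (2 * σ), (1 - σ ^ 2) * s / (2 * σ)⟩ with hz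
  have hmn : Complex.normSq m = σ ^ 2 := by
    rw [Complex.normSq_apply, hm]
    linear_combination (σ ^ 2 / 4) * hs2
  have hm1 : ‖m‖ < 1 := by
    rw [Complex.normSq_eq_norm_sq] at hmn
    nlinarith [norm_nonneg m]
  have hmz : m ^ 2 + z * m + 1 = 0 := by
    apply Complex.ext
    · simp only [pow_two, Complex.add_re, Complex.mul_re, hm, hz, Complex.one_re, Complex.zero_re]
      field_simp
      linear_combination (-1 : ℝ) * hs2
    · simp only [pow_two, Complex.add_im, Complex.mul_im, hm, hz, Complex.one_im, Complex.zero_im]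
      field_simp
      ring
  have hden : ∀ y : ℝ, Complex.normSq (y - z) = den σ x y / σ ^ 2 := fun y => by
    rw [Complex.normSq_apply]
    simp only [Complex.sub_re, Complex.sub_im, Complex.ofReal_re, Complex.ofReal_im, hz, den]
    field_simp
    linear_combination (1 - σ ^ 2) ^ 2 * hs2
  have hne : ∀ y ∈ Icc (-2 : ℝ) 2, (y : ℂ) - z ≠ 0 := fun y hy h => by
    have := hden y
    rw [h, map_zero] at this
    have hD := den_pos (by rwa [abs_of_pos hσ0]) (Ioo_subset_Icc_self hx) hy
    have : 0 < den σ x y / σ ^ 2 := by positivity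
    linarith
  have hint : IntervalIntegrable (fun y : ℝ => (rhoSc y : ℂ) / ((y : ℂ) - z)) volume (-2) 2 := by
    refine ContinuousOn.intervalIntegrable fun y hy => ContinuousAt.continuousWithinAt ?_
    rw [uIcc_of_le (by norm_num)] at hy
    refine ContinuousAt.div ?_ (by fun_prop) (hne y hy)
    exact (Complex.continuous_ofReal.comp (continuous_edge.div_const _)).continuousAt
  have key := congrArg Complex.im (mSc_eq hm1 hmz)
  rw [mSc] at key
  have h2 : (∫ y in (-2 : ℝ)..2, (rhoSc y : ℂ) / ((y : ℂ) - z)).im =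
      ∫ y in (-2 : ℝ)..2, ((rhoSc y : ℂ) / ((y : ℂ) - z)).im := by
    have := Complex.imCLM.intervalIntegral_comp_comm hint
    simpa using this.symm
  rw [h2, intervalIntegral_eq_bulk] at key
  have h3 : ∀ᵐ y ∂bulk, dKernel σ x y = 4 * π / σ * ((rhoSc y : ℂ) / ((y : ℂ) - z)).im := by
    filter_upwards [ae_bulk] with y hy
    have hD := den_pos (by rwa [abs_of_pos hσ0]) (Ioo_subset_Icc_self hx)
      (Ioo_subset_Icc_self hy)
    rw [Complex.div_im, hden]
    simp only [Complex.sub_re, Complex.sub_im, Complex.ofReal_re, Complex.ofReal_im, hz]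
    rw [show rhoSc y = edge y / (2 * π) from rfl, dKernel]
    field_simp
    ring
  rw [integral_congr_ae h3, integral_const_mul, key]
  simp only [hm]
  field_simp
  ring

/-- The kernel of `V_tr^2` has vanishing marginals. -/
lemma integral_trKernel {σ x : ℝ} (hσ : |σ| < 1) (hx : x ∈ Ioo (-2 : ℝ) 2)
    (hint : Integrable (fun y => trKernel σ x y) bulk) :
    ∫ y, trKernel σ x y ∂bulk = 0 := by
  -- By symmetry the kernel is also the y-derivative of the first logarithmic derivative with x and
  -- y exchanged; that function carries the factor `edge y` and vanishes at ±2.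
  rw [← intervalIntegral_eq_bulk, intervalIntegral.integral_eq_sub_of_hasDerivAt_of_le
    (by norm_num) (f := fun y => σ * edge y / edge x * (2 * σ * y - (1 + σ ^ 2) * x) / den σ y x)]
  · rw [edge_eq_zero_of_notMem (x := 2) (by simp), edge_eq_zero_of_notMem (x := -2) (by simp)]
    simp
  · intro y hy
    have := (den_pos hσ hy (Ioo_subset_Icc_self hx)).ne'
    have hc := continuous_edge.continuousAt (x := y)
    refine ContinuousAt.continuousWithinAt (ContinuousAt.div (by fun_prop) ?_ this)
    unfold den; fun_prop
  · intro y hy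
    rw [trKernel_symm]
    exact hasDerivAt_trKernel hσ hy hx
  · rw [intervalIntegrable_iff_integrableOn_Ioo_of_le (by norm_num)]
    exact hint

/-- The kernel of `E_tr`. -/
def eKernel (σ x : ℝ) : ℝ := (1 - σ ^ 2) / ((1 + σ) ^ 2 - σ * x ^ 2)

lemma eDen_ge {σ x : ℝ} (hx : x ∈ Icc (-2 : ℝ) 2) :
    (1 - |σ|) ^ 2 ≤ (1 + σ) ^ 2 - σ * x ^ 2 := by
  have h4 : x ^ 2 ≤ 4 := by nlinarith [hx.1, hx.2]
  rcases le_total 0 σ with h | h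
  · rw [abs_of_nonneg h]
    nlinarith
  · rw [abs_of_nonpos h]
    nlinarith [sq_nonneg x]

lemma eDen_pos {σ x : ℝ} (hσ : |σ| < 1) (hx : x ∈ Icc (-2 : ℝ) 2) :
    0 < (1 + σ) ^ 2 - σ * x ^ 2 :=
  lt_of_lt_of_le (by have : 0 < 1 - |σ| := by linarith
                     positivity) (eDen_ge hx)

lemma eKernel_nonneg {σ x : ℝ} (hσ : |σ| < 1) (hx : x ∈ Icc (-2 : ℝ) 2) : 0 ≤ eKernel σ x := by
  have : σ ^ 2 < 1 := by rwa [sq_lt_one_iff_abs_lt_one]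
  exact div_nonneg (by linarith) (eDen_pos hσ hx).le

lemma measurable_eKernel (σ : ℝ) : Measurable (eKernel σ) := by unfold eKernel; fun_prop

/-- An antiderivative is arctan(k x/√(4 - x²)) with k = (1 - σ)/(1 + σ), which runs from -π/2 to
π/2. The constant mass π is what turns the limits k → ∞ and k → 0 into point evaluations. -/
lemma integral_eKernel {σ : ℝ} (hσ : |σ| < 1) :
    Integrable (fun x => eKernel σ x * (edge x)⁻¹) bulk ∧
    ∫ x, eKernel σ x * (edge x)⁻¹ ∂bulk = π := by
  have h1 : 0 < 1 - σ := by linarith [(abs_lt.1 hσ).2]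
  have h2 : 0 < 1 + σ := by linarith [(abs_lt.1 hσ).1]
  set k := (1 - σ) / (1 + σ) with hk
  have hkpos : 0 < k := by positivity
  have hd : ∀ x ∈ Ioo (-2 : ℝ) 2, HasDerivAt (fun x => arctan (k * (x / edge x)))
      (eKernel σ x * (edge x)⁻¹) x := by
    intro x hx
    have hs := edge_pos hx
    have hs2 := edge_sq (Ioo_subset_Icc_self hx)
    have h := ((((hasDerivAt_id x).fun_div (hasDerivAt_edge hx) hs.ne').const_mul k).arctan)
    refine h.congr_deriv ?_
    have hpos : 0 < (1 + σ) ^ 2 - σ * x ^ 2 := by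
      have : (1 + σ) ^ 2 - σ * x ^ 2 = ((1 + σ) ^ 2 * edge x ^ 2 + (1 - σ) ^ 2 * x ^ 2) / 4 := by
        rw [hs2]; ring
      rw [this]; positivity
    simp only [id, eKernel, hk]
    have e : (1 : ℝ) + ((1 - σ) / (1 + σ) * (x / edge x)) ^ 2 =
        4 * ((1 + σ) ^ 2 - σ * x ^ 2) / ((1 + σ) ^ 2 * edge x ^ 2) := by
      field_simp
      rw [hs2]; ring
    have e2 : (1 * edge x - x * -(x / edge x)) = 4 / edge x := by
      field_simp
      rw [hs2]; ring
    rw [e, e2]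
    have := hpos.ne'
    generalize (1 + σ) ^ 2 - σ * x ^ 2 = A at *
    field_simp
    ring
  have hi : Integrable (fun x => eKernel σ x * (edge x)⁻¹) bulk := by
    refine integrable_inv_edge.bdd_mul (c := 1 / (1 - |σ|) ^ 2)
      (measurable_eKernel σ).aestronglyMeasurable ?_
    filter_upwards [ae_bulk] with x hx
    rw [Real.norm_eq_abs, abs_of_nonneg (eKernel_nonneg hσ (Ioo_subset_Icc_self hx)), eKernel]
    have : 0 < 1 - |σ| := by linarith
    refine div_le_div₀ zero_le_one (by nlinarith [sq_nonneg σ]) (by positivity)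
      (eDen_ge (Ioo_subset_Icc_self hx))
  refine ⟨hi, ?_⟩
  have he0 : Tendsto edge (𝓝[<] 2) (𝓝[>] 0) := by
    refine tendsto_nhdsWithin_iff.2 ⟨?_, ?_⟩
    · have := continuous_edge.tendsto 2
      rw [edge_eq_zero_of_notMem (x := 2) (by simp)] at this
      exact this.mono_left nhdsWithin_le_nhds
    · filter_upwards [Ioo_mem_nhdsLT (show (-2 : ℝ) < 2 by norm_num)] with x hx
      exact edge_pos hx
  have he1 : Tendsto edge (𝓝[>] (-2)) (𝓝[>] 0) := by
    refine tendsto_nhdsWithin_iff.2 ⟨?_, ?_⟩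
    · have := continuous_edge.tendsto (-2)
      rw [edge_eq_zero_of_notMem (x := -2) (by simp)] at this
      exact this.mono_left nhdsWithin_le_nhds
    · filter_upwards [Ioo_mem_nhdsGT (show (-2 : ℝ) < 2 by norm_num)] with x hx
      exact edge_pos hx
  have l0 : Tendsto (fun x => k * (x / edge x)) (𝓝[<] 2) atTop := by
    refine Tendsto.const_mul_atTop hkpos ?_
    simp_rw [div_eq_mul_inv]
    exact Tendsto.pos_mul_atTop (C := 2) (by norm_num)
      (tendsto_id.mono_left nhdsWithin_le_nhds) (tendsto_inv_nhdsGT_zero.comp he0)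
  have l1 : Tendsto (fun x => k * (x / edge x)) (𝓝[>] (-2)) atBot := by
    refine Tendsto.const_mul_atBot hkpos ?_
    simp_rw [div_eq_mul_inv]
    exact Tendsto.neg_mul_atTop (C := -2) (by norm_num)
      (tendsto_id.mono_left nhdsWithin_le_nhds) (tendsto_inv_nhdsGT_zero.comp he1)
  rw [← intervalIntegral_eq_bulk, intervalIntegral.integral_eq_sub_of_hasDerivAt_of_tendsto
    (by norm_num) hd ?_ ((tendsto_arctan_atBot.comp l1).mono_right nhdsWithin_le_nhds)
    ((tendsto_arctan_atTop.comp l0).mono_right nhdsWithin_le_nhds)]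
  · ring
  · rw [intervalIntegrable_iff_integrableOn_Ioo_of_le (by norm_num)]
    exact hi

/-! ### Bilinear forms and their limits at the endpoints -/

/-- A bounded Lipschitz function with the given constants. -/
structure BddLip (B L : ℝ) (f : ℝ → ℝ) : Prop where
  bdd : ∀ x, |f x| ≤ B
  lip : ∀ x y, |f x - f y| ≤ L * |x - y|

lemma BddLip.nonneg_bdd {B L : ℝ} {f : ℝ → ℝ} (hf : BddLip B L f) : 0 ≤ B :=
  (abs_nonneg _).trans (hf.bdd 0)

lemma BddLip.nonneg_lip {B L : ℝ} {f : ℝ → ℝ} (hf : BddLip B L f) : 0 ≤ L := by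
  have := (abs_nonneg _).trans (hf.lip 1 0)
  simpa using this

lemma BddLip.continuous {B L : ℝ} {f : ℝ → ℝ} (hf : BddLip B L f) : Continuous f :=
  (LipschitzWith.of_dist_le' (K := L) fun x y => by
    simpa [Real.dist_eq] using hf.lip x y).continuous

lemma BddLip.reflect {B L : ℝ} {f : ℝ → ℝ} (hf : BddLip B L f) : BddLip B L (reflect f) :=
  ⟨fun x => hf.bdd _, fun x y => (hf.lip _ _).trans_eq (by
    rw [← abs_neg]; congr 2; ring)⟩

lemma BddLip.abs_mul_sub_le {B L : ℝ} {f h : ℝ → ℝ} (hf : BddLip B L f) (hh : BddLip B L h)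
    (x y : ℝ) : |(f x - f y) * (h x - h y)| ≤ L ^ 2 * (x - y) ^ 2 := by
  rw [abs_mul]
  calc _ ≤ (L * |x - y|) * (L * |x - y|) :=
        mul_le_mul (hf.lip x y) (hh.lip x y) (abs_nonneg _)
          (mul_nonneg hf.nonneg_lip (abs_nonneg _))
    _ = L ^ 2 * |x - y| ^ 2 := by ring
    _ = _ := by rw [sq_abs]

lemma measurePreserving_neg_bulk : MeasurePreserving (fun x : ℝ => -x) bulk bulk := by
  have h := (Measure.measurePreserving_neg (volume : Measure ℝ)).restrict_preimage
    (s := Ioo (-2 : ℝ) 2) measurableSet_Ioo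
  have e : (Neg.neg ⁻¹' Ioo (-2 : ℝ) 2) = Ioo (-2) 2 := by
    ext x; simp only [mem_preimage, mem_Ioo]; constructor <;> rintro ⟨h1, h2⟩ <;>
      constructor <;> linarith
  rw [e] at h
  exact h

lemma integral_comp_neg_bulk (f : ℝ → ℝ) : ∫ x, f (-x) ∂bulk = ∫ x, f x ∂bulk :=
  measurePreserving_neg_bulk.integral_comp (Homeomorph.neg ℝ).measurableEmbedding f

lemma integral_comp_neg_snd_bulk (f : ℝ × ℝ → ℝ) :
    ∫ p, f (p.1, -p.2) ∂bulk.prod bulk = ∫ p, f p ∂bulk.prod bulk :=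
  ((MeasurePreserving.id bulk).prod measurePreserving_neg_bulk).integral_comp
    ((Homeomorph.refl ℝ).prodCongr (Homeomorph.neg ℝ)).measurableEmbedding f

lemma integrable_mul_kernel {k u : ℝ × ℝ → ℝ} (hk : Integrable k (bulk.prod bulk)) {B : ℝ}
    (hu : Continuous u) (hB : ∀ p, |u p| ≤ B) :
    Integrable (fun p => u p * k p) (bulk.prod bulk) :=
  hk.bdd_mul hu.aestronglyMeasurable (ae_of_all _ hB)

/-- A symmetric kernel splits into its marginal and a form in the increments. -/
lemma integral_bilinear_eq {k : ℝ → ℝ → ℝ} {f h c : ℝ → ℝ} {B L : ℝ}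
    (hk : Integrable (fun p : ℝ × ℝ => k p.1 p.2) (bulk.prod bulk)) (hs : ∀ x y, k x y = k y x)
    (hc : ∀ᵐ x ∂bulk, ∫ y, k x y ∂bulk = c x) (hf : BddLip B L f) (hh : BddLip B L h) :
    ∫ p, f p.1 * h p.2 * k p.1 p.2 ∂bulk.prod bulk = ∫ x, f x * h x * c x ∂bulk -
      1 / 2 * ∫ p, (f p.1 - f p.2) * (h p.1 - h p.2) * k p.1 p.2 ∂bulk.prod bulk := by
  have hfc := hf.continuous
  have hhc := hh.continuous
  have bound : ∀ x y, |f x * h y| ≤ B * B := fun x y => by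
    rw [abs_mul]
    exact mul_le_mul (hf.bdd x) (hh.bdd y) (abs_nonneg _) hf.nonneg_bdd
  have i12 := integrable_mul_kernel hk (u := fun p => f p.1 * h p.2) (by fun_prop)
    (fun p => bound _ _)
  have i21 := integrable_mul_kernel hk (u := fun p => f p.2 * h p.1) (by fun_prop)
    (fun p => bound _ _)
  have i11 := integrable_mul_kernel hk (u := fun p => f p.1 * h p.1) (by fun_prop)
    (fun p => bound _ _)
  have i22 := integrable_mul_kernel hk (u := fun p => f p.2 * h p.2) (by fun_prop)
    (fun p => bound _ _)
  have e21 : ∫ p, f p.2 * h p.1 * k p.1 p.2 ∂bulk.prod bulk =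
      ∫ p, f p.1 * h p.2 * k p.1 p.2 ∂bulk.prod bulk := by
    rw [← integral_prod_swap]
    refine integral_congr_ae (ae_of_all _ fun p => ?_)
    simp [hs p.2 p.1]
  have e22 : ∫ p, f p.2 * h p.2 * k p.1 p.2 ∂bulk.prod bulk =
      ∫ p, f p.1 * h p.1 * k p.1 p.2 ∂bulk.prod bulk := by
    rw [← integral_prod_swap]
    refine integral_congr_ae (ae_of_all _ fun p => ?_)
    simp [hs p.2 p.1]
  have e11 : ∫ p, f p.1 * h p.1 * k p.1 p.2 ∂bulk.prod bulk = ∫ x, f x * h x * c x ∂bulk := by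
    rw [integral_prod _ i11]
    refine integral_congr_ae ?_
    filter_upwards [hc] with x hx
    simp only [integral_const_mul, hx]
  have key : ∫ p, (f p.1 - f p.2) * (h p.1 - h p.2) * k p.1 p.2 ∂bulk.prod bulk =
      (∫ p, f p.1 * h p.1 * k p.1 p.2 ∂bulk.prod bulk) +
      (∫ p, f p.2 * h p.2 * k p.1 p.2 ∂bulk.prod bulk) -
      (∫ p, f p.1 * h p.2 * k p.1 p.2 ∂bulk.prod bulk) -
      (∫ p, f p.2 * h p.1 * k p.1 p.2 ∂bulk.prod bulk) := by
    have i3 : Integrable (fun p => f p.1 * h p.1 * k p.1 p.2 + f p.2 * h p.2 * k p.1 p.2)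
      (bulk.prod bulk) := i11.add i22
    have i4 : Integrable (fun p => f p.1 * h p.1 * k p.1 p.2 + f p.2 * h p.2 * k p.1 p.2 -
      f p.1 * h p.2 * k p.1 p.2) (bulk.prod bulk) := i3.sub i12
    rw [← integral_add i11 i22, ← integral_sub i3 i12, ← integral_sub i4 i21]
    refine integral_congr_ae (ae_of_all _ fun p => ?_)
    ring
  rw [key, e21, e22, e11]
  ring

lemma measurable_den (σ : ℝ) : Measurable (fun p : ℝ × ℝ => den σ p.1 p.2) := by
  unfold den; fun_prop

lemma measurable_trKernel (σ : ℝ) : Measurable (fun p : ℝ × ℝ => trKernel σ p.1 p.2) := by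
  have := measurable_den σ
  have := continuous_edge.measurable
  unfold trKernel; fun_prop

lemma measurable_dKernel (σ : ℝ) : Measurable (fun p : ℝ × ℝ => dKernel σ p.1 p.2) := by
  have := measurable_den σ
  have := continuous_edge.measurable
  unfold dKernel; fun_prop

lemma abs_trKernel_le' {σ x y : ℝ} (hσ : |σ| < 1) (hx : x ∈ Ioo (-2 : ℝ) 2)
    (hy : y ∈ Ioo (-2 : ℝ) 2) :
    |trKernel σ x y| ≤ 32 / (1 - |σ|) ^ 4 * ((edge x)⁻¹ * (edge y)⁻¹) := by
  refine (abs_trKernel_le hσ hx hy).trans ?_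
  have h1 := edge_pos hx
  have h2 := edge_pos hy
  have h3 : 0 < 1 - |σ| := by linarith
  have := den_ge_pow (σ := σ) (Ioo_subset_Icc_self hx) (Ioo_subset_Icc_self hy)
  gcongr

lemma integrable_trKernel {σ : ℝ} (hσ : |σ| < 1) :
    Integrable (fun p : ℝ × ℝ => trKernel σ p.1 p.2) (bulk.prod bulk) := by
  refine (integrable_inv_edge_prod.const_mul (32 / (1 - |σ|) ^ 4)).mono'
    (measurable_trKernel σ).aestronglyMeasurable ?_
  filter_upwards [ae_bulk_prod] with p hp
  exact abs_trKernel_le' hσ hp.1 hp.2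

lemma abs_dKernel_le {σ x y : ℝ} (hσ : |σ| < 1) (hx : x ∈ Ioo (-2 : ℝ) 2)
    (hy : y ∈ Ioo (-2 : ℝ) 2) : |dKernel σ x y| ≤ (1 - σ ^ 2) * 4 / den σ x y := by
  have hD := den_pos hσ (Ioo_subset_Icc_self hx) (Ioo_subset_Icc_self hy)
  have h1 := edge_pos hx
  have h2 := edge_pos hy
  have hs2 : σ ^ 2 < 1 := by rwa [sq_lt_one_iff_abs_lt_one]
  have h3 : 0 < 1 - σ ^ 2 := by linarith
  rw [dKernel, abs_of_pos (by positivity)]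
  gcongr
  nlinarith [edge_le_two x, edge_le_two y]

lemma abs_dKernel_le' {σ x y : ℝ} (hσ : |σ| < 1) (hx : x ∈ Ioo (-2 : ℝ) 2)
    (hy : y ∈ Ioo (-2 : ℝ) 2) : |dKernel σ x y| ≤ 4 / (1 - |σ|) ^ 4 := by
  refine (abs_dKernel_le hσ hx hy).trans ?_
  have h3 : 0 < 1 - |σ| := by linarith
  have := den_ge_pow (σ := σ) (Ioo_subset_Icc_self hx) (Ioo_subset_Icc_self hy)
  refine div_le_div₀ (by norm_num) (by nlinarith [sq_nonneg σ]) (by positivity) this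

lemma integrable_dKernel {σ : ℝ} (hσ : |σ| < 1) :
    Integrable (fun p : ℝ × ℝ => dKernel σ p.1 p.2) (bulk.prod bulk) := by
  refine (integrable_const (4 / (1 - |σ|) ^ 4)).mono'
    (measurable_dKernel σ).aestronglyMeasurable ?_
  filter_upwards [ae_bulk_prod] with p hp
  exact abs_dKernel_le' hσ hp.1 hp.2

/-- The polarization of `V_tr^2`. -/
def trForm (σ : ℝ) (f h : ℝ → ℝ) : ℝ :=
  1 / (4 * π ^ 2) * ∫ p, f p.1 * h p.2 * trKernel σ p.1 p.2 ∂bulk.prod bulk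

/-- The polarization of `V_d^2`, without the square of the mean. -/
def dForm (σ : ℝ) (f h : ℝ → ℝ) : ℝ :=
  1 / (4 * π ^ 2) * ∫ p, f p.1 * h p.2 * dKernel σ p.1 p.2 ∂bulk.prod bulk

/-- The polarization of `V_tr^1`. -/
def trLimit (f h : ℝ → ℝ) : ℝ :=
  1 / (4 * π ^ 2) * ∫ p, (f p.1 - f p.2) / (p.1 - p.2) * ((h p.1 - h p.2) / (p.1 - p.2)) *
    ((4 - p.1 * p.2) * ((edge p.1)⁻¹ * (edge p.2)⁻¹)) ∂bulk.prod bulk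

lemma sqrt_mul_eq_edge {x : ℝ} (hx : x ∈ Ioo (-2 : ℝ) 2) (y : ℝ) :
    √((4 - x ^ 2) * (4 - y ^ 2)) = edge x * edge y :=
  Real.sqrt_mul (by nlinarith [hx.1, hx.2]) _

lemma Vtr1_eq (f : ℝ → ℝ) : Vtr1 f = trLimit f f := by
  rw [Vtr1, trLimit, restrict_square]
  congr 1
  refine integral_congr_ae ?_
  filter_upwards [ae_bulk_prod] with p hp
  rw [sqrt_mul_eq_edge hp.1, div_eq_mul_inv (4 - p.1 * p.2), mul_inv]
  ring

lemma Vtr2Interior_eq {σ : ℝ} (hσ : |σ| < 1) (f : ℝ → ℝ) :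
    Vtr2Interior f σ = trForm σ f f := by
  rw [Vtr2Interior, trForm, restrict_square]
  congr 1
  refine integral_congr_ae ?_
  filter_upwards [ae_bulk_prod] with p hp
  rw [deriv_deriv_logKernel hσ hp.1 hp.2]

lemma Vd2Interior_eq (σ : ℝ) (f : ℝ → ℝ) :
    Vd2Interior f σ = dForm σ f f - avgSc f ^ 2 := by
  rw [Vd2Interior, dForm, restrict_square]
  congr 2
  refine integral_congr_ae ?_
  filter_upwards [ae_bulk_prod] with p hp
  rw [sqrt_mul_eq_edge hp.1]
  rfl

/-- Reflecting the second variable turns σ into -σ, which reduces the endpoint -1 to the endpoint 1.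
-/
lemma trForm_neg (σ : ℝ) (f : ℝ → ℝ) : trForm (-σ) f f = trForm σ f (reflect f) := by
  rw [trForm, trForm, ← integral_comp_neg_snd_bulk]
  simp_rw [trKernel_neg, neg_neg]
  rfl

lemma dForm_neg (σ : ℝ) (f : ℝ → ℝ) : dForm (-σ) f f = dForm σ f (reflect f) := by
  rw [dForm, dForm, ← integral_comp_neg_snd_bulk]
  simp_rw [dKernel_neg, neg_neg]
  rfl

lemma trForm_eq {σ B L : ℝ} {f h : ℝ → ℝ} (hσ : |σ| < 1) (hf : BddLip B L f)
    (hh : BddLip B L h) :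
    trForm σ f h = 1 / (4 * π ^ 2) *
      ∫ p, -(1 / 2) * ((f p.1 - f p.2) * (h p.1 - h p.2) * trKernel σ p.1 p.2)
        ∂bulk.prod bulk := by
  have hc : ∀ᵐ x ∂bulk, ∫ y, trKernel σ x y ∂bulk = 0 := by
    filter_upwards [ae_bulk, (integrable_trKernel hσ).prod_right_ae] with x hx hi
    exact integral_trKernel hσ hx hi
  rw [trForm, integral_bilinear_eq (integrable_trKernel hσ) (trKernel_symm σ) hc hf hh,
    integral_const_mul]
  simp

lemma den_ge_quarter {σ x y : ℝ} (hσ : 1 / 2 ≤ σ) (hx : x ∈ Icc (-2 : ℝ) 2)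
    (hy : y ∈ Icc (-2 : ℝ) 2) : (x - y) ^ 2 / 4 ≤ den σ x y := by
  have := den_ge (by linarith) hx hy (σ := σ)
  have h4 : 0 ≤ (1 - σ) ^ 4 := by positivity
  have : (1 / 2) ^ 2 * (x - y) ^ 2 ≤ σ ^ 2 * (x - y) ^ 2 := by gcongr
  linarith

lemma Ioo_half_mem : Ioo (1 / 2 : ℝ) 1 ∈ 𝓝[<] (1 : ℝ) := Ioo_mem_nhdsLT (by norm_num)

/-- Dominated convergence in the increment form. At σ = 1 the denominator is (x - y)², the second
term of the kernel drops out through (1 - σ²)², and -½(2xy - 8) = 4 - xy. -/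
lemma tendsto_trForm {B L : ℝ} {f h : ℝ → ℝ} (hf : BddLip B L f) (hh : BddLip B L h) :
    Tendsto (fun σ => trForm σ f h) (𝓝[<] 1) (𝓝 (trLimit f h)) := by
  have hfc := hf.continuous
  have hhc := hh.continuous
  have hev : (fun σ => 1 / (4 * π ^ 2) *
      ∫ p, -(1 / 2) * ((f p.1 - f p.2) * (h p.1 - h p.2) * trKernel σ p.1 p.2)
        ∂bulk.prod bulk) =ᶠ[𝓝[<] 1] fun σ => trForm σ f h := by
    filter_upwards [Ioo_half_mem] with σ hσ
    rw [trForm_eq (abs_lt.2 ⟨by linarith [hσ.1], hσ.2⟩) hf hh]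
  refine Tendsto.congr' hev (Tendsto.const_mul _ ?_)
  -- The constant is ½ · 32 · 4: the prefactor, `abs_trKernel_le`, and (x - y)² ≤ 4 `den` for σ ≥
  -- 1/2.
  refine tendsto_integral_filter_of_dominated_convergence
    (fun p => 64 * L ^ 2 * ((edge p.1)⁻¹ * (edge p.2)⁻¹)) ?_ ?_
    (integrable_inv_edge_prod.const_mul _) ?_
  · refine Eventually.of_forall fun σ => Measurable.aestronglyMeasurable ?_
    have := measurable_trKernel σ
    have := hfc.measurable
    have := hhc.measurable
    fun_prop
  · filter_upwards [Ioo_half_mem] with σ hσ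
    have hσ1 : |σ| < 1 := abs_lt.2 ⟨by linarith [hσ.1], hσ.2⟩
    filter_upwards [ae_bulk_prod] with p hp
    have h1 := edge_pos hp.1
    have h2 := edge_pos hp.2
    have hD := den_pos hσ1 (Ioo_subset_Icc_self hp.1) (Ioo_subset_Icc_self hp.2)
    have hD4 := den_ge_quarter hσ.1.le (Ioo_subset_Icc_self hp.1) (Ioo_subset_Icc_self hp.2)
    have hk := abs_trKernel_le hσ1 hp.1 hp.2
    have hd := hf.abs_mul_sub_le hh p.1 p.2
    rw [Real.norm_eq_abs, abs_mul, abs_mul]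
    calc |-(1 / 2)| * (|(f p.1 - f p.2) * (h p.1 - h p.2)| * |trKernel σ p.1 p.2|)
        ≤ |-(1 / 2)| * (L ^ 2 * (p.1 - p.2) ^ 2 *
          (32 / den σ p.1 p.2 * ((edge p.1)⁻¹ * (edge p.2)⁻¹))) := by gcongr
      _ = 16 * L ^ 2 * ((edge p.1)⁻¹ * (edge p.2)⁻¹) * ((p.1 - p.2) ^ 2 / den σ p.1 p.2) := by
          rw [abs_neg, abs_of_pos (by norm_num : (0 : ℝ) < 1 / 2)]; ring
      _ ≤ 16 * L ^ 2 * ((edge p.1)⁻¹ * (edge p.2)⁻¹) * 4 := by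
          gcongr
          rw [div_le_iff₀ hD]; linarith
      _ = _ := by ring
  · filter_upwards [ae_bulk_prod] with p hp
    have h1 := (edge_pos hp.1).ne'
    have h2 := (edge_pos hp.2).ne'
    by_cases hne : p.1 = p.2
    · simp [hne]
    · have hd : den 1 p.1 p.2 = (p.1 - p.2) ^ 2 := by unfold den; ring
      have hxy : p.1 - p.2 ≠ 0 := sub_ne_zero.2 hne
      have hd0 : den 1 p.1 p.2 ≠ 0 := by rw [hd]; positivity
      have hcd : Continuous (fun σ => den σ p.1 p.2) := by unfold den; fun_prop
      have hc : ContinuousAt (fun σ => -(1 / 2) * ((f p.1 - f p.2) * (h p.1 - h p.2) *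
          trKernel σ p.1 p.2)) 1 := by
        have : ContinuousAt (fun σ => trKernel σ p.1 p.2) 1 := by
          unfold trKernel
          refine ContinuousAt.mul (by fun_prop) (ContinuousAt.add ?_ ?_)
          · exact ContinuousAt.div (by fun_prop) hcd.continuousAt hd0
          · exact ContinuousAt.div (by fun_prop) (by fun_prop) (pow_ne_zero _ hd0)
        fun_prop
      have ht := hc.tendsto.mono_left (nhdsWithin_le_nhds (s := Iio 1))
      convert ht using 2
      simp only [trKernel, hd]
      field_simp
      ring

lemma avgSc_eq (f : ℝ → ℝ) : avgSc f = ∫ x, f x * (edge x / (2 * π)) ∂bulk :=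
  intervalIntegral_eq_bulk _

/-- The marginal term equals ⟨fh⟩_sc for every σ in (0, 1). In the increment term (x - y)² cancels
the denominator and the factor 1 - σ² sends it to zero. -/
lemma tendsto_dForm {B L : ℝ} {f h : ℝ → ℝ} (hf : BddLip B L f) (hh : BddLip B L h) :
    Tendsto (fun σ => dForm σ f h) (𝓝[<] 1) (𝓝 (avgSc (fun x => f x * h x))) := by
  have hfc := hf.continuous
  have hhc := hh.continuous
  have hev : (fun σ => avgSc (fun x => f x * h x) - 1 / (8 * π ^ 2) *
      ∫ p, (f p.1 - f p.2) * (h p.1 - h p.2) * dKernel σ p.1 p.2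
        ∂bulk.prod bulk) =ᶠ[𝓝[<] 1] fun σ => dForm σ f h := by
    filter_upwards [Ioo_half_mem] with σ hσ
    have hσ1 : |σ| < 1 := abs_lt.2 ⟨by linarith [hσ.1], hσ.2⟩
    have hc : ∀ᵐ x ∂bulk, ∫ y, dKernel σ x y ∂bulk = 2 * π * edge x := by
      filter_upwards [ae_bulk] with x hx
      exact integral_dKernel (by linarith [hσ.1]) hσ.2 hx
    rw [dForm, integral_bilinear_eq (integrable_dKernel hσ1) (dKernel_symm σ) hc hf hh, avgSc_eq,
      mul_sub, ← integral_const_mul (μ := bulk)]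
    congr 1
    · refine integral_congr_ae (ae_of_all _ fun x => ?_)
      simp only
      field_simp
      ring
    · rw [← mul_assoc]
      congr 1
      ring
  refine Tendsto.congr' hev ?_
  have h0 : Tendsto (fun σ => ∫ p, (f p.1 - f p.2) * (h p.1 - h p.2) * dKernel σ p.1 p.2
      ∂bulk.prod bulk) (𝓝[<] 1) (𝓝 0) := by
    have hb : Tendsto (fun σ : ℝ => 16 * L ^ 2 * (1 - σ ^ 2) * (bulk.prod bulk).real univ)
        (𝓝[<] 1) (𝓝 0) := by
      have : Continuous (fun σ : ℝ => 16 * L ^ 2 * (1 - σ ^ 2) * (bulk.prod bulk).real univ) := by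
        fun_prop
      have := (this.tendsto 1).mono_left (nhdsWithin_le_nhds (s := Iio 1))
      simpa using this
    refine squeeze_zero_norm' ?_ hb
    filter_upwards [Ioo_half_mem] with σ hσ
    have hσ1 : |σ| < 1 := abs_lt.2 ⟨by linarith [hσ.1], hσ.2⟩
    refine norm_integral_le_of_norm_le_const ?_
    filter_upwards [ae_bulk_prod] with p hp
    have hD := den_pos hσ1 (Ioo_subset_Icc_self hp.1) (Ioo_subset_Icc_self hp.2)
    have hD4 := den_ge_quarter hσ.1.le (Ioo_subset_Icc_self hp.1) (Ioo_subset_Icc_self hp.2)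
    have hk := abs_dKernel_le hσ1 hp.1 hp.2
    have hd := hf.abs_mul_sub_le hh p.1 p.2
    have hs2 : 0 ≤ 1 - σ ^ 2 := by nlinarith [hσ.1, hσ.2]
    rw [Real.norm_eq_abs, abs_mul]
    calc |(f p.1 - f p.2) * (h p.1 - h p.2)| * |dKernel σ p.1 p.2|
        ≤ L ^ 2 * (p.1 - p.2) ^ 2 * ((1 - σ ^ 2) * 4 / den σ p.1 p.2) := by gcongr
      _ = 4 * L ^ 2 * (1 - σ ^ 2) * ((p.1 - p.2) ^ 2 / den σ p.1 p.2) := by ring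
      _ ≤ 4 * L ^ 2 * (1 - σ ^ 2) * 4 := by
          gcongr
          rw [div_le_iff₀ hD]; linarith
      _ = _ := by ring
  have := (h0.const_mul (1 / (8 * π ^ 2))).const_sub (avgSc (fun x => f x * h x))
  simpa using this

/-! ### Endpoint limits of the expectation correction -/

lemma avgInvSc_eq (f : ℝ → ℝ) : avgInvSc f = 1 / π * ∫ x, f x * (edge x)⁻¹ ∂bulk := by
  rw [avgInvSc, intervalIntegral_eq_bulk, ← integral_const_mul]
  refine integral_congr_ae (ae_of_all _ fun x => ?_)
  change f x / (π * edge x) = _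
  simp only [div_eq_mul_inv, mul_inv]
  ring

lemma integrable_mul_inv_edge {f : ℝ → ℝ} (hf : Continuous f) :
    Integrable (fun x => f x * (edge x)⁻¹) bulk := by
  obtain ⟨C, hC⟩ := isCompact_Icc.exists_bound_of_continuousOn (s := Icc (-2 : ℝ) 2)
    hf.continuousOn
  refine integrable_inv_edge.bdd_mul hf.aestronglyMeasurable (c := C) ?_
  filter_upwards [ae_bulk] with x hx using hC x (Ioo_subset_Icc_self hx)

lemma integrable_mul_eKernel {σ : ℝ} (hσ : |σ| < 1) {f : ℝ → ℝ} (hf : Continuous f) :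
    Integrable (fun x => f x * (eKernel σ x * (edge x)⁻¹)) bulk := by
  obtain ⟨C, hC⟩ := isCompact_Icc.exists_bound_of_continuousOn (s := Icc (-2 : ℝ) 2)
    hf.continuousOn
  refine (integral_eKernel hσ).1.bdd_mul hf.aestronglyMeasurable (c := C) ?_
  filter_upwards [ae_bulk] with x hx using hC x (Ioo_subset_Icc_self hx)

lemma EtrInterior_eq {σ : ℝ} (hσ : |σ| < 1) {f : ℝ → ℝ} (hf : Continuous f) :
    EtrInterior f σ = avgInvSc f - 1 / π * ∫ x, f x * (eKernel σ x * (edge x)⁻¹) ∂bulk := by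
  rw [EtrInterior, avgInvSc_eq, avgInvSc_eq, ← mul_sub,
    ← integral_sub (integrable_mul_inv_edge hf) (integrable_mul_eKernel hσ hf)]
  congr 1
  refine integral_congr_ae (ae_of_all _ fun x => ?_)
  simp only [eKernel]
  ring

/-- The weight has mass π and concentrates at 0. Subtracting f(0) leaves an integrand of size L|x|
times the weight, which is dominated and tends to zero pointwise. -/
lemma tendsto_EtrInterior_neg_one {B L : ℝ} {f : ℝ → ℝ} (hf : BddLip B L f) :
    Tendsto (EtrInterior f) (𝓝[>] (-1)) (𝓝 (avgInvSc f - f 0)) := by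
  have hfc := hf.continuous
  have hmem : Ioo (-1 : ℝ) (-1 / 2) ∈ 𝓝[>] (-1 : ℝ) := Ioo_mem_nhdsGT (by norm_num)
  have hev : (fun σ => avgInvSc f - f 0 - 1 / π *
      ∫ x, (f x - f 0) * (eKernel σ x * (edge x)⁻¹) ∂bulk) =ᶠ[𝓝[>] (-1)] EtrInterior f := by
    filter_upwards [hmem] with σ hσ
    have hσ1 : |σ| < 1 := abs_lt.2 ⟨hσ.1, by linarith [hσ.2]⟩
    rw [EtrInterior_eq hσ1 hfc]
    simp_rw [sub_mul]
    rw [integral_sub (integrable_mul_eKernel hσ1 hfc)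
      (integrable_mul_eKernel hσ1 continuous_const), integral_const_mul, (integral_eKernel hσ1).2]
    field_simp
    ring
  refine Tendsto.congr' hev ?_
  have h0 : Tendsto (fun σ => ∫ x, (f x - f 0) * (eKernel σ x * (edge x)⁻¹) ∂bulk)
      (𝓝[>] (-1)) (𝓝 (∫ x, (0 : ℝ) ∂bulk)) := by
    refine tendsto_integral_filter_of_dominated_convergence
      (fun x => 2 * L * (edge x)⁻¹) ?_ ?_ (integrable_inv_edge.const_mul _) ?_
    · refine Eventually.of_forall fun σ => Measurable.aestronglyMeasurable ?_
      have := measurable_eKernel σ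
      have := hfc.measurable
      have := continuous_edge.measurable
      fun_prop
    · filter_upwards [hmem] with σ hσ
      have hσ1 : |σ| < 1 := abs_lt.2 ⟨hσ.1, by linarith [hσ.2]⟩
      filter_upwards [ae_bulk] with x hx
      have hs := edge_pos hx
      have hk := eKernel_nonneg hσ1 (Ioo_subset_Icc_self hx)
      have hl := hf.lip x 0
      rw [sub_zero] at hl
      have hp := eDen_pos hσ1 (Ioo_subset_Icc_self hx)
      -- Arithmetic–geometric mean: 2|x|(1 + σ) ≤ x² + (1 + σ)², where -σ ≥ 1/2 keeps the x² term of
      -- the denominator.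
      have hk2 : |x| * eKernel σ x ≤ 2 := by
        rw [eKernel, ← mul_div_assoc, div_le_iff₀ hp]
        have h1 : 0 < 1 + σ := by linarith [hσ.1]
        have h3 : 1 - σ ^ 2 ≤ 2 * (1 + σ) := by nlinarith
        have h4 : |x| * (1 - σ ^ 2) ≤ |x| * (2 * (1 + σ)) := by gcongr
        nlinarith [sq_abs x, sq_nonneg (|x| - (1 + σ)), hσ.2, sq_nonneg (|x|),
          sq_nonneg (1 + σ), mul_nonneg (sq_nonneg |x|) (by linarith [hσ.2] : 0 ≤ -1 / 2 - σ),
          sq_nonneg (|x| / 2 - (1 + σ))]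
      rw [Real.norm_eq_abs, abs_mul, abs_of_nonneg (a := _ * _) (by positivity)]
      calc |f x - f 0| * (eKernel σ x * (edge x)⁻¹)
          ≤ (L * |x|) * (eKernel σ x * (edge x)⁻¹) := by gcongr
        _ = L * (|x| * eKernel σ x) * (edge x)⁻¹ := by ring
        _ ≤ L * 2 * (edge x)⁻¹ := by have := hf.nonneg_lip; gcongr
        _ = _ := by ring
    · refine ae_of_all _ fun x => ?_
      by_cases hx : x = 0
      · simp [hx]
      · have hc : ContinuousAt (fun σ => (f x - f 0) * (eKernel σ x * (edge x)⁻¹)) (-1) := by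
          have : ContinuousAt (fun σ => eKernel σ x) (-1) := by
            unfold eKernel
            refine ContinuousAt.div (by fun_prop) (by fun_prop) ?_
            simpa using hx
          fun_prop
        have ht := hc.tendsto.mono_left (nhdsWithin_le_nhds (s := Ioi (-1)))
        simpa [eKernel] using ht
  rw [integral_zero] at h0
  simpa using (h0.const_mul (1 / π)).const_sub (avgInvSc f - f 0)

lemma integral_mul_eKernel_odd {σ : ℝ} : ∫ x, x * (eKernel σ x * (edge x)⁻¹) ∂bulk = 0 := by
  have h := integral_comp_neg_bulk (fun x => x * (eKernel σ x * (edge x)⁻¹))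
  have e : ∀ x, -x * (eKernel σ (-x) * (edge (-x))⁻¹) = -(x * (eKernel σ x * (edge x)⁻¹)) := by
    intro x
    rw [edge_neg, eKernel, eKernel, neg_sq]; ring
  simp only [e, integral_neg] at h
  linarith

/-- The weight concentrates symmetrically at ±2. The affine interpolant of f at ±2 contributes its
constant term exactly, its odd part integrating to zero; the remainder is at most L(4 - x²), which
cancels the denominator and leaves a factor 1 - σ². -/
lemma tendsto_EtrInterior_one {B L : ℝ} {f : ℝ → ℝ} (hf : BddLip B L f) :
    Tendsto (EtrInterior f) (𝓝[<] 1) (𝓝 (avgInvSc f - (f 2 + f (-2)) / 2)) := by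
  have hfc := hf.continuous
  set α := (f 2 + f (-2)) / 2 with hα
  set β := (f 2 - f (-2)) / 4 with hβ
  have hlip := hf.nonneg_lip
  have hbeta : |β| ≤ L := by
    have := hf.lip 2 (-2)
    norm_num at this
    rw [hβ, abs_div, abs_of_pos (by norm_num : (0 : ℝ) < 4)]
    linarith
  have hev : (fun σ => avgInvSc f - α - 1 / π *
      ∫ x, (f x - (α + β * x)) * (eKernel σ x * (edge x)⁻¹) ∂bulk) =ᶠ[𝓝[<] 1] EtrInterior f := by
    filter_upwards [Ioo_half_mem] with σ hσ
    have hσ1 : |σ| < 1 := abs_lt.2 ⟨by linarith [hσ.1], hσ.2⟩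
    rw [EtrInterior_eq hσ1 hfc]
    have hi := integrable_mul_eKernel hσ1 hfc
    have h1 : ∫ x, (α + β * x) * (eKernel σ x * (edge x)⁻¹) ∂bulk = α * π := by
      simp_rw [add_mul, mul_assoc]
      rw [integral_add ((integral_eKernel hσ1).1.const_mul α)
        ((integrable_mul_eKernel hσ1 (f := fun x => x) continuous_id).const_mul β), integral_const_mul,
        integral_const_mul, (integral_eKernel hσ1).2]
      rw [integral_mul_eKernel_odd]; ring
    simp_rw [sub_mul]
    rw [integral_sub hi (integrable_mul_eKernel hσ1 (f := fun x => α + β * x) (by fun_prop)), h1]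
    field_simp
    ring
  refine Tendsto.congr' hev ?_
  have h0 : Tendsto (fun σ => ∫ x, (f x - (α + β * x)) * (eKernel σ x * (edge x)⁻¹) ∂bulk)
      (𝓝[<] 1) (𝓝 0) := by
    have hb : Tendsto (fun σ : ℝ => 2 * L * (1 - σ ^ 2) * ∫ x, (edge x)⁻¹ ∂bulk)
        (𝓝[<] 1) (𝓝 0) := by
      have : Continuous (fun σ : ℝ => 2 * L * (1 - σ ^ 2) * ∫ x, (edge x)⁻¹ ∂bulk) := by
        fun_prop
      have := (this.tendsto 1).mono_left (nhdsWithin_le_nhds (s := Iio 1))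
      simpa using this
    refine squeeze_zero_norm' ?_ hb
    filter_upwards [Ioo_half_mem] with σ hσ
    have hσ1 : |σ| < 1 := abs_lt.2 ⟨by linarith [hσ.1], hσ.2⟩
    rw [← integral_const_mul]
    refine norm_integral_le_of_norm_le (integrable_inv_edge.const_mul _) ?_
    filter_upwards [ae_bulk] with x hx
    have hs := edge_pos hx
    have hk := eKernel_nonneg hσ1 (Ioo_subset_Icc_self hx)
    have hp := eDen_pos hσ1 (Ioo_subset_Icc_self hx)
    have hint : |f x - (α + β * x)| ≤ L * (4 - x ^ 2) := by
      have h2 := hf.lip x 2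
      have h3 := hf.lip x (-2)
      rcases le_total 0 x with h | h
      · have e : f x - (α + β * x) = (f x - f 2) + β * (2 - x) := by rw [hα, hβ]; ring
        rw [e]
        have h4 : |x - 2| = 2 - x := by rw [abs_sub_comm]; exact abs_of_pos (by linarith [hx.2])
        rw [h4] at h2
        refine (abs_add_le _ _).trans ?_
        rw [abs_mul, abs_of_pos (by linarith [hx.2] : 0 < 2 - x)]
        have : |β| * (2 - x) ≤ L * (2 - x) := by
          have : 0 ≤ 2 - x := by linarith [hx.2]
          gcongr
        nlinarith [mul_nonneg hlip (mul_nonneg h (by linarith [hx.2] : 0 ≤ 2 - x))]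
      · have e : f x - (α + β * x) = (f x - f (-2)) + -β * (2 + x) := by rw [hα, hβ]; ring
        rw [e]
        have h4 : |x - -2| = 2 + x := by
          rw [show x - -2 = 2 + x by ring]; exact abs_of_pos (by linarith [hx.1])
        rw [h4] at h3
        refine (abs_add_le _ _).trans ?_
        rw [abs_mul, abs_neg, abs_of_pos (by linarith [hx.1] : 0 < 2 + x)]
        have : |β| * (2 + x) ≤ L * (2 + x) := by
          have : 0 ≤ 2 + x := by linarith [hx.1]
          gcongr
        nlinarith [mul_nonneg hlip (mul_nonneg (by linarith : 0 ≤ -x)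
          (by linarith [hx.1] : 0 ≤ 2 + x))]
    have hk2 : (4 - x ^ 2) * eKernel σ x ≤ 2 * (1 - σ ^ 2) := by
      rw [eKernel, ← mul_div_assoc, div_le_iff₀ hp]
      have h1 : 0 ≤ 1 - σ ^ 2 := by nlinarith [hσ.1, hσ.2]
      have h2 : 4 - x ^ 2 ≤ 2 * ((1 + σ) ^ 2 - σ * x ^ 2) := by
        have : 0 ≤ 4 - x ^ 2 := by nlinarith [hx.1, hx.2]
        nlinarith [hσ.1, sq_nonneg (1 - σ)]
      nlinarith
    rw [Real.norm_eq_abs, abs_mul, abs_of_nonneg (a := _ * _) (by positivity)]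
    calc |f x - (α + β * x)| * (eKernel σ x * (edge x)⁻¹)
        ≤ (L * (4 - x ^ 2)) * (eKernel σ x * (edge x)⁻¹) := by gcongr
      _ = L * ((4 - x ^ 2) * eKernel σ x) * (edge x)⁻¹ := by ring
      _ ≤ L * (2 * (1 - σ ^ 2)) * (edge x)⁻¹ := by gcongr
      _ = _ := by ring
  simpa using (h0.const_mul (1 / π)).const_sub (avgInvSc f - α)

/-! ### Values at the endpoints -/

lemma tendsto_neg_nhdsGT_neg_one : Tendsto (fun σ : ℝ => -σ) (𝓝[>] (-1)) (𝓝[<] 1) := by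
  simpa using tendsto_neg_nhdsGT (a := (-1 : ℝ))

lemma abs_lt_one_eventually : ∀ᶠ σ : ℝ in 𝓝[<] 1, |σ| < 1 := by
  filter_upwards [Ioo_half_mem] with σ hσ
  exact abs_lt.2 ⟨by linarith [hσ.1], hσ.2⟩

lemma abs_lt_one_eventually_neg : ∀ᶠ σ : ℝ in 𝓝[>] (-1), |σ| < 1 := by
  filter_upwards [Ioo_mem_nhdsGT (show (-1 : ℝ) < 0 by norm_num)] with σ hσ
  exact abs_lt.2 ⟨hσ.1, by linarith [hσ.2]⟩

lemma tendsto_Vtr2Interior_one {B L : ℝ} {f : ℝ → ℝ} (hf : BddLip B L f) :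
    Tendsto (Vtr2Interior f) (𝓝[<] 1) (𝓝 (trLimit f f)) := by
  refine (tendsto_trForm hf hf).congr' ?_
  filter_upwards [abs_lt_one_eventually] with σ hσ using (Vtr2Interior_eq hσ f).symm

lemma tendsto_Vtr2Interior_neg_one {B L : ℝ} {f : ℝ → ℝ} (hf : BddLip B L f) :
    Tendsto (Vtr2Interior f) (𝓝[>] (-1)) (𝓝 (trLimit f (reflect f))) := by
  refine ((tendsto_trForm hf hf.reflect).comp tendsto_neg_nhdsGT_neg_one).congr' ?_
  filter_upwards [abs_lt_one_eventually_neg] with σ hσ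
  rw [Vtr2Interior_eq hσ f, Function.comp, ← trForm_neg, neg_neg]

lemma tendsto_Vd2Interior_one {B L : ℝ} {f : ℝ → ℝ} (hf : BddLip B L f) :
    Tendsto (Vd2Interior f) (𝓝[<] 1) (𝓝 (avgSc (fun x => f x * f x) - avgSc f ^ 2)) := by
  simp_rw [funext fun σ => Vd2Interior_eq σ f]
  exact (tendsto_dForm hf hf).sub_const _

lemma tendsto_Vd2Interior_neg_one {B L : ℝ} {f : ℝ → ℝ} (hf : BddLip B L f) :
    Tendsto (Vd2Interior f) (𝓝[>] (-1))
      (𝓝 (avgSc (fun x => f x * reflect f x) - avgSc f ^ 2)) := by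
  have h := ((tendsto_dForm hf hf.reflect).comp tendsto_neg_nhdsGT_neg_one).sub_const
    (avgSc f ^ 2)
  refine h.congr fun σ => ?_
  rw [Vd2Interior_eq, Function.comp, ← dForm_neg, neg_neg]

lemma extendToEndpoints_one {F : ℝ → ℝ} {l : ℝ} (h : Tendsto F (𝓝[<] 1) (𝓝 l)) :
    extendToEndpoints F 1 = l := by
  rw [extendToEndpoints, if_pos rfl]; exact h.limUnder_eq

lemma extendToEndpoints_neg_one {F : ℝ → ℝ} {l : ℝ} (h : Tendsto F (𝓝[>] (-1)) (𝓝 l)) :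
    extendToEndpoints F (-1) = l := by
  rw [extendToEndpoints, if_neg (by norm_num), if_pos rfl]; exact h.limUnder_eq

lemma extendToEndpoints_of_abs_lt {F : ℝ → ℝ} {σ : ℝ} (h : |σ| < 1) :
    extendToEndpoints F σ = F σ := by
  have := abs_lt.1 h
  rw [extendToEndpoints, if_neg this.2.ne, if_neg this.1.ne']

/-! ### Rescaled test functions -/

/-- A bounded Lipschitz function supported in `[-R, R]`. -/
structure TestFn (B L R : ℝ) (g : ℝ → ℝ) : Prop extends BddLip B L g where
  supp : ∀ x, R < |x| → g x = 0

/-- The rescaling `x ↦ g (n (x - E))`. -/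
def dil (n E : ℝ) (g : ℝ → ℝ) : ℝ → ℝ := fun x => g (n * (x - E))

/-- The indicator function of `[E - r, E + r]`. -/
def window (E r : ℝ) : ℝ → ℝ := indicator (Icc (E - r) (E + r)) fun _ => 1

lemma TestFn.reflect {B L R : ℝ} {g : ℝ → ℝ} (hg : TestFn B L R g) : TestFn B L R (reflect g) :=
  ⟨hg.toBddLip.reflect, fun x hx => hg.supp _ (by rwa [abs_neg])⟩

lemma BddLip.dil {B L : ℝ} {g : ℝ → ℝ} (hg : BddLip B L g) {n : ℝ} (hn : 0 ≤ n) (E : ℝ) :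
    BddLip B (L * n) (dil n E g) :=
  ⟨fun x => hg.bdd _, fun x y => (hg.lip _ _).trans_eq (by
    rw [← mul_sub, abs_mul, abs_of_nonneg hn, mul_assoc]; congr 3; ring)⟩

lemma reflect_dil_zero (n : ℝ) (g : ℝ → ℝ) : reflect (dil n 0 g) = dil n 0 (reflect g) := by
  funext x; simp [reflect, dil]

lemma window_nonneg (E r x : ℝ) : 0 ≤ window E r x :=
  indicator_nonneg (fun _ _ => zero_le_one) _

lemma window_le_one (E r x : ℝ) : window E r x ≤ 1 :=
  indicator_le_self' (fun _ _ => zero_le_one) _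

lemma window_of_abs_le {E r x : ℝ} (h : |x - E| ≤ r) : window E r x = 1 :=
  indicator_of_mem (by have := abs_le.1 h; constructor <;> linarith) _

lemma window_of_lt {E r x : ℝ} (h : r < |x - E|) : window E r x = 0 := by
  refine indicator_of_notMem (fun hx => ?_) _
  have : |x - E| ≤ r := abs_le.2 ⟨by linarith [hx.1], by linarith [hx.2]⟩
  linarith

lemma measurable_window (E r : ℝ) : Measurable (window E r) :=
  measurable_const.indicator measurableSet_Icc

lemma integrable_window (E r : ℝ) : Integrable (window E r) :=
  (integrable_indicator_iff measurableSet_Icc).2 (integrableOn_const (by simp))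

lemma integral_window (E : ℝ) {r : ℝ} (hr : 0 ≤ r) : ∫ x, window E r x = 2 * r := by
  unfold window
  rw [integral_indicator measurableSet_Icc]
  simp only [integral_const, MeasurableSet.univ, measureReal_restrict_apply, univ_inter,
    Real.volume_real_Icc, smul_eq_mul, mul_one]
  rw [max_eq_left (by linarith)]; ring

lemma TestFn.dil_eq_zero {B L R : ℝ} {g : ℝ → ℝ} (hg : TestFn B L R g) {n E x : ℝ} (hn : 0 < n)
    (hx : R / n < |x - E|) : dil n E g x = 0 := by
  refine hg.supp _ ?_
  rw [abs_mul, abs_of_pos hn]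
  rwa [div_lt_iff₀ hn, mul_comm] at hx

lemma TestFn.abs_dil_le {B L R : ℝ} {g : ℝ → ℝ} (hg : TestFn B L R g) {n E : ℝ} (hn : 0 < n)
    (x : ℝ) : |dil n E g x| ≤ B * window E (R / n) x := by
  by_cases h : |x - E| ≤ R / n
  · rw [window_of_abs_le h, mul_one]; exact hg.bdd _
  · rw [hg.dil_eq_zero hn (not_le.1 h), abs_zero]
    exact mul_nonneg hg.nonneg_bdd (window_nonneg _ _ _)

/-- A bounded quantity at bounded scale is `O(1/n)`. -/
lemma le_div_of_le_scale {q K n n₀ : ℝ} (hq : q ≤ K) (hK : 0 ≤ K) (hn : 0 < n) (h : n ≤ n₀) :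
    q ≤ K * n₀ / n := by
  rw [le_div_iff₀ hn]
  nlinarith

lemma bulk_le_volume : bulk ≤ volume := Measure.restrict_le_self

lemma integral_window_bulk_le (E : ℝ) {r : ℝ} (hr : 0 ≤ r) :
    ∫ x, window E r x ∂bulk ≤ 2 * r := by
  rw [← integral_window E hr]
  exact integral_mono_measure bulk_le_volume (ae_of_all _ (window_nonneg E r))
    (integrable_window E r)

lemma edge_sq_ge {ε x : ℝ} (hε : 0 < ε) (hx : |x| ≤ 2 - ε) : 2 * ε ≤ edge x ^ 2 := by
  have hx2 := abs_le.1 hx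
  rw [edge_sq ⟨by linarith, by linarith⟩, ← sq_abs]
  nlinarith [abs_nonneg x]

lemma mem_bulk_of_abs_le {ε x : ℝ} (hε : 0 < ε) (hx : |x| ≤ 2 - ε) : x ∈ Ioo (-2 : ℝ) 2 := by
  have hx2 := abs_le.1 hx
  constructor <;> linarith

/-- At large scales the window stays inside the bulk. -/
lemma abs_le_of_window {ε E n R x : ℝ} (hε : 0 < ε) (hE : |E| ≤ 2 - ε) (hn : 0 < n)
    (hnR : 2 * R / ε ≤ n) (hx : |x - E| ≤ R / n) : |x| ≤ 2 - ε / 2 := by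
  have h1 : R / n ≤ ε / 2 := by
    rw [div_le_iff₀ hn]
    rw [div_le_iff₀ hε] at hnR
    linarith
  have : |x| ≤ |x - E| + |E| := by
    have := abs_add_le (x - E) E
    rwa [sub_add_cancel] at this
  linarith

lemma integrable_window_mul_inv_edge (E r : ℝ) :
    Integrable (fun x => window E r x * (edge x)⁻¹) bulk :=
  integrable_inv_edge.bdd_mul (measurable_window E r).aestronglyMeasurable (c := 1)
    (ae_of_all _ fun x => by
      rw [Real.norm_eq_abs, abs_of_nonneg (window_nonneg _ _ _)]; exact window_le_one _ _ _)

lemma integral_window_mul_inv_edge_nonneg (E r : ℝ) :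
    0 ≤ ∫ x, window E r x * (edge x)⁻¹ ∂bulk :=
  integral_nonneg fun x => mul_nonneg (window_nonneg _ _ _) (inv_nonneg.2 (edge_nonneg x))

lemma integral_window_mul_inv_edge_le_pi (E r : ℝ) :
    ∫ x, window E r x * (edge x)⁻¹ ∂bulk ≤ π := by
  rw [← integral_inv_edge]
  refine integral_mono (integrable_window_mul_inv_edge E r) integrable_inv_edge fun x => ?_
  exact mul_le_of_le_one_left (inv_nonneg.2 (edge_nonneg x)) (window_le_one _ _ _)

/-- The basic counting estimate: the window has length 2R/n, and once n ≥ 2R/ε the edge factor on it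
is at least √ε. For smaller n the total mass π suffices. -/
lemma exists_integral_window_le (ε R : ℝ) (hε : 0 < ε) (hR : 0 ≤ R) :
    ∃ C, 0 ≤ C ∧ ∀ n E : ℝ, 1 ≤ n → |E| ≤ 2 - ε →
      ∫ x, window E (R / n) x * (edge x)⁻¹ ∂bulk ≤ C / n := by
  refine ⟨(√ε)⁻¹ * (2 * R) + π * (2 * R / ε), by positivity, fun n E hn hE => ?_⟩
  have hn0 : 0 < n := by linarith
  rcases le_total n (2 * R / ε) with h | h
  · refine (le_div_of_le_scale (integral_window_mul_inv_edge_le_pi E (R / n)) pi_pos.le hn0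
      h).trans ?_
    gcongr
    have : 0 ≤ (√ε)⁻¹ * (2 * R) := by positivity
    linarith
  · have h1 : ∫ x, window E (R / n) x * (edge x)⁻¹ ∂bulk ≤
        ∫ x, (√ε)⁻¹ * window E (R / n) x ∂bulk := by
      refine integral_mono_of_nonneg (ae_of_all _ fun x =>
        mul_nonneg (window_nonneg _ _ _) (inv_nonneg.2 (edge_nonneg x)))
        (((integrable_window _ _).mono_measure bulk_le_volume).const_mul _) ?_
      filter_upwards [ae_bulk] with x hx
      by_cases hw : |x - E| ≤ R / n
      · rw [mul_comm]
        refine mul_le_mul_of_nonneg_right ?_ (window_nonneg _ _ _)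
        have hx2 := abs_le_of_window hε hE hn0 h hw
        have h3 := edge_sq_ge (by linarith : 0 < ε / 2) hx2
        have h4 : √ε ≤ edge x := Real.sqrt_le_iff.2 ⟨edge_nonneg x, by linarith⟩
        have : 0 < √ε := Real.sqrt_pos.2 hε
        gcongr
      · rw [window_of_lt (not_le.1 hw)]; simp
    rw [integral_const_mul] at h1
    refine h1.trans ?_
    have h2 := integral_window_bulk_le E (r := R / n) (by positivity)
    calc (√ε)⁻¹ * ∫ x, window E (R / n) x ∂bulk ≤ (√ε)⁻¹ * (2 * (R / n)) := by gcongr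
      _ = (√ε)⁻¹ * (2 * R) / n := by ring
      _ ≤ _ := by
        gcongr
        have : 0 ≤ π * (2 * R / ε) := by positivity
        linarith

/-! ### The expectation correction -/

lemma exists_avgInvSc_le (B L R ε : ℝ) (hε : 0 < ε) (hR : 0 ≤ R) :
    ∃ C, 0 ≤ C ∧ ∀ (g : ℝ → ℝ) (n E : ℝ), TestFn B L R g → 1 ≤ n → |E| ≤ 2 - ε →
      |avgInvSc (dil n E g)| ≤ C / n := by
  obtain ⟨C, hC, h⟩ := exists_integral_window_le ε R hε hR
  refine ⟨|B| * C, by positivity, fun g n E hg hn hE => ?_⟩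
  have hn0 : 0 < n := by linarith
  rw [avgInvSc_eq, abs_mul, abs_of_pos (by positivity : 0 < 1 / π)]
  have h1 : |∫ x, dil n E g x * (edge x)⁻¹ ∂bulk| ≤
      B * ∫ x, window E (R / n) x * (edge x)⁻¹ ∂bulk := by
    rw [← integral_const_mul, ← Real.norm_eq_abs]
    refine norm_integral_le_of_norm_le ((integrable_window_mul_inv_edge _ _).const_mul B)
      (ae_of_all _ fun x => ?_)
    rw [Real.norm_eq_abs, abs_mul, abs_of_nonneg (inv_nonneg.2 (edge_nonneg x)), ← mul_assoc]
    exact mul_le_mul_of_nonneg_right (hg.abs_dil_le hn0 x) (inv_nonneg.2 (edge_nonneg x))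
  have hB := hg.nonneg_bdd
  have hpi : 1 / π ≤ 1 := by rw [div_le_one pi_pos]; linarith [pi_gt_three]
  calc 1 / π * |∫ x, dil n E g x * (edge x)⁻¹ ∂bulk| ≤ 1 * (B * (C / n)) := by
        have := h n E hn hE
        gcongr
        exact h1.trans (by gcongr)
    _ = |B| * C / n := by rw [abs_of_nonneg hB]; ring

lemma eKernel_le_of_bulk {ε δ σ x : ℝ} (hε : 0 < ε) (hδ : 0 < δ) (hσδ : -1 + δ ≤ σ) (hx : |x| ≤ 2 - ε) : eKernel σ x ≤ 2 / (δ ^ 2 * ε) := by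
  have h1 : (1 + σ) ^ 2 - σ * x ^ 2 = ((1 + σ) ^ 2 * edge x ^ 2 + (1 - σ) ^ 2 * x ^ 2) / 4 := by
    rw [edge_sq (Ioo_subset_Icc_self (mem_bulk_of_abs_le hε hx))]; ring
  have h2 := edge_sq_ge hε hx
  have h3 : δ ^ 2 * (2 * ε) ≤ (1 + σ) ^ 2 * edge x ^ 2 := by
    have : δ ≤ 1 + σ := by linarith
    gcongr
  have h4 : δ ^ 2 * ε / 2 ≤ (1 + σ) ^ 2 - σ * x ^ 2 := by
    rw [h1]; nlinarith [mul_nonneg (sq_nonneg (1 - σ)) (sq_nonneg x)]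
  calc eKernel σ x ≤ 1 / (δ ^ 2 * ε / 2) := by
        unfold eKernel
        exact div_le_div₀ zero_le_one (by nlinarith [sq_nonneg σ]) (by positivity) h4
    _ = _ := by field_simp

/-- The constant does not depend on σ as σ approaches 1, so the bound passes to the limit there.
Only σ near -1, where the weight concentrates inside the bulk, is excluded. -/
lemma exists_EtrInterior_le (B L R ε δ : ℝ) (hε : 0 < ε) (hδ : 0 < δ) (hR : 0 ≤ R) :
    ∃ C, 0 ≤ C ∧ ∀ (g : ℝ → ℝ) (n E σ : ℝ), TestFn B L R g → 1 ≤ n → |E| ≤ 2 - ε → |σ| < 1 →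
      -1 + δ ≤ σ → |EtrInterior (dil n E g) σ| ≤ C / n := by
  obtain ⟨C₁, hC₁, h₁⟩ := exists_avgInvSc_le B L R ε hε hR
  obtain ⟨C₂, hC₂, h₂⟩ := exists_integral_window_le ε R hε hR
  refine ⟨C₁ + (|B| * (2 * R / ε) + |B| * (2 / (δ ^ 2 * (ε / 2))) * C₂), by positivity,
    fun g n E σ hg hn hE hσ hσδ => ?_⟩
  have hn0 : 0 < n := by linarith
  have hB := hg.nonneg_bdd
  have hgd := (hg.toBddLip.dil hn0.le E)
  have hgc := hgd.continuous
  rw [EtrInterior_eq hσ hgc, add_div]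
  refine (abs_sub _ _).trans (add_le_add (h₁ g n E hg hn hE) ?_)
  rw [abs_mul, abs_of_pos (by positivity : 0 < 1 / π), abs_of_nonneg hB]
  have hk : ∀ x ∈ Ioo (-2 : ℝ) 2, 0 ≤ eKernel σ x * (edge x)⁻¹ := fun x hx =>
    mul_nonneg (eKernel_nonneg hσ (Ioo_subset_Icc_self hx)) (inv_nonneg.2 (edge_nonneg x))
  rcases le_total n (2 * R / ε) with h | h
  · have h1 : |∫ x, dil n E g x * (eKernel σ x * (edge x)⁻¹) ∂bulk| ≤ B * π := by
      rw [← (integral_eKernel hσ).2, ← integral_const_mul, ← Real.norm_eq_abs]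
      refine norm_integral_le_of_norm_le ((integral_eKernel hσ).1.const_mul B) ?_
      filter_upwards [ae_bulk] with x hx
      rw [Real.norm_eq_abs, abs_mul, abs_of_nonneg (hk x hx)]
      exact mul_le_mul_of_nonneg_right (hgd.bdd x) (hk x hx)
    have h2 : 1 / π * |∫ x, dil n E g x * (eKernel σ x * (edge x)⁻¹) ∂bulk| ≤ B := by
      rw [div_mul_eq_mul_div, one_mul, div_le_iff₀ pi_pos]; exact h1
    refine (le_div_of_le_scale h2 hB hn0 h).trans ?_
    gcongr
    have : 0 ≤ B * (2 / (δ ^ 2 * (ε / 2))) * C₂ := by positivity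
    linarith
  · set K := 2 / (δ ^ 2 * (ε / 2)) with hK
    have hK0 : 0 ≤ K := by positivity
    have h1 : |∫ x, dil n E g x * (eKernel σ x * (edge x)⁻¹) ∂bulk| ≤
        B * K * ∫ x, window E (R / n) x * (edge x)⁻¹ ∂bulk := by
      rw [← integral_const_mul, ← Real.norm_eq_abs]
      refine norm_integral_le_of_norm_le
        ((integrable_window_mul_inv_edge _ _).const_mul _) ?_
      filter_upwards [ae_bulk] with x hx
      rw [Real.norm_eq_abs, abs_mul, abs_of_nonneg (hk x hx)]
      by_cases hw : |x - E| ≤ R / n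
      · rw [window_of_abs_le hw, one_mul, mul_assoc]
        have h3 := eKernel_le_of_bulk (by linarith : 0 < ε / 2) hδ hσδ
          (abs_le_of_window hε hE hn0 h hw)
        have := inv_nonneg.2 (edge_nonneg x)
        have h4 := eKernel_nonneg hσ (Ioo_subset_Icc_self hx)
        have := hgd.bdd x
        gcongr
      · rw [hg.dil_eq_zero hn0 (not_le.1 hw), window_of_lt (not_le.1 hw)]; simp
    have hpi : 1 / π ≤ 1 := by rw [div_le_one pi_pos]; linarith [pi_gt_three]
    calc _ ≤ 1 * (B * K * (C₂ / n)) := by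
          have := h₂ n E hn hE
          gcongr
          exact h1.trans (by gcongr)
      _ = B * K * C₂ / n := by ring
      _ ≤ _ := by
        gcongr
        have : 0 ≤ B * (2 * R / ε) := by positivity
        linarith

lemma exists_Etr_le (B L R ε δ : ℝ) (hε : 0 < ε) (hδ : 0 < δ) (hR : 0 ≤ R) :
    ∃ C, 0 ≤ C ∧ ∀ (g : ℝ → ℝ) (n E σ : ℝ), TestFn B L R g → 1 ≤ n → |E| ≤ 2 - ε →
      σ ∈ Icc (-1 : ℝ) 1 → (σ = -1 ∨ -1 + δ ≤ σ) → (σ = -1 → E = 0 ∨ δ ≤ |E|) →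
      |-(Etr (dil n E g) σ / 2) - ind (σ = -1) * ind (E = 0) * (g 0 / 2)| ≤ C / n := by
  obtain ⟨C₁, hC₁, h₁⟩ := exists_avgInvSc_le B L R ε hε hR
  -- The minimum with 1 ensures that the approximants σ in (1/2, 1) used for the endpoint 1 are
  -- admissible even when δ is large.
  obtain ⟨C₂, hC₂, h₂⟩ := exists_EtrInterior_le B L R ε (min δ 1) hε
    (lt_min hδ one_pos) hR
  refine ⟨C₁ + C₂ + |B| * (R / δ), by positivity, fun g n E σ hg hn hE hσ hσδ hEδ => ?_⟩
  have hn0 : 0 < n := by linarith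
  have hB := hg.nonneg_bdd
  have hgd := (hg.toBddLip.dil hn0.le E)
  have hRn : 0 ≤ |B| * (R / δ) / n := by positivity
  have hC1n : 0 ≤ C₁ / n := by positivity
  have hC2n : 0 ≤ C₂ / n := by positivity
  rw [add_div, add_div]
  by_cases h1 : σ = -1
  · subst h1
    rw [Etr, extendToEndpoints_neg_one (tendsto_EtrInterior_neg_one hgd)]
    have ha := h₁ g n E hg hn hE
    -- f(0) = g(-nE) equals g(0) when E = 0, and vanishes for |E| ≥ δ unless n ≤ R/δ.
    have h0 : |dil n E g 0 - ind (E = 0) * g 0| ≤ |B| * (R / δ) / n := by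
      by_cases hE0 : E = 0
      · rw [hE0]; simpa [dil, ind] using hRn
      · rw [ind, if_neg hE0, zero_mul, sub_zero]
        have hδE := (hEδ rfl).resolve_left hE0
        by_cases hw : |0 - E| ≤ R / n
        · rw [zero_sub, abs_neg, le_div_iff₀ hn0] at hw
          refine le_div_of_le_scale ?_ (abs_nonneg B) hn0 ?_
          · exact (hgd.bdd 0).trans (le_abs_self B)
          · rw [le_div_iff₀ hδ]; nlinarith
        · rw [hg.dil_eq_zero hn0 (not_le.1 hw), abs_zero]; exact hRn
    have e : -((avgInvSc (dil n E g) - dil n E g 0) / 2) - ind ((-1 : ℝ) = -1) * ind (E = 0) *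
        (g 0 / 2) = -(avgInvSc (dil n E g)) / 2 + (dil n E g 0 - ind (E = 0) * g 0) / 2 := by
      rw [ind, if_pos rfl, one_mul]; ring
    rw [e]
    refine (abs_add_le _ _).trans ?_
    rw [abs_div, abs_div, abs_neg, abs_two]
    linarith
  · rw [ind, if_neg h1, zero_mul, zero_mul, sub_zero, abs_neg, abs_div, abs_two]
    have hσδ' := hσδ.resolve_left h1
    have key : |Etr (dil n E g) σ| ≤ C₂ / n := by
      by_cases h2 : σ = 1
      · subst h2
        have ht := tendsto_EtrInterior_one hgd
        rw [Etr, extendToEndpoints_one ht]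
        refine le_of_tendsto ht.abs ?_
        filter_upwards [Ioo_half_mem] with σ hσ'
        refine h₂ g n E σ hg hn hE (abs_lt.2 ⟨by linarith [hσ'.1], hσ'.2⟩) ?_
        linarith [min_le_right δ 1, hσ'.1]
      · have h3 : |σ| < 1 := abs_lt.2 ⟨lt_of_le_of_ne hσ.1 (Ne.symm h1), lt_of_le_of_ne hσ.2 h2⟩
        rw [Etr, extendToEndpoints_of_abs_lt h3]
        exact h₂ g n E σ hg hn hE h3 (by linarith [min_le_left δ 1])
    have := abs_nonneg (Etr (dil n E g) σ)
    linarith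

/-! ### The interior terms of `V_tr^2` and `V_d^2` -/

lemma abs_bilinear_le {f h u v W : ℝ → ℝ} {k : ℝ × ℝ → ℝ} {K : ℝ}
    (hf : ∀ x, |f x| ≤ u x) (hh : ∀ x, |h x| ≤ v x)
    (hk : ∀ᵐ p ∂bulk.prod bulk, |k p| ≤ K * (W p.1 * W p.2))
    (hu : Integrable (fun x => u x * W x) bulk) (hv : Integrable (fun x => v x * W x) bulk) :
    |∫ p, f p.1 * h p.2 * k p ∂bulk.prod bulk| ≤
      K * ((∫ x, u x * W x ∂bulk) * ∫ x, v x * W x ∂bulk) := by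
  rw [← integral_prod_mul, ← integral_const_mul, ← Real.norm_eq_abs]
  refine norm_integral_le_of_norm_le ((hu.mul_prod hv).const_mul K) ?_
  filter_upwards [hk] with p hp
  rw [Real.norm_eq_abs, abs_mul, abs_mul]
  have h1 := hf p.1
  have h2 := hh p.2
  have hu0 := (abs_nonneg _).trans h1
  have hv0 := (abs_nonneg _).trans h2
  calc |f p.1| * |h p.2| * |k p| ≤ u p.1 * v p.2 * (K * (W p.1 * W p.2)) := by gcongr
    _ = _ := by ring

/-- For σ away from ±1 the kernel is dominated by a product, so the integral is at most a multiple
of the squared window integral. One factor gives 1/n; the other is bounded by π and cancels against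
the prefactor. -/
lemma exists_Vtr2Interior_le (B L R ε δ : ℝ) (hε : 0 < ε) (hδ : 0 < δ) (hR : 0 ≤ R) :
    ∃ C, 0 ≤ C ∧ ∀ (g : ℝ → ℝ) (n E σ : ℝ), TestFn B L R g → 1 ≤ n → |E| ≤ 2 - ε →
      |σ| ≤ 1 - δ → |Vtr2Interior (dil n E g) σ| ≤ C / n := by
  obtain ⟨C, hC, h⟩ := exists_integral_window_le ε R hε hR
  refine ⟨32 / δ ^ 4 * (|B| * |B|) * C, by positivity, fun g n E σ hg hn hE hσ => ?_⟩
  have hn0 : 0 < n := by linarith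
  have hB := hg.nonneg_bdd
  have hσ1 : |σ| < 1 := by linarith
  have hi := ((integrable_window_mul_inv_edge E (R / n)).const_mul B)
  simp_rw [← mul_assoc] at hi
  have h1 := abs_bilinear_le (f := dil n E g) (h := dil n E g)
    (u := fun x => B * window E (R / n) x) (v := fun x => B * window E (R / n) x)
    (W := fun x => (edge x)⁻¹) (k := fun p => trKernel σ p.1 p.2) (K := 32 / δ ^ 4)
    (hg.abs_dil_le hn0) (hg.abs_dil_le hn0) (by
      filter_upwards [ae_bulk_prod] with p hp
      refine (abs_trKernel_le' hσ1 hp.1 hp.2).trans ?_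
      have := edge_pos hp.1
      have := edge_pos hp.2
      have : δ ≤ 1 - |σ| := by linarith
      gcongr) hi hi
  rw [Vtr2Interior_eq hσ1, trForm, abs_mul]
  simp_rw [mul_assoc B, integral_const_mul] at h1
  set J := ∫ x, window E (R / n) x * (edge x)⁻¹ ∂bulk with hJ
  have hJ0 : 0 ≤ J := integral_window_mul_inv_edge_nonneg _ _
  have hJpi : J ≤ π := integral_window_mul_inv_edge_le_pi _ _
  have hJn : J ≤ C / n := h n E hn hE
  have hpi : |1 / (4 * π ^ 2)| * π ≤ 1 := by
    rw [abs_of_pos (by positivity), div_mul_eq_mul_div, div_le_one (by positivity)]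
    nlinarith [pi_gt_three]
  calc _ ≤ |1 / (4 * π ^ 2)| * (32 / δ ^ 4 * (B * J * (B * J))) := by gcongr
    _ = |1 / (4 * π ^ 2)| * J * (32 / δ ^ 4 * (B * B) * J) := by ring
    _ ≤ |1 / (4 * π ^ 2)| * π * (32 / δ ^ 4 * (B * B) * (C / n)) := by gcongr
    _ ≤ 1 * (32 / δ ^ 4 * (B * B) * (C / n)) := by gcongr
    _ = _ := by rw [abs_of_nonneg hB]; ring

lemma abs_avgSc_dil_le {B L R : ℝ} {g : ℝ → ℝ} (hg : TestFn B L R g) (hR : 0 ≤ R) {n : ℝ}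
    (hn : 0 < n) (E : ℝ) : |avgSc (dil n E g)| ≤ 2 * B * R / n := by
  have hB := hg.nonneg_bdd
  rw [avgSc_eq, ← Real.norm_eq_abs]
  have h1 : ‖∫ x, dil n E g x * (edge x / (2 * π)) ∂bulk‖ ≤
      ∫ x, B * window E (R / n) x ∂bulk := by
    refine norm_integral_le_of_norm_le
      (((integrable_window _ _).mono_measure bulk_le_volume).const_mul _) (ae_of_all _ fun x => ?_)
    rw [norm_mul, Real.norm_eq_abs, Real.norm_eq_abs,
      abs_of_nonneg (div_nonneg (edge_nonneg x) two_pi_pos.le)]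
    have h2 : edge x / (2 * π) ≤ 1 := by
      rw [div_le_one two_pi_pos]
      linarith [edge_le_two x, pi_gt_three]
    have h3 := hg.abs_dil_le (E := E) hn x
    have h4 := window_nonneg E (R / n) x
    exact (mul_le_of_le_one_right (abs_nonneg _) h2).trans h3
  rw [integral_const_mul] at h1
  have h2 := integral_window_bulk_le E (r := R / n) (by positivity)
  calc _ ≤ B * (2 * (R / n)) := h1.trans (by gcongr)
    _ = _ := by ring

/-- Both window factors are kept here: C_N is of order n, so the order n⁻² is needed. -/
lemma abs_dForm_dil_le {B L R δ σ : ℝ} {g : ℝ → ℝ} (hg : TestFn B L R g) (hR : 0 ≤ R)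
    (hδ : 0 < δ) (hσ : |σ| ≤ 1 - δ) {n : ℝ} (hn : 0 < n) (E : ℝ) :
    |dForm σ (dil n E g) (dil n E g)| ≤ 4 / δ ^ 4 * (2 * B * R / n) ^ 2 := by
  have hB := hg.nonneg_bdd
  have hσ1 : |σ| < 1 := by linarith
  have hi : Integrable (fun x => B * window E (R / n) x * 1) bulk := by
    simp_rw [mul_one]
    exact ((integrable_window _ _).mono_measure bulk_le_volume).const_mul _
  have h1 := abs_bilinear_le (f := dil n E g) (h := dil n E g)
    (u := fun x => B * window E (R / n) x) (v := fun x => B * window E (R / n) x)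
    (W := fun _ => 1) (k := fun p => dKernel σ p.1 p.2) (K := 4 / δ ^ 4)
    (hg.abs_dil_le hn) (hg.abs_dil_le hn) (by
      filter_upwards [ae_bulk_prod] with p hp
      refine (abs_dKernel_le' hσ1 hp.1 hp.2).trans ?_
      have : δ ≤ 1 - |σ| := by linarith
      rw [mul_one, mul_one]
      gcongr) hi hi
  rw [dForm, abs_mul]
  simp_rw [mul_one, integral_const_mul] at h1
  have h2 := integral_window_bulk_le E (r := R / n) (by positivity)
  have h0 : 0 ≤ ∫ x, window E (R / n) x ∂bulk := integral_nonneg (window_nonneg _ _)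
  set J := ∫ x, window E (R / n) x ∂bulk
  have hpi : |1 / (4 * π ^ 2)| ≤ 1 := by
    rw [abs_of_pos (by positivity), div_le_one (by positivity)]
    nlinarith [pi_gt_three]
  calc _ ≤ 1 * (4 / δ ^ 4 * (B * J * (B * J))) := by gcongr
    _ = 4 / δ ^ 4 * (B * J) ^ 2 := by ring
    _ ≤ 4 / δ ^ 4 * (B * (2 * (R / n))) ^ 2 := by gcongr
    _ = _ := by ring

/-! ### The variance on the diagonal -/

/-- The density `ρ_N` at scale `n⁻¹`. -/
def rhoScale (n E : ℝ) : ℝ := rhoC ((E : ℂ) + ((n⁻¹ : ℝ) : ℂ) * Complex.I)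

lemma rhoScale_ge {ε n E : ℝ} (hε : 0 < ε) (hn : 1 ≤ n) (hE : |E| ≤ 2 - ε) :
    ε / (6 * π) ≤ rhoScale n E := by
  have hn0 : 0 < n := by linarith
  have h := (im_mSc_bounds (mem_bulk_of_abs_le hε hE) (inv_pos.2 hn0) (inv_le_one_of_one_le₀ hn)).1
  have h2 := edge_sq_ge hε hE
  rw [rhoScale, rhoC, ← div_div]
  gcongr
  refine le_trans ?_ (le_abs_self _)
  linarith

lemma abs_rhoScale_sub_le {ε n E : ℝ} (hε : 0 < ε) (hn : 1 ≤ n) (hE : |E| ≤ 2 - ε) :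
    |rhoScale n E - edge E / (2 * π)| ≤ (1 + 2 / √ε) / n := by
  have hn0 : 0 < n := by linarith
  obtain ⟨h1, h⟩ := im_mSc_bounds (mem_bulk_of_abs_le hε hE) (inv_pos.2 hn0)
    (inv_le_one_of_one_le₀ hn)
  have h2 := edge_sq_ge hε hE
  have h3 : √ε ≤ edge E := Real.sqrt_le_iff.2 ⟨edge_nonneg E, by linarith⟩
  have h4 : 0 < √ε := Real.sqrt_pos.2 hε
  have hb : 0 ≤ (mSc ((E : ℂ) + ((n⁻¹ : ℝ) : ℂ) * Complex.I)).im := by nlinarith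
  rw [rhoScale, rhoC, abs_of_nonneg hb]
  set b := (mSc ((E : ℂ) + ((n⁻¹ : ℝ) : ℂ) * Complex.I)).im
  have e : b / π - edge E / (2 * π) = (2 * b - edge E) / (2 * π) := by
    field_simp
  rw [e, abs_div, abs_of_pos two_pi_pos]
  have h5 : (1 + 2 / edge E) * n⁻¹ ≤ (1 + 2 / √ε) / n := by
    rw [div_eq_mul_inv (1 + 2 / √ε)]; gcongr
  refine (div_le_self (abs_nonneg _) (by linarith [pi_gt_three])).trans (h.trans h5)

/-- Rationalise the difference of roots, using `edge E` ≤ `edge x` + `edge E`. Outside [-2, 2] the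
root is zero and the claim reads 4 - E² ≤ |x² - E²|. -/
lemma abs_edge_sub_le {E x : ℝ} (hE : 0 < edge E) :
    |edge x - edge E| ≤ |x ^ 2 - E ^ 2| / edge E := by
  have hE2 : edge E ^ 2 = 4 - E ^ 2 := Real.sq_sqrt (Real.sqrt_pos.1 hE).le
  rw [le_div_iff₀ hE]
  rcases le_total 0 (4 - x ^ 2) with h | h
  · have hx2 : edge x ^ 2 = 4 - x ^ 2 := Real.sq_sqrt h
    have hx := edge_nonneg x
    calc |edge x - edge E| * edge E ≤ |edge x - edge E| * |edge x + edge E| := by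
          gcongr
          exact (le_abs_self _).trans' (by linarith)
      _ = |x ^ 2 - E ^ 2| := by
          rw [← abs_mul, ← abs_neg]
          congr 1
          linear_combination -(hx2 - hE2)
  · have hx : edge x = 0 := Real.sqrt_eq_zero_of_nonpos h
    rw [hx, zero_sub, abs_neg, abs_of_pos hE, ← pow_two, hE2]
    exact (le_abs_self _).trans' (by linarith)

/-- Extending the integral to ℝ lets the substitution x = E + u/n be made without boundary terms. -/
lemma avgSc_eq_integral (f : ℝ → ℝ) : avgSc f = ∫ x, f x * (edge x / (2 * π)) := by
  rw [avgSc_eq, bulk, setIntegral_eq_integral_of_forall_compl_eq_zero]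
  intro x hx
  rw [edge_eq_zero_of_notMem hx]; simp

lemma integral_comp_dil {F : Type*} [NormedAddCommGroup F] [NormedSpace ℝ F] (φ : ℝ → F) {n : ℝ}
    (hn : 0 < n) (E : ℝ) : ∫ x, φ (n * (x - E)) = n⁻¹ • ∫ u, φ u := by
  rw [integral_sub_right_eq_self (fun x => φ (n * x)) E, Measure.integral_comp_mul_left,
    abs_of_pos (inv_pos.2 hn)]

lemma TestFn.abs_mul_le {B L R : ℝ} {g h : ℝ → ℝ} (hg : TestFn B L R g) (hh : TestFn B L R h)
    (x : ℝ) : |g x * h x| ≤ B ^ 2 * window 0 R x := by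
  by_cases hx : |x - 0| ≤ R
  · rw [window_of_abs_le hx, abs_mul, mul_one, pow_two]
    exact mul_le_mul (hg.bdd x) (hh.bdd x) (abs_nonneg _) hg.nonneg_bdd
  · rw [window_of_lt (not_le.1 hx), hg.supp x (by simpa using hx)]; simp

lemma TestFn.integrable_mul {B L R : ℝ} {g h : ℝ → ℝ} (hg : TestFn B L R g)
    (hh : TestFn B L R h) : Integrable (fun x => g x * h x) :=
  ((integrable_window 0 R).const_mul (B ^ 2)).mono'
    (hg.continuous.mul hh.continuous).aestronglyMeasurable (ae_of_all _ (hg.abs_mul_le hh))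

/-- After rescaling, the difference is ρ_N⁻¹ times the integral of gh against `edge (E + u/n)`/(2π)
- ρ_N. On the support of gh this density difference is O(1/n), by `abs_edge_sub_le` and
`abs_rhoScale_sub_le`. -/
lemma exists_variance_le (B L R ε : ℝ) (hε : 0 < ε) (hR : 0 ≤ R) :
    ∃ C, 0 ≤ C ∧ ∀ (g h : ℝ → ℝ) (n E : ℝ), TestFn B L R g → TestFn B L R h → 1 ≤ n →
      |E| ≤ 2 - ε →
      |n / rhoScale n E * avgSc (fun x => dil n E g x * dil n E h x) - innerL2 g h| ≤ C / n := by
  set K := R * (4 + R) / √ε + (1 + 2 / √ε) with hK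
  refine ⟨6 * π / ε * (B ^ 2 * (2 * R) * K), by positivity, fun g h n E hg hh hn hE => ?_⟩
  have hn0 : 0 < n := by linarith
  have hs : √ε ≤ edge E :=
    Real.sqrt_le_iff.2 ⟨edge_nonneg E, by linarith [edge_sq_ge hε hE]⟩
  have hs0 : 0 < √ε := Real.sqrt_pos.2 hε
  have hr := rhoScale_ge hε hn hE
  have hr0 : 0 < rhoScale n E := lt_of_lt_of_le (by positivity) hr
  have hr1 : (rhoScale n E)⁻¹ ≤ 6 * π / ε := by
    rw [← inv_div]; gcongr
  have hrs := abs_rhoScale_sub_le hε hn hE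
  have hgh := hg.integrable_mul hh
  have h1 : avgSc (fun x => dil n E g x * dil n E h x) =
      n⁻¹ * ∫ u, g u * h u * (edge (E + u / n) / (2 * π)) := by
    have hcomp := integral_comp_dil (fun u => g u * h u * (edge (E + u / n) / (2 * π))) hn0 E
    rw [smul_eq_mul] at hcomp
    rw [avgSc_eq_integral, ← hcomp]
    refine integral_congr_ae (ae_of_all _ fun x => ?_)
    have : E + n * (x - E) / n = x := by field_simp; ring
    simp only [this, dil]
  have hi : Integrable (fun u => g u * h u * (edge (E + u / n) / (2 * π))) := by
    have hc : Continuous (fun u => edge (E + u / n) / (2 * π)) :=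
      (continuous_edge.comp (by fun_prop)).div_const _
    refine hgh.mul_bdd (c := 1) hc.aestronglyMeasurable (ae_of_all _ fun u => ?_)
    rw [Real.norm_eq_abs, abs_of_nonneg (div_nonneg (edge_nonneg _) two_pi_pos.le),
      div_le_one two_pi_pos]
    linarith [edge_le_two (E + u / n), pi_gt_three]
  have h2 : n / rhoScale n E * avgSc (fun x => dil n E g x * dil n E h x) - innerL2 g h =
      (rhoScale n E)⁻¹ *
        ∫ u, g u * h u * (edge (E + u / n) / (2 * π) - rhoScale n E) := by
    simp_rw [mul_sub]
    rw [integral_sub hi (hgh.mul_const _), integral_mul_const, h1, innerL2]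
    field_simp
  rw [h2, abs_mul, abs_of_pos (inv_pos.2 hr0)]
  have hb : |∫ u, g u * h u * (edge (E + u / n) / (2 * π) - rhoScale n E)| ≤
      ∫ u, B ^ 2 * window 0 R u * (K / n) := by
    rw [← Real.norm_eq_abs]
    refine norm_integral_le_of_norm_le (((integrable_window 0 R).const_mul _).mul_const _)
      (ae_of_all _ fun u => ?_)
    rw [Real.norm_eq_abs, abs_mul]
    by_cases hu : |u - 0| ≤ R
    · refine mul_le_mul (hg.abs_mul_le hh u) ?_ (abs_nonneg _)
        (mul_nonneg (sq_nonneg _) (window_nonneg _ _ _))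
      rw [sub_zero] at hu
      have h3 : |edge (E + u / n) - edge E| ≤ R * (4 + R) / √ε / n := by
        refine (abs_edge_sub_le (hs0.trans_le hs)).trans ?_
        have e : (E + u / n) ^ 2 - E ^ 2 = u / n * (2 * E + u / n) := by ring
        have h4 : |u / n| ≤ R / n := by rw [abs_div, abs_of_pos hn0]; gcongr
        have h5 : |2 * E + u / n| ≤ 4 + R := by
          refine (abs_add_le _ _).trans ?_
          rw [abs_mul, abs_two]
          have : R / n ≤ R := div_le_self hR hn
          linarith
        rw [e, abs_mul]
        calc |u / n| * |2 * E + u / n| / edge E ≤ R / n * (4 + R) / √ε := by gcongr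
          _ = _ := by ring
      have h6 : edge (E + u / n) / (2 * π) - rhoScale n E =
          (edge (E + u / n) - edge E) / (2 * π) - (rhoScale n E - edge E / (2 * π)) := by ring
      rw [h6, hK, add_div]
      refine (abs_sub _ _).trans (add_le_add ?_ hrs)
      rw [abs_div, abs_of_pos two_pi_pos]
      exact (div_le_self (abs_nonneg _) (by linarith [pi_gt_three])).trans h3
    · rw [window_of_lt (not_le.1 hu), hg.supp u (by simpa using hu)]; simp
  rw [integral_mul_const, integral_const_mul, integral_window 0 hR] at hb
  calc _ ≤ 6 * π / ε * (B ^ 2 * (2 * R) * (K / n)) := by gcongr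
    _ = _ := by ring

lemma scale_mul_le {ε n E q K : ℝ} (hε : 0 < ε) (hn : 1 ≤ n) (hE : |E| ≤ 2 - ε)
    (hq : |q| ≤ K / n ^ 2) : |n / rhoScale n E * q| ≤ 6 * π / ε * K / n := by
  have hn0 : 0 < n := by linarith
  have hr := rhoScale_ge hε hn hE
  have hr0 : 0 < rhoScale n E := lt_of_lt_of_le (by positivity) hr
  rw [abs_mul, abs_of_pos (by positivity)]
  calc n / rhoScale n E * |q| ≤ n / (ε / (6 * π)) * (K / n ^ 2) := by gcongr
    _ = _ := by field_simp

lemma abs_avgSc_dil_sq_le {B L R : ℝ} {g : ℝ → ℝ} (hg : TestFn B L R g) (hR : 0 ≤ R) {n : ℝ}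
    (hn : 0 < n) (E : ℝ) : |avgSc (dil n E g) ^ 2| ≤ (2 * B * R) ^ 2 / n ^ 2 := by
  rw [abs_pow, ← div_pow]
  have := abs_avgSc_dil_le hg hR hn E
  gcongr

lemma exists_Vd_limit_le (B L R ε : ℝ) (hε : 0 < ε) (hR : 0 ≤ R) :
    ∃ C, 0 ≤ C ∧ ∀ (g h : ℝ → ℝ) (n E : ℝ), TestFn B L R g → TestFn B L R h → 1 ≤ n →
      |E| ≤ 2 - ε →
      |n / rhoScale n E * (avgSc (fun x => dil n E g x * dil n E h x) - avgSc (dil n E g) ^ 2) -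
        innerL2 g h| ≤ C / n := by
  obtain ⟨C, hC, h₁⟩ := exists_variance_le B L R ε hε hR
  refine ⟨C + 6 * π / ε * (2 * B * R) ^ 2, by positivity, fun g h n E hg hh hn hE => ?_⟩
  have hn0 : 0 < n := by linarith
  have h2 := scale_mul_le hε hn hE (abs_avgSc_dil_sq_le hg hR hn0 E)
  rw [mul_sub, add_div, sub_right_comm]
  exact (abs_sub _ _).trans (add_le_add (h₁ g h n E hg hh hn hE) h2)

lemma exists_Vd2Interior_le (B L R ε δ : ℝ) (hε : 0 < ε) (hδ : 0 < δ) (hR : 0 ≤ R) :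
    ∃ C, 0 ≤ C ∧ ∀ (g : ℝ → ℝ) (n E σ : ℝ), TestFn B L R g → 1 ≤ n → |E| ≤ 2 - ε →
      |σ| ≤ 1 - δ → |n / rhoScale n E * Vd2Interior (dil n E g) σ| ≤ C / n := by
  refine ⟨6 * π / ε * (4 / δ ^ 4 * (2 * B * R) ^ 2 + (2 * B * R) ^ 2), by positivity,
    fun g n E σ hg hn hE hσ => ?_⟩
  have hn0 : 0 < n := by linarith
  refine scale_mul_le hε hn hE ?_
  rw [Vd2Interior_eq, add_div]
  refine (abs_sub _ _).trans (add_le_add ?_ (abs_avgSc_dil_sq_le hg hR hn0 E))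
  refine (abs_dForm_dil_le hg hR hδ hσ hn0 E).trans_eq ?_
  ring

/-- Away from the origin a window is disjoint from its reflection. -/
lemma TestFn.dil_mul_reflect_eq_zero {B L R : ℝ} {g : ℝ → ℝ} (hg : TestFn B L R g) {n E δ : ℝ}
    (hn : 0 < n) (hδ : δ ≤ |E|) {x y : ℝ} (hxy : |x - y| < 2 * δ - 2 * (R / n)) :
    dil n E g x * WignerMeso.reflect (dil n E g) y = 0 := by
  by_cases hx : |x - E| ≤ R / n
  · by_cases hy : |-y - E| ≤ R / n
    · exfalso
      have e : 2 * E = (x - y) - (x - E) - (-y - E) := by ring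
      have h1 : |2 * E| ≤ |x - y| + |x - E| + |-y - E| := by
        rw [e]
        exact (abs_sub _ _).trans (add_le_add_left (abs_sub _ _) _)
      rw [abs_mul, abs_two] at h1
      linarith
    · have : WignerMeso.reflect (dil n E g) y = 0 := hg.dil_eq_zero hn (not_le.1 hy)
      rw [this, mul_zero]
  · rw [hg.dil_eq_zero hn (not_le.1 hx), zero_mul]

/-- For n ≥ 2R/δ the window and its reflection are disjoint and only the squared mean remains. For
smaller n, the factor (2R/(δn))² ≥ 1 turns a constant bound into O(n⁻²). -/
lemma exists_Vd_separated_le (B L R ε δ : ℝ) (hε : 0 < ε) (hδ : 0 < δ) (hR : 0 ≤ R) :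
    ∃ C, 0 ≤ C ∧ ∀ (g : ℝ → ℝ) (n E : ℝ), TestFn B L R g → 1 ≤ n → |E| ≤ 2 - ε → δ ≤ |E| →
      |n / rhoScale n E * (avgSc (fun x => dil n E g x * reflect (dil n E g) x) -
        avgSc (dil n E g) ^ 2)| ≤ C / n := by
  refine ⟨6 * π / ε * (4 * |B| * |B| * (2 * R / δ) ^ 2 + (2 * B * R) ^ 2), by positivity,
    fun g n E hg hn hE hEδ => ?_⟩
  have hn0 : 0 < n := by linarith
  have hB := hg.nonneg_bdd
  refine scale_mul_le hε hn hE ?_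
  rw [add_div]
  refine (abs_sub _ _).trans (add_le_add ?_ (abs_avgSc_dil_sq_le hg hR hn0 E))
  rcases le_total n (2 * R / δ) with h | h
  · have h1 : |avgSc (fun x => dil n E g x * reflect (dil n E g) x)| ≤ 4 * B * B := by
      rw [avgSc, ← Real.norm_eq_abs]
      refine (intervalIntegral.norm_integral_le_of_norm_le_const (C := B * B)
        fun x _ => ?_).trans_eq (by norm_num; ring)
      change ‖_ * (edge x / (2 * π))‖ ≤ _
      rw [norm_mul, norm_mul, Real.norm_eq_abs, Real.norm_eq_abs, Real.norm_eq_abs,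
        abs_of_nonneg (div_nonneg (edge_nonneg x) two_pi_pos.le)]
      have h2 : edge x / (2 * π) ≤ 1 := by
        rw [div_le_one two_pi_pos]
        linarith [edge_le_two x, pi_gt_three]
      refine (mul_le_of_le_one_right (by positivity) h2).trans ?_
      exact mul_le_mul (hg.bdd _) (hg.bdd _) (abs_nonneg _) hB
    rw [abs_of_nonneg hB, le_div_iff₀ (by positivity)]
    gcongr
  · have h1 : ∀ x, dil n E g x * reflect (dil n E g) x = 0 := by
      intro x
      by_cases h3 : 0 < δ - R / n
      · refine hg.dil_mul_reflect_eq_zero hn0 hEδ ?_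
        rw [sub_self, abs_zero]; linarith
      · exfalso
        rw [div_le_iff₀ hδ] at h
        have : R / n ≤ δ / 2 := by
          rw [div_le_iff₀ hn0]; linarith
        linarith
    simp_rw [h1]
    simp only [avgSc, zero_mul, intervalIntegral.integral_zero, abs_zero]
    positivity

/-! ### The `H^{1/2}` asymptotics -/

/-- The integrand of the `H^{1/2}` inner product. -/
def quot (f h : ℝ → ℝ) (p : ℝ × ℝ) : ℝ :=
  (f p.1 - f p.2) / (p.1 - p.2) * ((h p.1 - h p.2) / (p.1 - p.2))

/-- The kernel of `V_tr^1`. -/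
def vKernel (p : ℝ × ℝ) : ℝ := (4 - p.1 * p.2) * ((edge p.1)⁻¹ * (edge p.2)⁻¹)

/-- The sum of the indicators of a window in the two coordinates. -/
def cross (E r : ℝ) (p : ℝ × ℝ) : ℝ := window E r p.1 + window E r p.2

lemma cross_nonneg (E r : ℝ) (p : ℝ × ℝ) : 0 ≤ cross E r p :=
  add_nonneg (window_nonneg _ _ _) (window_nonneg _ _ _)

lemma measurable_cross (E r : ℝ) : Measurable (cross E r) :=
  ((measurable_window E r).comp measurable_fst).add ((measurable_window E r).comp measurable_snd)

lemma measurable_quot {f h : ℝ → ℝ} (hf : Measurable f) (hh : Measurable h) :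
    Measurable (quot f h) := by unfold quot; fun_prop

lemma measurable_vKernel : Measurable vKernel := by
  have := continuous_edge.measurable
  unfold vKernel; fun_prop

lemma quot_eq (f h : ℝ → ℝ) (p : ℝ × ℝ) :
    quot f h p = (f p.1 - f p.2) * (h p.1 - h p.2) / (p.1 - p.2) ^ 2 := by
  unfold quot; rw [div_mul_div_comm, pow_two]

lemma abs_quot_le {B L : ℝ} {f h : ℝ → ℝ} (hf : BddLip B L f) (hh : BddLip B L h) (p : ℝ × ℝ) :
    |quot f h p| ≤ L ^ 2 := by
  rw [quot_eq, abs_div, abs_of_nonneg (sq_nonneg (p.1 - p.2))]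
  exact div_le_of_le_mul₀ (sq_nonneg _) (sq_nonneg _) (hf.abs_mul_sub_le hh _ _)

lemma TestFn.abs_increments_le {B L R : ℝ} {g h : ℝ → ℝ} (hg : TestFn B L R g)
    (hh : TestFn B L R h) {n E : ℝ} (hn : 0 < n) (p : ℝ × ℝ) :
    |(dil n E g p.1 - dil n E g p.2) * (dil n E h p.1 - dil n E h p.2)| ≤
      4 * B ^ 2 * cross E (R / n) p := by
  have hB := hg.nonneg_bdd
  rw [abs_mul]
  have h1 : |dil n E g p.1 - dil n E g p.2| ≤ B * cross E (R / n) p := by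
    refine (abs_sub _ _).trans ?_
    rw [cross, mul_add]
    exact add_le_add (hg.abs_dil_le hn _) (hg.abs_dil_le hn _)
  have h2 : |dil n E h p.1 - dil n E h p.2| ≤ 2 * B := by
    refine (abs_sub _ _).trans ?_
    rw [two_mul]
    exact add_le_add (hh.bdd _) (hh.bdd _)
  have h3 := cross_nonneg E (R / n) p
  calc _ ≤ (B * cross E (R / n) p) * (2 * B) := by gcongr
    _ ≤ _ := by nlinarith [mul_nonneg (sq_nonneg B) h3]

lemma vKernel_bounds {p : ℝ × ℝ} (h1 : p.1 ∈ Ioo (-2 : ℝ) 2) (h2 : p.2 ∈ Ioo (-2 : ℝ) 2) :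
    0 < vKernel p ∧ vKernel p ≤ 8 * ((edge p.1)⁻¹ * (edge p.2)⁻¹) := by
  have := edge_pos h1
  have := edge_pos h2
  have h3 : 0 < 4 - p.1 * p.2 := by nlinarith [h1.1, h1.2, h2.1, h2.2]
  refine ⟨by unfold vKernel; positivity, ?_⟩
  unfold vKernel
  gcongr
  nlinarith [h1.1, h1.2, h2.1, h2.2]

/-- With P = 4 - xy and Q = √((4 - x²)(4 - y²)), P² - Q² = 4(x - y)². Hence 0 ≤ P/Q - 1 ≤ (P² -
Q²)/(PQ), and the factor (x - y)² cancels the singularity of `quot`. -/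
lemma abs_vKernel_sub_one_le {p : ℝ × ℝ} (h1 : p.1 ∈ Ioo (-2 : ℝ) 2) (h2 : p.2 ∈ Ioo (-2 : ℝ) 2) :
    |vKernel p - 1| ≤
      4 * (p.1 - p.2) ^ 2 / (4 - p.1 * p.2) * ((edge p.1)⁻¹ * (edge p.2)⁻¹) := by
  have e1 := edge_pos h1
  have e2 := edge_pos h2
  have s1 := edge_sq (Ioo_subset_Icc_self h1)
  have s2 := edge_sq (Ioo_subset_Icc_self h2)
  have hP : 0 < 4 - p.1 * p.2 := by nlinarith [h1.1, h1.2, h2.1, h2.2]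
  set P := 4 - p.1 * p.2 with hPdef
  set Q := edge p.1 * edge p.2 with hQdef
  have hQ : 0 < Q := by positivity
  have hPQ : P ^ 2 - Q ^ 2 = 4 * (p.1 - p.2) ^ 2 := by
    rw [hQdef, mul_pow, s1, s2, hPdef]; ring
  have hPQ' : Q ≤ P := by
    refine le_of_sq_le_sq ?_ hP.le
    nlinarith [sq_nonneg (p.1 - p.2)]
  have ev : vKernel p = P / Q := by
    unfold vKernel; rw [← mul_inv, div_eq_mul_inv]
  rw [ev, ← mul_inv, ← hPQ, abs_of_nonneg (by rw [sub_nonneg, le_div_iff₀ hQ]; linarith)]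
  rw [div_sub_one hQ.ne', ← div_eq_mul_inv]
  gcongr
  rw [le_div_iff₀ hP]
  nlinarith

lemma integrable_cross_mul_inv_edge (E r : ℝ) :
    Integrable (fun p : ℝ × ℝ => cross E r p * ((edge p.1)⁻¹ * (edge p.2)⁻¹))
      (bulk.prod bulk) :=
  integrable_inv_edge_prod.bdd_mul (measurable_cross E r).aestronglyMeasurable (c := 2)
    (ae_of_all _ fun p => by
      rw [Real.norm_eq_abs, abs_of_nonneg (cross_nonneg _ _ _), cross]
      linarith [window_le_one E r p.1, window_le_one E r p.2])

lemma integral_cross_mul_inv_edge (E r : ℝ) :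
    ∫ p, cross E r p * ((edge p.1)⁻¹ * (edge p.2)⁻¹) ∂bulk.prod bulk =
      2 * π * ∫ x, window E r x * (edge x)⁻¹ ∂bulk := by
  have i1 := (integrable_window_mul_inv_edge E r).mul_prod integrable_inv_edge
  have i2 := integrable_inv_edge.mul_prod (integrable_window_mul_inv_edge E r)
  have e : ∀ p : ℝ × ℝ, cross E r p * ((edge p.1)⁻¹ * (edge p.2)⁻¹) =
      window E r p.1 * (edge p.1)⁻¹ * (edge p.2)⁻¹ +
      (edge p.1)⁻¹ * (window E r p.2 * (edge p.2)⁻¹) := fun p => by unfold cross; ring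
  simp_rw [e]
  rw [integral_add i1 i2, integral_prod_mul (fun x => window E r x * (edge x)⁻¹)
    (fun x => (edge x)⁻¹), integral_prod_mul (fun x => (edge x)⁻¹)
    (fun x => window E r x * (edge x)⁻¹), integral_inv_edge]
  ring

/-- A window in the first coordinate against a Cauchy kernel. -/
lemma window_cauchy (E : ℝ) {r : ℝ} (hr : 0 ≤ r) :
    Integrable (fun p : ℝ × ℝ => window E r p.1 * (1 + (p.1 - p.2) ^ 2)⁻¹) ∧
    ∫ p : ℝ × ℝ, window E r p.1 * (1 + (p.1 - p.2) ^ 2)⁻¹ = 2 * r * π := by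
  have hc : ∀ x : ℝ, Integrable fun y : ℝ => (1 + (x - y) ^ 2)⁻¹ := fun x =>
    integrable_inv_one_add_sq.comp_sub_left x
  have hi : ∀ x : ℝ, ∫ y : ℝ, (1 + (x - y) ^ 2)⁻¹ = π := fun x => by
    rw [integral_sub_left_eq_self (fun t : ℝ => (1 + t ^ 2)⁻¹), integral_univ_inv_one_add_sq]
  have hm : AEStronglyMeasurable
      (fun p : ℝ × ℝ => window E r p.1 * (1 + (p.1 - p.2) ^ 2)⁻¹) (volume.prod volume) := by
    have := measurable_window E r
    exact Measurable.aestronglyMeasurable (by fun_prop)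
  have hint : Integrable (fun p : ℝ × ℝ => window E r p.1 * (1 + (p.1 - p.2) ^ 2)⁻¹)
      (volume.prod volume) := by
    rw [integrable_prod_iff hm]
    refine ⟨ae_of_all _ fun x => (hc x).const_mul (window E r x), ?_⟩
    refine ((integrable_window E r).mul_const π).congr (ae_of_all _ fun x => ?_)
    simp only
    rw [← hi x, ← integral_const_mul]
    refine integral_congr_ae (ae_of_all _ fun y => ?_)
    have := window_nonneg E r x
    simp only
    rw [Real.norm_eq_abs, abs_of_nonneg (by positivity)]
  refine ⟨hint, ?_⟩
  rw [Measure.volume_eq_prod, integral_prod _ hint]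
  simp_rw [integral_const_mul, hi, integral_mul_const]
  rw [integral_window E hr]

lemma cross_cauchy (E : ℝ) {r : ℝ} (hr : 0 ≤ r) :
    Integrable (fun p : ℝ × ℝ => cross E r p * (1 + (p.1 - p.2) ^ 2)⁻¹) ∧
    ∫ p : ℝ × ℝ, cross E r p * (1 + (p.1 - p.2) ^ 2)⁻¹ = 4 * r * π := by
  obtain ⟨i1, e1⟩ := window_cauchy E hr
  have e2 : ∫ p : ℝ × ℝ, window E r p.2 * (1 + (p.1 - p.2) ^ 2)⁻¹ = 2 * r * π := by
    rw [← e1, Measure.volume_eq_prod, ← integral_prod_swap]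
    refine integral_congr_ae (ae_of_all _ fun p => ?_)
    simp only [Prod.fst_swap, Prod.snd_swap]
    rw [← neg_sub, neg_sq]
  have i2 : Integrable (fun p : ℝ × ℝ => window E r p.2 * (1 + (p.1 - p.2) ^ 2)⁻¹) := by
    refine (Integrable.swap (μ := (volume : Measure ℝ)) (ν := (volume : Measure ℝ)) i1).congr
      (ae_of_all _ fun p => ?_)
    simp only [Function.comp, Prod.fst_swap, Prod.snd_swap]
    rw [← neg_sub, neg_sq]
  have e : ∀ p : ℝ × ℝ, cross E r p * (1 + (p.1 - p.2) ^ 2)⁻¹ =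
      window E r p.1 * (1 + (p.1 - p.2) ^ 2)⁻¹ + window E r p.2 * (1 + (p.1 - p.2) ^ 2)⁻¹ :=
    fun p => by unfold cross; ring
  simp_rw [e]
  refine ⟨i1.add i2, ?_⟩
  rw [integral_add i1 i2, e1, e2]
  ring

/-- The Lipschitz bound controls the diagonal and the sup bound gives decay (x - y)⁻²; adding the
two yields one Cauchy majorant, integrable over the plane. -/
lemma TestFn.abs_quot_dil_le {B L R : ℝ} {g h : ℝ → ℝ} (hg : TestFn B L R g)
    (hh : TestFn B L R h) {n E : ℝ} (hn : 0 < n) (p : ℝ × ℝ) :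
    |quot (dil n E g) (dil n E h) p| ≤
      ((L * n) ^ 2 + 4 * B ^ 2) * (cross E (R / n) p * (1 + (p.1 - p.2) ^ 2)⁻¹) := by
  have h1 := abs_quot_le (hg.toBddLip.dil hn.le E) (hh.toBddLip.dil hn.le E) p
  have h2 := hg.abs_increments_le hh hn (E := E) p
  have h3 : (p.1 - p.2) ^ 2 * |quot (dil n E g) (dil n E h) p| ≤
      4 * B ^ 2 * cross E (R / n) p := by
    refine le_trans ?_ h2
    rw [quot_eq, abs_div, abs_of_nonneg (sq_nonneg (p.1 - p.2))]
    rw [← mul_div_assoc]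
    exact div_le_of_le_mul₀ (sq_nonneg _) (abs_nonneg _) (mul_comm _ _).le
  have h4 : |quot (dil n E g) (dil n E h) p| ≤ (L * n) ^ 2 * cross E (R / n) p := by
    by_cases hx : |p.1 - E| ≤ R / n
    · refine h1.trans (le_mul_of_one_le_right (sq_nonneg _) ?_)
      rw [cross, window_of_abs_le hx]; linarith [window_nonneg E (R / n) p.2]
    · by_cases hy : |p.2 - E| ≤ R / n
      · refine h1.trans (le_mul_of_one_le_right (sq_nonneg _) ?_)
        rw [cross, window_of_abs_le hy]; linarith [window_nonneg E (R / n) p.1]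
      · rw [quot, hg.dil_eq_zero hn (not_le.1 hx), hg.dil_eq_zero hn (not_le.1 hy)]
        simp only [sub_self, zero_div, zero_mul, abs_zero]
        exact mul_nonneg (sq_nonneg _) (cross_nonneg _ _ _)
  rw [← mul_assoc, ← div_eq_mul_inv, le_div_iff₀ (by positivity)]
  nlinarith

lemma TestFn.integrable_quot_dil {B L R : ℝ} {g h : ℝ → ℝ} (hg : TestFn B L R g)
    (hh : TestFn B L R h) (hR : 0 ≤ R) {n : ℝ} (E : ℝ) (hn : 0 < n) :
    Integrable (quot (dil n E g) (dil n E h)) :=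
  ((cross_cauchy E (by positivity : 0 ≤ R / n)).1.const_mul _).mono'
    (measurable_quot (hg.toBddLip.dil hn.le E).continuous.measurable
      (hh.toBddLip.dil hn.le E).continuous.measurable).aestronglyMeasurable
    (ae_of_all _ (hg.abs_quot_dil_le hh hn))

/-- Scale invariance: `quot` picks up n² under dilation, which cancels the Jacobian n⁻² in the
plane. -/
lemma innerHhalf_dil (g h : ℝ → ℝ) {n : ℝ} (hn : 0 < n) (E : ℝ) :
    ∫ p, quot (dil n E g) (dil n E h) p = innerHhalf g h := by
  have h1 : ∀ p : ℝ × ℝ, quot (dil n E g) (dil n E h) p =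
      n ^ 2 * quot g h (n • (p - (E, E))) := fun p => by
    simp only [quot_eq, dil, Prod.smul_fst, Prod.smul_snd, Prod.fst_sub, Prod.snd_sub,
      smul_eq_mul]
    rw [← mul_sub, mul_pow, sub_sub_sub_cancel_right]
    field_simp
  simp_rw [h1]
  rw [integral_const_mul, integral_sub_right_eq_self (fun p => quot g h (n • p)),
    Measure.integral_comp_smul]
  have : Module.finrank ℝ (ℝ × ℝ) = 2 := by simp
  rw [this, abs_of_pos (by positivity), smul_eq_mul, ← mul_assoc,
    mul_inv_cancel₀ (by positivity), one_mul]
  rfl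

lemma integrable_quot_mul_vKernel {B L : ℝ} {f h : ℝ → ℝ} (hf : BddLip B L f)
    (hh : BddLip B L h) : Integrable (fun p => quot f h p * vKernel p) (bulk.prod bulk) := by
  refine (integrable_inv_edge_prod.const_mul (L ^ 2 * 8)).mono'
    ((measurable_quot hf.continuous.measurable hh.continuous.measurable).mul
      measurable_vKernel).aestronglyMeasurable ?_
  filter_upwards [ae_bulk_prod] with p hp
  have hv := vKernel_bounds hp.1 hp.2
  rw [norm_mul, Real.norm_eq_abs, Real.norm_eq_abs, abs_of_pos hv.1, mul_assoc]
  have := abs_quot_le hf hh p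
  exact mul_le_mul this hv.2 hv.1.le (sq_nonneg _)

lemma trLimit_eq (f h : ℝ → ℝ) :
    trLimit f h = 1 / (4 * π ^ 2) * ∫ p, quot f h p * vKernel p ∂bulk.prod bulk := rfl

lemma abs_trLimit_le {B L : ℝ} {f h : ℝ → ℝ} (hf : BddLip B L f) (hh : BddLip B L h) :
    |trLimit f h| ≤ 2 * L ^ 2 := by
  have h1 : |∫ p, quot f h p * vKernel p ∂bulk.prod bulk| ≤ L ^ 2 * 8 * (π * π) := by
    have e : ∫ p : ℝ × ℝ, (edge p.1)⁻¹ * (edge p.2)⁻¹ ∂bulk.prod bulk = π * π := by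
      rw [integral_prod_mul (fun x => (edge x)⁻¹) (fun x => (edge x)⁻¹), integral_inv_edge]
    rw [← e, ← integral_const_mul, ← Real.norm_eq_abs]
    refine norm_integral_le_of_norm_le (integrable_inv_edge_prod.const_mul _) ?_
    filter_upwards [ae_bulk_prod] with p hp
    have hv := vKernel_bounds hp.1 hp.2
    rw [norm_mul, Real.norm_eq_abs, Real.norm_eq_abs, abs_of_pos hv.1, mul_assoc]
    exact mul_le_mul (abs_quot_le hf hh p) hv.2 hv.1.le (sq_nonneg _)
  rw [trLimit_eq, abs_mul, abs_of_pos (by positivity), div_mul_eq_mul_div, one_mul,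
    div_le_iff₀ (by positivity)]
  linarith

lemma abs_innerHhalf_le {B L R : ℝ} {g h : ℝ → ℝ} (hg : TestFn B L R g) (hh : TestFn B L R h)
    (hR : 0 ≤ R) : |innerHhalf g h| ≤ (L ^ 2 + 4 * B ^ 2) * (4 * R * π) := by
  obtain ⟨hi, he⟩ := cross_cauchy 0 hR
  rw [← he, ← integral_const_mul, ← innerHhalf_dil g h one_pos 0, ← Real.norm_eq_abs]
  refine norm_integral_le_of_norm_le (hi.const_mul _) (ae_of_all _ fun p => ?_)
  simpa using hg.abs_quot_dil_le hh one_pos p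

/-- Pointwise comparison of the integrands of `V_tr^1` and of the `H^{1/2}` inner product. -/
lemma TestFn.abs_indicator_quot_sub_le {B L R ε : ℝ} {g h : ℝ → ℝ} (hg : TestFn B L R g)
    (hh : TestFn B L R h) (hε : 0 < ε) {n E : ℝ} (hn0 : 0 < n) (hE : |E| ≤ 2 - ε)
    (hnn : 2 * R / ε ≤ n) (p : ℝ × ℝ) :
    |(Ioo (-2 : ℝ) 2 ×ˢ Ioo (-2 : ℝ) 2).indicator
        (fun p => quot (dil n E g) (dil n E h) p * vKernel p) p -
        quot (dil n E g) (dil n E h) p| ≤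
      4 * B ^ 2 * (1 + 4 / ε ^ 2) * (cross E (R / n) p * (1 + (p.1 - p.2) ^ 2)⁻¹) +
      16 * B ^ 2 / ε * (Ioo (-2 : ℝ) 2 ×ˢ Ioo (-2 : ℝ) 2).indicator
        (fun p => cross E (R / n) p * ((edge p.1)⁻¹ * (edge p.2)⁻¹)) p := by
  set φ := quot (dil n E g) (dil n E h) with hφ
  set S : Set (ℝ × ℝ) := Ioo (-2 : ℝ) 2 ×ˢ Ioo (-2 : ℝ) 2 with hS
  have hinc := hg.abs_increments_le hh hn0 (E := E) p
  have hcr := cross_nonneg E (R / n) p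
  have hnn1 : 0 ≤ 4 * B ^ 2 * (1 + 4 / ε ^ 2) *
      (cross E (R / n) p * (1 + (p.1 - p.2) ^ 2)⁻¹) := by positivity
  have hnn2 : 0 ≤ 16 * B ^ 2 / ε *
      S.indicator (fun p => cross E (R / n) p * ((edge p.1)⁻¹ * (edge p.2)⁻¹)) p := by
    refine mul_nonneg (by positivity) (indicator_nonneg (fun q _ => ?_) p)
    have := cross_nonneg E (R / n) q
    have := edge_nonneg q.1
    have := edge_nonneg q.2
    positivity
  by_cases hz : |p.1 - E| ≤ R / n ∨ |p.2 - E| ≤ R / n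
  swap
  · push Not at hz
    have hφ0 : φ p = 0 := by
      rw [hφ, quot, hg.dil_eq_zero hn0 hz.1, hg.dil_eq_zero hn0 hz.2]; simp
    have : S.indicator (fun p => φ p * vKernel p) p = 0 := by
      by_cases hpS : p ∈ S
      · rw [indicator_of_mem hpS, hφ0, zero_mul]
      · exact indicator_of_notMem hpS _
    rw [this, hφ0, sub_zero, abs_zero]
    positivity
  have hz' : |p.1| ≤ 2 - ε / 2 ∨ |p.2| ≤ 2 - ε / 2 :=
    hz.imp (abs_le_of_window hε hE hn0 hnn) (abs_le_of_window hε hE hn0 hnn)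
  by_cases hpS : p ∈ S
  · rw [indicator_of_mem hpS] at hnn2 ⊢
    rw [indicator_of_mem hpS]
    refine le_add_of_nonneg_of_le hnn1 ?_
    have hv := abs_vKernel_sub_one_le hpS.1 hpS.2
    have a1 := abs_le.2 ⟨hpS.1.1.le, hpS.1.2.le⟩
    have a2 := abs_le.2 ⟨hpS.2.1.le, hpS.2.2.le⟩
    -- One coordinate is at most 2 - ε/2 in absolute value and the other at most 2.
    have hP : ε ≤ 4 - p.1 * p.2 := by
      have h5 : p.1 * p.2 ≤ |p.1| * |p.2| := (le_abs_self _).trans_eq (abs_mul _ _)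
      rcases hz' with h6 | h6 <;> nlinarith [abs_nonneg p.1, abs_nonneg p.2]
    have hw0 : 0 ≤ (edge p.1)⁻¹ * (edge p.2)⁻¹ :=
      mul_nonneg (inv_nonneg.2 (edge_nonneg _)) (inv_nonneg.2 (edge_nonneg _))
    by_cases hxy : p.1 = p.2
    · have hφ0 : φ p = 0 := by rw [hφ, quot, hxy]; simp
      rw [hφ0, zero_mul, sub_zero, abs_zero]
      exact hnn2
    · have hxy' : 0 < (p.1 - p.2) ^ 2 := by
        have := sub_ne_zero.2 hxy; positivity
      have e2 : φ p * vKernel p - φ p = φ p * (vKernel p - 1) := by ring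
      rw [e2, abs_mul, hφ, quot_eq, abs_div, abs_of_pos hxy']
      calc _ ≤ 4 * B ^ 2 * cross E (R / n) p / (p.1 - p.2) ^ 2 *
            (4 * (p.1 - p.2) ^ 2 / ε * ((edge p.1)⁻¹ * (edge p.2)⁻¹)) := by
            gcongr
            refine hv.trans ?_
            gcongr
        _ = _ := by field_simp; ring
  · rw [indicator_of_notMem hpS, zero_sub, abs_neg]
    refine le_add_of_le_of_nonneg ?_ hnn2
    -- Outside the square one coordinate is in the window, hence ε/2 away from the edges, while the
    -- other has left (-2, 2).
    have hd : ε / 2 ≤ |p.1 - p.2| := by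
      by_contra! hlt
      rw [abs_lt] at hlt
      refine hpS ⟨?_, ?_⟩ <;> rcases hz' with h6 | h6 <;> rw [abs_le] at h6 <;>
        constructor <;> linarith
    have hd2 : (ε / 2) ^ 2 ≤ (p.1 - p.2) ^ 2 := by
      rw [← sq_abs (p.1 - p.2)]; gcongr
    have hd3 : 0 < (p.1 - p.2) ^ 2 := lt_of_lt_of_le (by positivity) hd2
    rw [hφ, quot_eq, abs_div, abs_of_pos hd3, div_le_iff₀ hd3]
    -- From (x - y)² ≥ ε²/4, the decay (x - y)⁻² is at most 1 + 4/ε² times the Cauchy kernel.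
    have h7 : 1 ≤ (1 + 4 / ε ^ 2) * (1 + (p.1 - p.2) ^ 2)⁻¹ * (p.1 - p.2) ^ 2 := by
      rw [← div_eq_mul_inv, div_mul_eq_mul_div, one_le_div (by positivity)]
      have h8 : 1 ≤ 4 / ε ^ 2 * (p.1 - p.2) ^ 2 := by
        rw [div_mul_eq_mul_div, one_le_div (by positivity)]; linarith
      linarith
    calc _ ≤ 4 * B ^ 2 * cross E (R / n) p * 1 := by rw [mul_one]; exact hinc
      _ ≤ 4 * B ^ 2 * cross E (R / n) p *
          ((1 + 4 / ε ^ 2) * (1 + (p.1 - p.2) ^ 2)⁻¹ * (p.1 - p.2) ^ 2) := by gcongr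
      _ = _ := by ring

/-- For n ≥ 2R/ε the pointwise comparison is integrated; the masses of its two majorants are O(1/n)
by `cross_cauchy` and `exists_integral_window_le`. For smaller n both quantities are bounded. -/
lemma exists_trLimit_sub_le (B L R ε : ℝ) (hε : 0 < ε) (hR : 0 ≤ R) :
    ∃ C, 0 ≤ C ∧ ∀ (g h : ℝ → ℝ) (n E : ℝ), TestFn B L R g → TestFn B L R h → 1 ≤ n →
      |E| ≤ 2 - ε →
      |trLimit (dil n E g) (dil n E h) - innerHhalf g h / (4 * π ^ 2)| ≤ C / n := by
  obtain ⟨C₁, hC₁, h₁⟩ := exists_integral_window_le ε R hε hR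
  set n₀ := 2 * R / ε with hn₀
  set K₁ := 2 * (L * n₀) ^ 2 + (L ^ 2 + 4 * B ^ 2) * (4 * R * π) with hK₁
  set K₂ := 4 * B ^ 2 * (1 + 4 / ε ^ 2) * (4 * R * π) + 16 * B ^ 2 / ε * (2 * π * C₁) with hK₂
  have hK₁0 : 0 ≤ K₁ * n₀ := by positivity
  have hK₂0 : 0 ≤ K₂ := by positivity
  refine ⟨K₁ * n₀ + K₂, by positivity, fun g h n E hg hh hn hE => ?_⟩
  have hn0 : 0 < n := by linarith
  have hgd := hg.toBddLip.dil hn0.le E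
  have hhd := hh.toBddLip.dil hn0.le E
  have hpi : 1 / (4 * π ^ 2) ≤ 1 := by
    rw [div_le_one (by positivity)]; nlinarith [pi_gt_three]
  rw [add_div]
  rcases le_total n n₀ with hnn | hnn
  · have hq : |trLimit (dil n E g) (dil n E h) - innerHhalf g h / (4 * π ^ 2)| ≤ K₁ := by
      refine (abs_sub _ _).trans (add_le_add ((abs_trLimit_le hgd hhd).trans ?_) ?_)
      · rw [mul_pow, mul_pow]; gcongr
      · rw [abs_div, abs_of_pos (by positivity : 0 < 4 * π ^ 2)]
        refine (div_le_self (abs_nonneg _) ?_).trans (abs_innerHhalf_le hg hh hR)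
        nlinarith [pi_gt_three]
    have := le_div_of_le_scale hq (by positivity) hn0 hnn
    have : 0 ≤ K₂ / n := by positivity
    linarith
  · set φ := quot (dil n E g) (dil n E h) with hφ
    set S : Set (ℝ × ℝ) := Ioo (-2 : ℝ) 2 ×ˢ Ioo (-2 : ℝ) 2 with hS
    have hSm : MeasurableSet S := measurableSet_Ioo.prod measurableSet_Ioo
    have hiφ : Integrable φ := hg.integrable_quot_dil hh hR E hn0
    have hiK : Integrable (S.indicator fun p => φ p * vKernel p) := by
      rw [integrable_indicator_iff hSm, IntegrableOn, ← bulk_prod]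
      exact integrable_quot_mul_vKernel hgd hhd
    have hW : Integrable
        (S.indicator fun p => cross E (R / n) p * ((edge p.1)⁻¹ * (edge p.2)⁻¹)) := by
      rw [integrable_indicator_iff hSm, IntegrableOn, ← bulk_prod]
      exact integrable_cross_mul_inv_edge _ _
    obtain ⟨hci, hce⟩ := cross_cauchy E (by positivity : 0 ≤ R / n)
    have e : trLimit (dil n E g) (dil n E h) - innerHhalf g h / (4 * π ^ 2) =
        1 / (4 * π ^ 2) * ∫ p, (S.indicator (fun p => φ p * vKernel p) p - φ p) := by
      rw [integral_sub hiK hiφ, innerHhalf_dil g h hn0 E, integral_indicator hSm, ← bulk_prod,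
        trLimit_eq]
      ring
    have hpt := hg.abs_indicator_quot_sub_le hh hε hn0 hE hnn
    rw [e, abs_mul, abs_of_pos (by positivity)]
    have hb : |∫ p, (S.indicator (fun p => φ p * vKernel p) p - φ p)| ≤ K₂ / n := by
      rw [← Real.norm_eq_abs]
      refine (norm_integral_le_of_norm_le ((hci.const_mul _).add (hW.const_mul _))
        (ae_of_all _ hpt)).trans ?_
      simp only [Pi.add_apply]
      rw [integral_add (hci.const_mul _) (hW.const_mul _), integral_const_mul, integral_const_mul,
        hce, integral_indicator hSm, ← bulk_prod, integral_cross_mul_inv_edge, hK₂]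
      have := h₁ n E hn hE
      calc _ ≤ 4 * B ^ 2 * (1 + 4 / ε ^ 2) * (4 * (R / n) * π) +
            16 * B ^ 2 / ε * (2 * π * (C₁ / n)) := by gcongr
        _ = _ := by ring
    have : 0 ≤ K₁ * n₀ / n := by positivity
    calc _ ≤ 1 * (K₂ / n) := by gcongr
      _ ≤ _ := by linarith

/-- When n ≥ 2R/δ, f times its reflection vanishes whenever the two arguments are closer than δ. The
quotient is therefore bounded by a multiple of δ⁻² on the windows and zero near the diagonal. -/
lemma exists_trLimit_separated_le (B L R ε δ : ℝ) (hε : 0 < ε) (hδ : 0 < δ) (hR : 0 ≤ R) :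
    ∃ C, 0 ≤ C ∧ ∀ (g : ℝ → ℝ) (n E : ℝ), TestFn B L R g → 1 ≤ n → |E| ≤ 2 - ε → δ ≤ |E| →
      |trLimit (dil n E g) (reflect (dil n E g))| ≤ C / n := by
  obtain ⟨C₁, hC₁, h₁⟩ := exists_integral_window_le ε R hε hR
  set n₀ := 2 * R / δ with hn₀
  set K₁ := 2 * (L * n₀) ^ 2 with hK₁
  set K₂ := B ^ 2 / δ ^ 2 * 8 * (2 * π * C₁) with hK₂
  have hK₁0 : 0 ≤ K₁ * n₀ := by positivity
  have hK₂0 : 0 ≤ K₂ := by positivity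
  refine ⟨K₁ * n₀ + K₂, by positivity, fun g n E hg hn hE hEδ => ?_⟩
  have hn0 : 0 < n := by linarith
  have hB := hg.nonneg_bdd
  have hgd := hg.toBddLip.dil hn0.le E
  rw [add_div]
  rcases le_total n n₀ with hnn | hnn
  · have hq : |trLimit (dil n E g) (reflect (dil n E g))| ≤ K₁ := by
      refine (abs_trLimit_le hgd hgd.reflect).trans ?_
      rw [hK₁, mul_pow, mul_pow]; gcongr
    have := le_div_of_le_scale hq (by positivity) hn0 hnn
    have : 0 ≤ K₂ / n := by positivity
    linarith
  · have hRn : R / n ≤ δ / 2 := by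
      rw [div_le_iff₀ hn0]
      rw [hn₀, div_le_iff₀ hδ] at hnn
      linarith
    set f := dil n E g with hf
    have hprod : ∀ x y, |x - y| < δ → f x * reflect f y = 0 := fun x y hxy =>
      hg.dil_mul_reflect_eq_zero hn0 hEδ (by linarith)
    have hfh : ∀ x y, |f x * reflect f y| ≤ B ^ 2 * window E (R / n) x := fun x y => by
      rw [abs_mul, pow_two, mul_assoc, mul_comm]
      exact mul_le_mul (hgd.reflect.bdd y) (hg.abs_dil_le hn0 x) (abs_nonneg _) hB
    have hq : ∀ p, |quot f (reflect f) p| ≤ B ^ 2 / δ ^ 2 * cross E (R / n) p := fun p => by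
      have h0 : ∀ x, f x * reflect f x = 0 := fun x => hprod x x (by simpa using hδ)
      -- Only the off-diagonal products survive, since f times its reflection is zero at every
      -- single point.
      have e : (f p.1 - f p.2) * (reflect f p.1 - reflect f p.2) =
          -(f p.1 * reflect f p.2) - f p.2 * reflect f p.1 := by
        linear_combination h0 p.1 + h0 p.2
      rw [quot_eq, e]
      by_cases hlt : |p.1 - p.2| < δ
      · rw [hprod _ _ hlt, hprod p.2 p.1 (by rwa [abs_sub_comm])]
        simp only [neg_zero, sub_zero, zero_div, abs_zero]
        exact mul_nonneg (by positivity) (cross_nonneg _ _ _)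
      · have h2 : δ ^ 2 ≤ (p.1 - p.2) ^ 2 := by
          rw [← sq_abs (p.1 - p.2)]
          have := not_lt.1 hlt
          gcongr
        rw [abs_div, abs_of_nonneg (sq_nonneg (p.1 - p.2)), div_mul_eq_mul_div]
        have h3 : |-(f p.1 * reflect f p.2) - f p.2 * reflect f p.1| ≤
            B ^ 2 * cross E (R / n) p := by
          refine (abs_sub _ _).trans ?_
          rw [abs_neg, cross, mul_add]
          exact add_le_add (hfh _ _) (hfh _ _)
        have := cross_nonneg E (R / n) p
        gcongr
    have hb : |∫ p, quot f (reflect f) p * vKernel p ∂bulk.prod bulk| ≤ K₂ / n := by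
      rw [← Real.norm_eq_abs]
      refine (norm_integral_le_of_norm_le
        ((integrable_cross_mul_inv_edge E (R / n)).const_mul (B ^ 2 / δ ^ 2 * 8)) ?_).trans ?_
      · filter_upwards [ae_bulk_prod] with p hp
        have hv := vKernel_bounds hp.1 hp.2
        have hc := cross_nonneg E (R / n) p
        rw [norm_mul, Real.norm_eq_abs, Real.norm_eq_abs, abs_of_pos hv.1]
        calc _ ≤ B ^ 2 / δ ^ 2 * cross E (R / n) p * (8 * ((edge p.1)⁻¹ * (edge p.2)⁻¹)) :=
              mul_le_mul (hq p) hv.2 hv.1.le (by positivity)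
          _ = _ := by ring
      · rw [integral_const_mul, integral_cross_mul_inv_edge, hK₂]
        have := h₁ n E hn hE
        calc _ ≤ B ^ 2 / δ ^ 2 * 8 * (2 * π * (C₁ / n)) := by gcongr
          _ = _ := by ring
    have hpi : 1 / (4 * π ^ 2) ≤ 1 := by
      rw [div_le_one (by positivity)]; nlinarith [pi_gt_three]
    rw [trLimit_eq, abs_mul, abs_of_pos (by positivity)]
    have : 0 ≤ K₁ * n₀ / n := by positivity
    calc _ ≤ 1 * (K₂ / n) := by gcongr
      _ ≤ _ := by linarith

/-! ### The main theorem -/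

lemma IsH2.testFn {g g₁ g₂ : ℝ → ℝ} (hg : IsH2 g g₁ g₂) {M R : ℝ} (hR : 0 ≤ R)
    (hsupp : tsupport g ⊆ Icc (-R) R) (hM : h2Norm g g₁ g₂ ≤ M) :
    TestFn ((M ^ 2 + 2 * (R + 2)) * (2 * R + 1)) (M ^ 2 + 2 * (R + 2)) R g := by
  have h0 : ∀ x, R < |x| → g x = 0 := fun x hx =>
    image_eq_zero_of_notMem_tsupport fun h => by
      have := abs_le.2 (hsupp h)
      linarith
  refine ⟨⟨fun x => ?_, hg.abs_sub_le hR hsupp hM⟩, h0⟩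
  by_cases hx : R < |x|
  · rw [h0 x hx, abs_zero]; positivity
  -- The sup bound compares x with R + 1, a point outside the support at distance at most 2R + 1.
  · have h1 := hg.abs_sub_le hR hsupp hM x (R + 1)
    rw [h0 (R + 1) (by rw [abs_of_nonneg (by linarith)]; linarith), sub_zero] at h1
    refine h1.trans ?_
    have h2 : |x - (R + 1)| ≤ 2 * R + 1 := by
      have := abs_le.1 (not_lt.1 hx)
      rw [abs_le]; constructor <;> linarith
    gcongr

lemma CN_eq {N : ℕ} {a : ℝ} (ha : 0 < a) (E : ℝ) :
    CN N a E = (N : ℝ) ^ a / rhoScale ((N : ℝ) ^ a) E := by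
  rw [CN, rhoN, if_pos ha, rhoScale, Real.rpow_neg (Nat.cast_nonneg N)]

end
end WignerMeso

open WignerMeso in
theorem mainTheorem6 (a ε δ : ℝ) (ha₀ : 0 < a) (ha₁ : a < 1) (hε : 0 < ε) (hδ : 0 < δ)
    (M R : ℝ) :
    ∃ C : ℝ, ∀ g g₁ g₂ : ℝ → ℝ, WignerMeso.IsH2 g g₁ g₂ →
      tsupport g ⊆ Set.Icc (-R) R → WignerMeso.h2Norm g g₁ g₂ ≤ M →
      ∀ (N : ℕ) (E : ℝ), 1 ≤ N → |E| ≤ 2 - ε →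
        -- the limits that define the quantities at `σ = ±1` exist
        WignerMeso.HasEndpointLimits
          (WignerMeso.Vtr2Interior (WignerMeso.rescale N a E g)) ∧
        WignerMeso.HasEndpointLimits
          (WignerMeso.Vd2Interior (WignerMeso.rescale N a E g)) ∧
        WignerMeso.HasEndpointLimits
          (WignerMeso.EtrInterior (WignerMeso.rescale N a E g)) ∧
        -- the terms that do not depend on `σ`
        |WignerMeso.Vtr1 (WignerMeso.rescale N a E g)
            - WignerMeso.innerHhalf g g / (4 * Real.pi ^ 2)| ≤ C * (N : ℝ) ^ (-a) ∧
        |WignerMeso.CN N a E * WignerMeso.Vd1 (WignerMeso.rescale N a E g)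
            - WignerMeso.innerL2 g g| ≤ C * (N : ℝ) ^ (-a) ∧
        -- the terms that depend on `σ`
        ∀ σ ∈ Set.Icc (-1 : ℝ) 1, (σ = -1 ∨ -1 + δ ≤ σ) →
          (σ = -1 → E = 0 ∨ δ ≤ |E|) →
          ((σ = 1 ∨ σ ≤ 1 - δ) →
            |WignerMeso.Vtr2 (WignerMeso.rescale N a E g) σ
              - (WignerMeso.ind (σ = 1) * (WignerMeso.innerHhalf g g / (4 * Real.pi ^ 2))
                + WignerMeso.ind (σ = -1) * WignerMeso.ind (E = 0) *
                  (WignerMeso.innerHhalf g (WignerMeso.reflect g) / (4 * Real.pi ^ 2)))|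
              ≤ C * (N : ℝ) ^ (-a) ∧
            |WignerMeso.CN N a E * WignerMeso.Vd2 (WignerMeso.rescale N a E g) σ
              - (WignerMeso.ind (σ = 1) * WignerMeso.innerL2 g g
                + WignerMeso.ind (σ = -1) * WignerMeso.ind (E = 0) *
                  WignerMeso.innerL2 g (WignerMeso.reflect g))|
              ≤ C * (N : ℝ) ^ (-a)) ∧
          |-(WignerMeso.Etr (WignerMeso.rescale N a E g) σ / 2)
            - WignerMeso.ind (σ = -1) * WignerMeso.ind (E = 0) * (g 0 / 2)|
            ≤ C * (N : ℝ) ^ (-a) := by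
  -- R may be negative; enlarging it keeps the support condition and makes the radius nonnegative.
  have hR' : 0 ≤ max R 1 := zero_le_one.trans (le_max_right _ _)
  set R' := max R 1
  set L := M ^ 2 + 2 * (R' + 2)
  set B := L * (2 * R' + 1)
  obtain ⟨C₁, hC₁, h₁⟩ := exists_trLimit_sub_le B L R' ε hε hR'
  obtain ⟨C₂, hC₂, h₂⟩ := exists_Vd_limit_le B L R' ε hε hR'
  obtain ⟨C₃, hC₃, h₃⟩ := exists_trLimit_separated_le B L R' ε δ hε hδ hR'
  obtain ⟨C₄, hC₄, h₄⟩ := exists_Vd_separated_le B L R' ε δ hε hδ hR'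
  obtain ⟨C₅, hC₅, h₅⟩ := exists_Vtr2Interior_le B L R' ε δ hε hδ hR'
  obtain ⟨C₆, hC₆, h₆⟩ := exists_Vd2Interior_le B L R' ε δ hε hδ hR'
  obtain ⟨C₇, hC₇, h₇⟩ := exists_Etr_le B L R' ε δ hε hδ hR'
  refine ⟨C₁ + C₂ + C₃ + C₄ + C₅ + C₆ + C₇, fun g g₁ g₂ hg hsupp hM N E hN hE => ?_⟩
  have hgt : TestFn B L R' g := hg.testFn hR'
    (hsupp.trans (Icc_subset_Icc (neg_le_neg (le_max_left _ _)) (le_max_left _ _))) hM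
  set n : ℝ := (N : ℝ) ^ a with hn_def
  have hn : 1 ≤ n := Real.one_le_rpow (by exact_mod_cast hN) ha₀.le
  have hn0 : 0 < n := by linarith
  have hf : rescale N a E g = dil n E g := rfl
  have hgd := hgt.toBddLip.dil hn0.le E
  rw [hf, CN_eq ha₀, ← hn_def, Real.rpow_neg (Nat.cast_nonneg N), ← hn_def]
  have wk : ∀ {q c : ℝ}, q ≤ c / n → c ≤ C₁ + C₂ + C₃ + C₄ + C₅ + C₆ + C₇ →
      q ≤ (C₁ + C₂ + C₃ + C₄ + C₅ + C₆ + C₇) * n⁻¹ := fun h1 h2 => by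
    rw [← div_eq_mul_inv]
    exact h1.trans (by gcongr)
  refine ⟨⟨⟨_, tendsto_Vtr2Interior_one hgd⟩, ⟨_, tendsto_Vtr2Interior_neg_one hgd⟩⟩,
    ⟨⟨_, tendsto_Vd2Interior_one hgd⟩, ⟨_, tendsto_Vd2Interior_neg_one hgd⟩⟩,
    ⟨⟨_, tendsto_EtrInterior_one hgd⟩, ⟨_, tendsto_EtrInterior_neg_one hgd⟩⟩, ?_, ?_, ?_⟩
  · rw [Vtr1_eq]
    exact wk (h₁ g g n E hgt hgt hn hE) (by linarith)
  · rw [Vd1]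
    simp_rw [pow_two (dil n E g _)]
    exact wk (h₂ g g n E hgt hgt hn hE) (by linarith)
  intro σ hσ hσδ hEδ
  refine ⟨fun hσ1 => ?_, wk (h₇ g n E σ hgt hn hE hσ hσδ hEδ) (by linarith)⟩
  by_cases h1 : σ = 1
  · subst h1
    have i1 : ind ((1 : ℝ) = 1) = 1 := if_pos rfl
    have i2 : ind ((1 : ℝ) = -1) = 0 := if_neg (by norm_num)
    rw [i1, i2, Vtr2, Vd2, extendToEndpoints_one (tendsto_Vtr2Interior_one hgd),
      extendToEndpoints_one (tendsto_Vd2Interior_one hgd)]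
    simp only [one_mul, zero_mul, add_zero]
    exact ⟨wk (h₁ g g n E hgt hgt hn hE) (by linarith),
      wk (h₂ g g n E hgt hgt hn hE) (by linarith)⟩
  by_cases h2 : σ = -1
  · subst h2
    have i1 : ind ((-1 : ℝ) = 1) = 0 := if_neg (by norm_num)
    have i2 : ind ((-1 : ℝ) = -1) = 1 := if_pos rfl
    rw [i1, i2, Vtr2, Vd2, extendToEndpoints_neg_one (tendsto_Vtr2Interior_neg_one hgd),
      extendToEndpoints_neg_one (tendsto_Vd2Interior_neg_one hgd)]
    by_cases hE0 : E = 0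
    · subst hE0
      have i3 : ind ((0 : ℝ) = 0) = 1 := if_pos rfl
      -- At E = 0 the reflection of f is the rescaling of the reflected g, so the polarized
      -- asymptotics apply to g and its reflection.
      rw [i3, reflect_dil_zero]
      simp only [one_mul, zero_mul, zero_add]
      exact ⟨wk (h₁ g (reflect g) n 0 hgt hgt.reflect hn hE) (by linarith),
        wk (h₂ g (reflect g) n 0 hgt hgt.reflect hn hE) (by linarith)⟩
    · have i3 : ind (E = 0) = 0 := if_neg hE0
      have hEδ' := (hEδ rfl).resolve_left hE0
      rw [i3]
      simp only [mul_zero, zero_mul, add_zero, sub_zero]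
      exact ⟨wk (h₃ g n E hgt hn hE hEδ') (by linarith),
        wk (h₄ g n E hgt hn hE hEδ') (by linarith)⟩
  · have i1 : ind (σ = 1) = 0 := if_neg h1
    have i2 : ind (σ = -1) = 0 := if_neg h2
    have h3 : |σ| < 1 := abs_lt.2 ⟨lt_of_le_of_ne hσ.1 (Ne.symm h2), lt_of_le_of_ne hσ.2 h1⟩
    have h4 : |σ| ≤ 1 - δ := by
      have := hσ1.resolve_left h1
      have := hσδ.resolve_left h2
      rw [abs_le]; constructor <;> linarith
    rw [i1, i2, Vtr2, Vd2, extendToEndpoints_of_abs_lt h3, extendToEndpoints_of_abs_lt h3]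
    simp only [zero_mul, add_zero, sub_zero]
    exact ⟨wk (h₅ g n E σ hgt hn hE h4) (by linarith),
      wk (h₆ g n E σ hgt hn hE h4) (by linarith)⟩
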